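/- Let $M$ be a smooth finite-dimensional manifold (Hausdorff, second countable, without boundary) and let $\pi:A\to M$ be a smooth affine bundle of rank $n$. A *Jacobi structure* on a manifold $N$ is a pair $(\Lambda,E)$ of a smooth bivector field and a smooth vector field with $[\Lambda,\Lambda]=-2E\wedge\Lambda$ and $[E,\Lambda]=0$, where the sign of the Schouten bracket is such that it is a graded Lie bracket, i.e. $[\Lambda,\Lambda](df,dg,dh)=2\big(\Lambda(df,d(\Lambda(dg,dh)))+\text{cyclic}\big)$. Its *Jacobi bracket* is $\{f,g\}_{(\Lambda,E)}=\Lambda(df,dg)+fE(g)-gE(f)$. A *Poisson structure* is a smooth bivector field $\Lambda$ with $[\Lambda,\Lambda]=0$, and its bracket is $\{f,g\}_\Lambda=\Lambda(df,dg)$. A Jacobi structure on $A$ (or its bracket) is *affine* if the bracket of any two affine functions is an affine function, where an affine function is a smooth function on $A$ that is affine on every fibre $A_p$. Let $A^+=\bigcup_{p\in M}\mathrm{Aff}(A_p,\mathbb R)$ be the vector bundle of affine functionals and $\hat A=(A^+)^*$ its dual bundle, with Liouville vector field $\Delta_{\hat A}$. The bundle $A$ is included in $\hat A$ by sending a point of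 $A_p$ to the evaluation at it. An affine function $a:A\to\mathbb R$ corresponds to the linear function $\bar a:\hat A\to\mathbb R$, $\bar a(\psi_p)=\psi_p(a|_{A_p})$, and $\iota_{\tilde 1}=\bar 1$ corresponds to the constant function $1$. A Poisson structure $\bar\Lambda$ on $\hat A$ is *homogeneous* (linear) if $\mathcal L_{\Delta_{\hat A}}\bar\Lambda=-\bar\Lambda$. 1. If $n>0$, there is a one-to-one correspondence between affine Jacobi brackets $\{\cdot,\cdot\}_{(\Lambda_A,E_A)}$ on $A$ and homogeneous Poisson brackets $\{\cdot,\cdot\}_{\bar\Lambda_{\hat A}}$ on $\hat A$, uniquely determined by $$\{a,b\}_{(\Lambda_A,E_A)}=\big(\{\bar a,\bar b\}_{\bar\Lambda_{\hat A}}\big)_{|A}\qquad\text{for all affine functions } a,b:A\to\mathbb R.$$ Moreover, let $E_{\hat A}$ be the hamiltonian vector field of $\iota_{\tilde 1}$ with respect to $\bar\Lambda_{\hat A}$, i.e. $E_{\hat A}(f)=\bar\Lambda_{\hat A}(d\iota_{\tilde 1},df)$. Then $(\bar\Lambda_{\hat A}-\Delta_{\hat A}\wedge E_{\hat A},\,E_{\hat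 A})$ is a Jacobi structure on $\hat A$ whose tensors are tangent to $A$ along $A$, and $(\Lambda_A,E_A)$ is its restriction to $A$. 2. If $n=0$, every (affine) Jacobi structure $(\Lambda_A,E_A)$ on $A$ induces a unique Jacobi structure $(\Lambda,E)$ on $M$ that is related to it by the bijection $\pi:A\to M$. Let $t$ be the coordinate on $\mathbb R\setminus\{0\}$, and call a Poisson tensor $\bar\Lambda$ on $M\times(\mathbb R\setminus\{0\})$ *linear* if for all $f,g\in C^\infty(M)$ there is $h\in C^\infty(M)$ with $\bar\Lambda(d(tf),d(tg))=th$. Then there is a one-to-one correspondence between affine Jacobi brackets $\{\cdot,\cdot\}_{(\Lambda_A,E_A)}$ on $A$ and linear Poisson tensors $\bar\Lambda$ on $M\times(\mathbb R\setminus\{0\})$, uniquely determined by $$\bar\Lambda(d(tf),d(tg))=t\,\{f,g\}_{(\Lambda,E)}\qquad\text{for all } f,g\in C^\infty(M),$$ and this linear Poisson tensor is $$\bar\Lambda=\frac1t\,\Lambda+\frac{\partial}{\partial t}\wedge E.$$ -/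

import Mathlib

open Set Bundle Module
open scoped Manifold ContDiff Topology

noncomputable section

/-! ### Affine bundles -/

section AffineBundles

variable {M : Type*} [TopologicalSpace M]
  (F : Type*) [NormedAddCommGroup F] [NormedSpace ℝ F]
  {V : M → Type*} [∀ x, AddCommGroup (V x)] [∀ x, Module ℝ (V x)]
  (E : M → Type*) [∀ x, AddTorsor (V x) (E x)]

/-- A locally trivial bundle `E` over `M` whose fibre `E x` is an affine space modelled on the
vector space `V x` is an affine bundle if its trivializations are affine isomorphisms on the
fibres. The trivializations then pass from one to another by affine transformations of `F`, and
their linear parts make `V` a vector bundle. The rank is `finrank ℝ F`. -/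
class IsAffineBundle [TopologicalSpace (TotalSpace F E)] [∀ x, TopologicalSpace (E x)]
    [FiberBundle F E] : Prop where
  affine : ∀ (e : Trivialization F (π F E)) [MemTrivializationAtlas e], ∀ x ∈ e.baseSet,
    ∃ φ : E x ≃ᵃ[ℝ] F, ∀ p : E x, (e ⟨x, p⟩).2 = φ p

/-- A smooth affine bundle: the changes of trivialization are smooth. -/
class IsSmoothAffineBundle {EM : Type*} [NormedAddCommGroup EM] [NormedSpace ℝ EM]
    {H : Type*} [TopologicalSpace H] (I : ModelWithCorners ℝ EM H) [ChartedSpace H M]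
    [TopologicalSpace (TotalSpace F E)] [∀ x, TopologicalSpace (E x)]
    [FiberBundle F E] : Prop extends IsAffineBundle F E where
  smooth : ∀ (e e' : Trivialization F (π F E)) [MemTrivializationAtlas e]
    [MemTrivializationAtlas e'],
    ContMDiffOn (I.prod 𝓘(ℝ, F)) 𝓘(ℝ, F) ∞
      (fun q : M × F => (e' (e.toOpenPartialHomeomorph.symm q)).2)
      ((e.baseSet ∩ e'.baseSet) ×ˢ univ)

/-- The affine isomorphism from the fibre over `x` to `F` given by a trivialization `e` (when `x`
is outside the base set of `e`, the preferred trivialization at `x` is used instead). -/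
def fibreAff [TopologicalSpace (TotalSpace F E)] [∀ x, TopologicalSpace (E x)]
    [FiberBundle F E] [h : IsAffineBundle F E] (e : Trivialization F (π F E))
    [MemTrivializationAtlas e] (x : M) : E x ≃ᵃ[ℝ] F :=
  open Classical in
  if hx : x ∈ e.baseSet then (h.affine e x hx).choose
  else (h.affine (trivializationAt F E x) x (mem_baseSet_trivializationAt F E x)).choose

theorem fibreAff_apply [TopologicalSpace (TotalSpace F E)] [∀ x, TopologicalSpace (E x)]
    [FiberBundle F E] [h : IsAffineBundle F E] (e : Trivialization F (π F E))
    [MemTrivializationAtlas e] {x : M} (hx : x ∈ e.baseSet) (p : E x) :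
    fibreAff F E e x p = (e ⟨x, p⟩).2 := by
  unfold fibreAff
  rw [dif_pos hx]
  exact ((h.affine e x hx).choose_spec p).symm

/-- For a finite-dimensional vector space `F`, the dual of the space of affine functions on an
affine space `P` is identified, through an affine isomorphism `φ : P ≃ F`, with `ℝ × F`: the pair
`(t, v)` is the functional `a ↦ t * b 0 + b.linear v`, where `b = a ∘ φ⁻¹`. -/
def hullCoord [FiniteDimensional ℝ F] {W P : Type*} [AddCommGroup W] [Module ℝ W]
    [AddTorsor W P] (φ : P ≃ᵃ[ℝ] F) : Dual ℝ (P →ᵃ[ℝ] ℝ) ≃ₗ[ℝ] ℝ × F where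
  toFun ψ := (ψ (AffineMap.const ℝ P 1),
    (evalEquiv ℝ F).symm
      { toFun := fun ℓ => ψ (ℓ.toAffineMap.comp φ.toAffineMap)
        map_add' := fun ℓ ℓ' => by rw [← map_add]; rfl
        map_smul' := fun c ℓ => by rw [RingHom.id_apply, ← map_smul]; rfl })
  invFun y :=
    { toFun := fun a => y.1 * a (φ.symm 0) + (a.comp φ.symm.toAffineMap).linear y.2
      map_add' := fun a b => by
        simp only [AffineMap.coe_add, Pi.add_apply, AffineMap.comp_linear, AffineMap.add_linear,
          LinearMap.comp_apply, LinearMap.add_apply]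
        ring
      map_smul' := fun c a => by
        simp only [AffineMap.coe_smul, Pi.smul_apply, AffineMap.comp_linear,
          AffineMap.smul_linear, LinearMap.comp_apply, LinearMap.smul_apply, smul_eq_mul,
          RingHom.id_apply]
        ring }
  map_add' ψ ψ' := by
    refine Prod.ext rfl ?_
    rw [Prod.snd_add, ← map_add]
    rfl
  map_smul' c ψ := by
    refine Prod.ext rfl ?_
    rw [RingHom.id_apply, Prod.smul_snd, ← map_smul]
    rfl
  left_inv ψ := by
    ext a
    have key : a = (a (φ.symm 0)) • AffineMap.const ℝ P (1 : ℝ) +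
        ((a.comp φ.symm.toAffineMap).linear.toAffineMap.comp φ.toAffineMap) := by
      ext p
      have := congrFun (AffineMap.decomp (a.comp φ.symm.toAffineMap)) (φ p)
      simp at this
      simp [this]
      ring
    conv_rhs => rw [key, map_add, map_smul]
    simp only [LinearMap.coe_mk, AddHom.coe_mk, smul_eq_mul]
    rw [mul_comm]
    congr 1
    exact Module.apply_evalEquiv_symm_apply (R := ℝ) (M := F) _ _
  right_inv y := by
    refine Prod.ext (by simp) ?_
    change (evalEquiv ℝ F).symm _ = _
    rw [LinearEquiv.symm_apply_eq]
    ext ℓ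
    simp

theorem hullCoord_comp_symm [FiniteDimensional ℝ F] {W P : Type*} [AddCommGroup W] [Module ℝ W]
    [AddTorsor W P] (φ φ' : P ≃ᵃ[ℝ] F) (y : ℝ × F) :
    hullCoord F φ' ((hullCoord F φ).symm y) =
      (y.1, y.1 • φ' (φ.symm 0) + (φ' (φ.symm y.2) - φ' (φ.symm 0))) := by
  refine Prod.ext (by simp [hullCoord]) ?_
  change (evalEquiv ℝ F).symm _ = _
  rw [LinearEquiv.symm_apply_eq]
  ext ℓ
  have : φ' (φ.symm y.2) - φ' (φ.symm 0) = φ'.linear (φ.symm.linear y.2) := by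
    have h1 := (φ.symm.trans φ').toAffineMap.linearMap_vsub y.2 0
    simpa using h1.symm
  rw [this]
  simp [hullCoord]

/-! ### The vector hull -/

/-- The fibres of the vector hull of an affine bundle: the dual space of the vector space of
affine functions on the fibre `E x`. -/
@[nolint unusedArguments]
def Hull (_F : Type*) (E : M → Type*) [∀ x, AddTorsor (V x) (E x)] (x : M) : Type _ :=
  Dual ℝ (E x →ᵃ[ℝ] ℝ)

instance (x : M) : AddCommGroup (Hull F E x) :=
  inferInstanceAs (AddCommGroup (Dual ℝ (E x →ᵃ[ℝ] ℝ)))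

instance (x : M) : Module ℝ (Hull F E x) :=
  inferInstanceAs (Module ℝ (Dual ℝ (E x →ᵃ[ℝ] ℝ)))

/-- An element of the hull is a functional on affine functions. -/
def Hull.eval {F : Type*} {E : M → Type*} [∀ x, AddTorsor (V x) (E x)] {x : M}
    (ψ : Hull F E x) (a : E x →ᵃ[ℝ] ℝ) : ℝ :=
  (show Dual ℝ (E x →ᵃ[ℝ] ℝ) from ψ) a

variable [FiniteDimensional ℝ F]
  [TopologicalSpace (TotalSpace F E)] [∀ x, TopologicalSpace (E x)]
  [FiberBundle F E] [IsAffineBundle F E]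

/-- The linear coordinates on the fibre of the hull induced by a trivialization of the affine
bundle. -/
def hullFibre (e : Trivialization F (π F E)) [MemTrivializationAtlas e] (x : M) :
    Hull F E x ≃ₗ[ℝ] ℝ × F :=
  hullCoord F (fibreAff F E e x)

instance (x : M) : TopologicalSpace (Hull F E x) :=
  TopologicalSpace.induced (hullFibre F E (trivializationAt F E x) x) inferInstance

/-- The local trivialization of the hull induced by a trivialization of the affine bundle. -/
def hullPretriv (e : Trivialization F (π F E)) [MemTrivializationAtlas e] :
    Pretrivialization (ℝ × F) (π (ℝ × F) (Hull F E)) where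
  toFun ψ := (ψ.1, hullFibre F E e ψ.1 ψ.2)
  invFun q := ⟨q.1, (hullFibre F E e q.1).symm q.2⟩
  source := π (ℝ × F) (Hull F E) ⁻¹' e.baseSet
  target := e.baseSet ×ˢ univ
  map_source' ψ hψ := ⟨hψ, mem_univ _⟩
  map_target' q hq := hq.1
  left_inv' ψ _ := by simp
  right_inv' q _ := by simp
  open_target := e.open_baseSet.prod isOpen_univ
  baseSet := e.baseSet
  open_baseSet := e.open_baseSet
  source_eq := rfl
  target_eq := rfl
  proj_toFun _ _ := rfl

theorem hullPretriv_symm (e : Trivialization F (π F E)) [MemTrivializationAtlas e] {x : M}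
    (hx : x ∈ e.baseSet) (y : ℝ × F) :
    (hullPretriv F E e).symm x y = (hullFibre F E e x).symm y := by
  have h : x ∈ (hullPretriv F E e).baseSet := hx
  apply (hullFibre F E e x).injective
  have := (hullPretriv F E e).apply_mk_symm h y
  rw [LinearEquiv.apply_symm_apply]
  exact congrArg Prod.snd this

theorem continuousOn_hullChange (e e' : Trivialization F (π F E)) [MemTrivializationAtlas e]
    [MemTrivializationAtlas e'] :
    ContinuousOn (fun x => LinearMap.toContinuousLinearMap
      ((hullFibre F E e' x).toLinearMap ∘ₗ (hullFibre F E e x).symm.toLinearMap))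
      (e.baseSet ∩ e'.baseSet) := by
  rw [continuousOn_clm_apply]
  intro y
  have hg : ∀ v : F, ContinuousOn (fun x => fibreAff F E e' x ((fibreAff F E e x).symm v))
      (e.baseSet ∩ e'.baseSet) := by
    intro v
    have hc : ContinuousOn (fun x => (e' (e.toOpenPartialHomeomorph.symm (x, v))).2)
        (e.baseSet ∩ e'.baseSet) := by
      have h1 : ContinuousOn (fun x : M => e.toOpenPartialHomeomorph.symm (x, v))
          (e.baseSet ∩ e'.baseSet) :=
        e.toOpenPartialHomeomorph.symm.continuousOn.comp
          (by fun_prop) (fun x hx => by simpa [e.target_eq] using hx.1)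
      refine continuous_snd.comp_continuousOn (e'.continuousOn.comp h1 ?_)
      intro x hx
      rw [e'.mem_source]
      have := e.proj_symm_apply (x := (x, v)) (by simpa [e.target_eq] using hx.1)
      exact this ▸ hx.2
    refine hc.congr fun x hx => ?_
    have h2 : e.toOpenPartialHomeomorph.symm (x, v) = ⟨x, (fibreAff F E e x).symm v⟩ := by
      have hs : (⟨x, (fibreAff F E e x).symm v⟩ : TotalSpace F E) ∈ e.source := by
        rw [e.mem_source]; exact hx.1
      have h3 : e ⟨x, (fibreAff F E e x).symm v⟩ = (x, v) := by
        refine Prod.ext (e.coe_fst' hx.1) ?_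
        rw [← fibreAff_apply F E e hx.1]
        simp
      rw [← h3]
      exact e.toOpenPartialHomeomorph.left_inv hs
    simp only
    rw [h2, fibreAff_apply F E e' hx.2]
  have : ∀ x, (LinearMap.toContinuousLinearMap
      ((hullFibre F E e' x).toLinearMap ∘ₗ (hullFibre F E e x).symm.toLinearMap)) y =
      (y.1, y.1 • fibreAff F E e' x ((fibreAff F E e x).symm 0) +
        (fibreAff F E e' x ((fibreAff F E e x).symm y.2) -
          fibreAff F E e' x ((fibreAff F E e x).symm 0))) :=
    fun x => hullCoord_comp_symm F _ _ y
  simp only [this]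
  exact continuousOn_const.prodMk
    (((hg 0).const_smul y.1).add ((hg y.2).sub (hg 0)))

/-- The vector hull is a vector bundle with model fibre `ℝ × F`, trivialized by the coordinates
that the trivializations of the affine bundle induce. -/
def hullPrebundle : VectorPrebundle ℝ (ℝ × F) (Hull F E) where
  pretrivializationAtlas := {q | ∃ (e : Trivialization F (π F E)) (_ : MemTrivializationAtlas e),
    q = hullPretriv F E e}
  pretrivialization_linear' := by
    rintro _ ⟨e, _, rfl⟩
    exact ⟨fun x _ => (hullFibre F E e x).toLinearMap.isLinear⟩
  pretrivializationAt x := hullPretriv F E (trivializationAt F E x)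
  mem_base_pretrivializationAt x := mem_baseSet_trivializationAt F E x
  pretrivialization_mem_atlas x := ⟨trivializationAt F E x, inferInstance, rfl⟩
  exists_coordChange := by
    rintro _ ⟨e, _, rfl⟩ _ ⟨e', _, rfl⟩
    refine ⟨_, continuousOn_hullChange F E e e', fun x hx y => ?_⟩
    rw [hullPretriv_symm F E e hx.1]
    rfl
  totalSpaceMk_isInducing x := by
    have h : Topology.IsInducing (hullFibre F E (trivializationAt F E x) x) := ⟨rfl⟩
    exact (Topology.isInducing_const_prod (x := x)).2 h

instance : TopologicalSpace (TotalSpace (ℝ × F) (Hull F E)) :=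
  (hullPrebundle F E).totalSpaceTopology

instance : FiberBundle (ℝ × F) (Hull F E) :=
  (hullPrebundle F E).toFiberBundle

instance : VectorBundle ℝ (ℝ × F) (Hull F E) :=
  (hullPrebundle F E).toVectorBundle

end AffineBundles

/-! ### Vector fields, bivector fields, Jacobi and Poisson structures -/

section Tensors

variable {EN : Type*} [NormedAddCommGroup EN] [NormedSpace ℝ EN]
  {HN : Type*} [TopologicalSpace HN] (I : ModelWithCorners ℝ EN HN)
  {N : Type*} [TopologicalSpace N] [ChartedSpace HN N]

/-- The cotangent space at `x` (the manifolds considered are finite dimensional). -/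
abbrev Cotangent (x : N) : Type _ := Dual ℝ (TangentSpace I x)

/-- The differential at `x` of a real function. -/
def dif (f : N → ℝ) (x : N) : Cotangent I x := (mvfderiv I f x).toLinearMap

/-- Bivectors at `x`: elements of `⋀² TₓN`, viewed as alternating bilinear forms on the cotangent
space. -/
abbrev Bivector (x : N) : Type _ := Cotangent I x [⋀^Fin 2]→ₗ[ℝ] ℝ

/-- The wedge product `u ∧ v`, with `(u ∧ v)(α, β) = α(u) β(v) - α(v) β(u)`. -/
def wedge {x : N} (u v : TangentSpace I x) : Bivector I x :=
  (Matrix.detRowAlternating (n := Fin 2) (R := ℝ)).compLinearMap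
    (LinearMap.pi ![Dual.eval ℝ (TangentSpace I x) u, Dual.eval ℝ (TangentSpace I x) v])

/-- `#Λ(α)`: the tangent vector such that `β(#Λ(α)) = Λ(α, β)` for all covectors `β`. -/
def sharp [FiniteDimensional ℝ EN] {x : N} (Λ : Bivector I x) (α : Cotangent I x) :
    TangentSpace I x :=
  haveI : FiniteDimensional ℝ (TangentSpace I x) := inferInstanceAs (FiniteDimensional ℝ EN)
  (evalEquiv ℝ (TangentSpace I x)).symm
    { toFun := fun β => Λ ![α, β]
      map_add' := fun β β' => by
        have hu : ∀ γ : Cotangent I x, Function.update ![α, 0] 1 γ = ![α, γ] := fun γ => by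
          ext i : 1
          fin_cases i <;> rfl
        have h := Λ.map_update_add ![α, 0] 1 β β'
        simp only [hu] at h
        exact h
      map_smul' := fun c β => by
        have hu : ∀ γ : Cotangent I x, Function.update ![α, 0] 1 γ = ![α, γ] := fun γ => by
          ext i : 1
          fin_cases i <;> rfl
        have h := Λ.map_update_smul ![α, 0] 1 c β
        simp only [hu] at h
        exact h }

variable {I} in
/-- `X(f)`, for a vector field `X` and a function `f`. -/
def lieFun (X : ∀ x : N, TangentSpace I x) (f : N → ℝ) : N → ℝ :=
  fun x => dif I f x (X x)

variable {I} in
/-- `Λ(df, dg)`, for a bivector field `Λ` and functions `f`, `g`. For a Poisson structure this is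
the Poisson bracket of `f` and `g`. -/
def pairing (Λ : ∀ x : N, Bivector I x) (f g : N → ℝ) : N → ℝ :=
  fun x => Λ x ![dif I f x, dif I g x]

variable {I} in
/-- The Lie derivative `[X, Λ] = £_X Λ` of a bivector field, evaluated on `(df, dg)`. -/
def lieBivector (X : ∀ x : N, TangentSpace I x) (Λ : ∀ x : N, Bivector I x) (f g : N → ℝ) :
    N → ℝ :=
  lieFun X (pairing Λ f g) - pairing Λ (lieFun X f) g - pairing Λ f (lieFun X g)

variable {I} in
/-- The Schouten bracket `[Λ, Λ']` of two bivector fields, evaluated on `(df, dg, dh)`, with the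
sign for which the Schouten bracket is a graded Lie bracket; in particular
`[Λ, Λ](df, dg, dh) = 2 (Λ(df, dΛ(dg, dh)) + cyclic permutations)`. -/
def schouten (Λ Λ' : ∀ x : N, Bivector I x) (f g h : N → ℝ) : N → ℝ :=
  pairing Λ f (pairing Λ' g h) + pairing Λ' f (pairing Λ g h) +
  (pairing Λ g (pairing Λ' h f) + pairing Λ' g (pairing Λ h f)) +
  (pairing Λ h (pairing Λ' f g) + pairing Λ' h (pairing Λ f g))

variable {I} in
/-- The trivector field `X ∧ Λ`, evaluated on `(df, dg, dh)`. -/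
def wedgeVB (X : ∀ x : N, TangentSpace I x) (Λ : ∀ x : N, Bivector I x) (f g h : N → ℝ) :
    N → ℝ :=
  lieFun X f * pairing Λ g h + lieFun X g * pairing Λ h f + lieFun X h * pairing Λ f g

/-- Smooth real functions. -/
abbrev SmoothFun (f : N → ℝ) : Prop := ContMDiff I 𝓘(ℝ, ℝ) ∞ f

/-- Smooth vector fields: those that map smooth functions to smooth functions. -/
def SmoothVectorField (X : ∀ x : N, TangentSpace I x) : Prop :=
  ∀ f, SmoothFun I f → SmoothFun I (lieFun X f)

/-- Smooth bivector fields: those that map differentials of smooth functions to smooth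
functions. -/
def SmoothBivectorField (Λ : ∀ x : N, Bivector I x) : Prop :=
  ∀ f g, SmoothFun I f → SmoothFun I g → SmoothFun I (pairing Λ f g)

variable (N)

/-- A Jacobi structure: a bivector field `Λ` and a vector field `E` with `[Λ, Λ] = -2 E ∧ Λ` and
`[E, Λ] = 0`. A trivector or bivector field is determined by its values on the differentials of
smooth functions. -/
@[ext]
structure JacobiStructure where
  Λ : ∀ x : N, Bivector I x
  E : ∀ x : N, TangentSpace I x
  smoothΛ : SmoothBivectorField I Λ
  smoothE : SmoothVectorField I E
  schouten_self : ∀ f g h : N → ℝ, SmoothFun I f → SmoothFun I g → SmoothFun I h →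
    schouten Λ Λ f g h = (-2 : ℝ) • wedgeVB E Λ f g h
  lie_E : ∀ f g : N → ℝ, SmoothFun I f → SmoothFun I g → lieBivector E Λ f g = 0

/-- A Poisson structure: a bivector field `Λ` with `[Λ, Λ] = 0`. -/
@[ext]
structure PoissonStructure where
  Λ : ∀ x : N, Bivector I x
  smoothΛ : SmoothBivectorField I Λ
  schouten_self : ∀ f g h : N → ℝ, SmoothFun I f → SmoothFun I g → SmoothFun I h →
    schouten Λ Λ f g h = 0

variable {I N}

/-- The Jacobi bracket `{f, g} = Λ(df, dg) + f E(g) - g E(f)`. -/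
def JacobiStructure.bracket (J : JacobiStructure I N) (f g : N → ℝ) : N → ℝ :=
  pairing J.Λ f g + f * lieFun J.E g - g * lieFun J.E f

/-- The Poisson bracket `{f, g} = Λ(df, dg)`. -/
def PoissonStructure.bracket (P : PoissonStructure I N) (f g : N → ℝ) : N → ℝ :=
  pairing P.Λ f g

/-- A bivector field `Λ` is homogeneous with respect to a vector field `X` if `£_X Λ = -Λ`. -/
def IsHomogeneous (X : ∀ x : N, TangentSpace I x) (Λ : ∀ x : N, Bivector I x) : Prop :=
  ∀ f g : N → ℝ, SmoothFun I f → SmoothFun I g → lieBivector X Λ f g = -pairing Λ f g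

variable {EN' : Type*} [NormedAddCommGroup EN'] [NormedSpace ℝ EN']
  {HN' : Type*} [TopologicalSpace HN'] {I' : ModelWithCorners ℝ EN' HN'}
  {N' : Type*} [TopologicalSpace N'] [ChartedSpace HN' N']

variable (I I') in
/-- The image of a bivector at `x` under the tangent map of `φ` at `x`. -/
def pushBivector (φ : N → N') (x : N) (Λ : Bivector I x) : Bivector I' (φ x) :=
  Λ.compLinearMap (mfderiv I I' φ x).toLinearMap.dualMap

/-- `J` and `K` are related by `φ`: the tangent map of `φ` sends the tensors of `J` at `x` to those
of `K` at `φ x`, for all `x`. When `φ` is the inclusion of a submanifold, this says that the tensors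
of `K` are tangent to the submanifold and that `J` is their restriction to it. -/
def IsRelated (φ : N → N') (J : JacobiStructure I N) (K : JacobiStructure I' N') : Prop :=
  ∀ x, K.E (φ x) = mfderiv I I' φ x (J.E x) ∧ K.Λ (φ x) = pushBivector I I' φ x (J.Λ x)

end Tensors

/-! ### Affine Jacobi structures and homogeneous Poisson structures -/

section Affine

variable {EM : Type*} [NormedAddCommGroup EM] [NormedSpace ℝ EM]
  {H : Type*} [TopologicalSpace H] (I : ModelWithCorners ℝ EM H)
  {M : Type*} [TopologicalSpace M] [ChartedSpace H M]
  (F : Type*) [NormedAddCommGroup F] [NormedSpace ℝ F]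
  {V : M → Type*} [∀ x, AddCommGroup (V x)] [∀ x, Module ℝ (V x)]
  (E : M → Type*) [∀ x, AddTorsor (V x) (E x)]
  [TopologicalSpace (TotalSpace F E)] [∀ x, TopologicalSpace (E x)] [FiberBundle F E]

/-- The (smooth) affine functions on an affine bundle, given by their restrictions to the
fibres. -/
structure AffineFunction where
  onFibre : ∀ x, E x →ᵃ[ℝ] ℝ
  smooth : SmoothFun (I.prod 𝓘(ℝ, F)) fun p : TotalSpace F E => onFibre p.1 p.2

variable {I F E}

/-- An affine function, as a function on the total space. -/
def AffineFunction.fn (a : AffineFunction I F E) (p : TotalSpace F E) : ℝ := a.onFibre p.1 p.2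

/-- The linear function on the vector hull that corresponds to an affine function. -/
def AffineFunction.bar (a : AffineFunction I F E) (ψ : TotalSpace (ℝ × F) (Hull F E)) : ℝ :=
  ψ.2.eval (a.onFibre ψ.1)

/-- A Jacobi structure is affine if the bracket of affine functions is an affine function. -/
def IsAffineJacobi (J : JacobiStructure (I.prod 𝓘(ℝ, F)) (TotalSpace F E)) : Prop :=
  ∀ a b : AffineFunction I F E, ∃ c : AffineFunction I F E, J.bracket a.fn b.fn = c.fn

variable (I F E) in
/-- The affine Jacobi structures on an affine bundle. -/
abbrev AffineJacobi : Type _ :=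
  {J : JacobiStructure (I.prod 𝓘(ℝ, F)) (TotalSpace F E) // IsAffineJacobi J}

variable (F E)

/-- The inclusion of an affine bundle into its vector hull: a point of the fibre is sent to the
evaluation of affine functions at it. -/
def inclHull (p : TotalSpace F E) : TotalSpace (ℝ × F) (Hull F E) :=
  ⟨p.1, show Dual ℝ (E p.1 →ᵃ[ℝ] ℝ) from
    { toFun := fun a => a p.2
      map_add' := fun _ _ => rfl
      map_smul' := fun _ _ => rfl }⟩

/-- The linear function on the vector hull that corresponds to the constant function `1`. -/
def iotaOne (ψ : TotalSpace (ℝ × F) (Hull F E)) : ℝ :=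
  ψ.2.eval (AffineMap.const ℝ (E ψ.1) 1)

variable [FiniteDimensional ℝ F] [IsAffineBundle F E]

variable (I) in
/-- The Liouville vector field of the vector hull, whose value at `ψ` is the velocity at `s = 1` of
the curve `s ↦ s • ψ`. -/
def liouville (ψ : TotalSpace (ℝ × F) (Hull F E)) : TangentSpace (I.prod 𝓘(ℝ, ℝ × F)) ψ :=
  mfderiv 𝓘(ℝ, ℝ) (I.prod 𝓘(ℝ, ℝ × F))
    (fun s : ℝ => (⟨ψ.1, s • ψ.2⟩ : TotalSpace (ℝ × F) (Hull F E))) 1 (1 : ℝ)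

variable (I) in
/-- The Poisson structures on the vector hull that are homogeneous with respect to the Liouville
vector field. -/
abbrev HomogeneousPoisson : Type _ :=
  {P : PoissonStructure (I.prod 𝓘(ℝ, ℝ × F)) (TotalSpace (ℝ × F) (Hull F E)) //
    IsHomogeneous (liouville I F E) P.Λ}

variable {F E}

variable [FiniteDimensional ℝ EM]

/-- The hamiltonian vector field of `iotaOne` with respect to a bivector field on the hull. -/
def hamOne (Λ : ∀ ψ : TotalSpace (ℝ × F) (Hull F E), Bivector (I.prod 𝓘(ℝ, ℝ × F)) ψ)
    (ψ : TotalSpace (ℝ × F) (Hull F E)) : TangentSpace (I.prod 𝓘(ℝ, ℝ × F)) ψ :=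
  sharp _ (Λ ψ) (dif _ (iotaOne F E) ψ)

end Affine

/-! ### Linear Poisson tensors on `M × (ℝ ∖ {0})` -/

section RankZero

/-- The open submanifold `ℝ ∖ {0}` of `ℝ`. -/
def NonzeroReal : TopologicalSpace.Opens ℝ := ⟨{0}ᶜ, isOpen_compl_singleton⟩

variable {EM : Type*} [NormedAddCommGroup EM] [NormedSpace ℝ EM]
  {H : Type*} [TopologicalSpace H] (I : ModelWithCorners ℝ EM H)
  {M : Type*} [TopologicalSpace M] [ChartedSpace H M]

/-- The coordinate `t` on `M × (ℝ ∖ {0})`. -/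
def tCoord (q : M × NonzeroReal) : ℝ := (q.2 : ℝ)

/-- The function `t f` on `M × (ℝ ∖ {0})`, for a function `f` on `M`. -/
def tMul (f : M → ℝ) (q : M × NonzeroReal) : ℝ := tCoord q * f q.1

/-- The vector field `∂/∂t` on `M × (ℝ ∖ {0})`. -/
def partialT (q : M × NonzeroReal) : TangentSpace (I.prod 𝓘(ℝ, ℝ)) q :=
  mfderiv 𝓘(ℝ, ℝ) (I.prod 𝓘(ℝ, ℝ)) (fun s : NonzeroReal => (q.1, s)) q.2 (1 : ℝ)

/-- A vector field on `M`, as a vector field on `M × (ℝ ∖ {0})`. -/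
def liftVectorField (X : ∀ x : M, TangentSpace I x) (q : M × NonzeroReal) :
    TangentSpace (I.prod 𝓘(ℝ, ℝ)) q :=
  mfderiv I (I.prod 𝓘(ℝ, ℝ)) (fun x : M => (x, q.2)) q.1 (X q.1)

/-- A bivector field on `M`, as a bivector field on `M × (ℝ ∖ {0})`. -/
def liftBivectorField (Λ : ∀ x : M, Bivector I x) (q : M × NonzeroReal) :
    Bivector (I.prod 𝓘(ℝ, ℝ)) q :=
  pushBivector I (I.prod 𝓘(ℝ, ℝ)) (fun x : M => (x, q.2)) q.1 (Λ q.1)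

variable {I} in
/-- A bivector field `P` on `M × (ℝ ∖ {0})` is linear (homogeneous) if, for all smooth functions
`f`, `g` on `M`, `P(d(tf), d(tg)) = t h` for a smooth function `h` on `M`. -/
def IsLinearBivector (P : ∀ q : M × NonzeroReal, Bivector (I.prod 𝓘(ℝ, ℝ)) q) : Prop :=
  ∀ f g : M → ℝ, SmoothFun I f → SmoothFun I g →
    ∃ h : M → ℝ, SmoothFun I h ∧ pairing P (tMul f) (tMul g) = tMul h

variable (M) in
/-- The linear Poisson tensors on `M × (ℝ ∖ {0})`. -/
abbrev LinearPoisson : Type _ :=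
  {P : PoissonStructure (I.prod 𝓘(ℝ, ℝ)) (M × NonzeroReal) // IsLinearBivector P.Λ}

end RankZero

end

noncomputable section

/-! ### Alternating bilinear forms -/

section AlternatingForms

/-! Both correspondences are instances of one abstract situation, `IsHull`. A manifold `N` is
included in a manifold `N'` of one more dimension, inside the level set `ι = 1` of a function `ι`
that is homogeneous for a Liouville field `Δ`. Every function `a` of a class on `N` that contains
coordinates extends to a homogeneous function `ā` on `N'`. For the first part, `N` is the affine
bundle, `N'` is its hull and `Δ` is the usual Liouville field. For the second part, `N = M` is the
slice `t = 1` of `M × (ℝ ∖ {0})`, `ā = t a` and `Δ = t ∂/∂t`.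

From Poisson to Jacobi: let `Λ̄` be linear and let `E` be the hamiltonian field of `ι`. Homogeneity
makes `Δ` commute with `E`, and a computation shows that `(Λ̄ - Δ ∧ E, E)` is a Jacobi structure
(`PoissonStructure.toJacobi`). Where `ι = 1`, `E` annihilates `ι` and contraction of `Λ̄ - Δ ∧ E`
with `dι` gives `E - ι E = 0`. Both tensors are therefore tangent to `N` (`IsHull.exists_tangent`)
and restrict to it. Since `Δ(ā) = ā`, the Jacobi bracket of `ā` and `b̄` is their Poisson bracket.

From Jacobi to Poisson: the differentials of the functions `ā` span the cotangent spaces on the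
dense set `ι ≠ 0`, so a smooth bivector field is determined by the brackets of these functions. If
those brackets extend the Jacobi brackets on `N`, the Jacobi identity passes to the bivector field
(`IsHull.toPoisson`). Here the tensoriality of the Schouten square is needed, since it is defined by
iterated brackets. What remains is to produce a smooth bivector field with the prescribed brackets
(`IsHull.exists_equiv`).

On `M × (ℝ ∖ {0})` it is `t⁻¹ Λ + ∂/∂t ∧ E`. On a hull the analogous formula has a factor `ι⁻¹` and
could be singular at `ι = 0`; positive rank removes the singularity. Indeed `{a, f b} - f {a, b} = b
ρ(a)(f)`, with `ρ(a)(f) = Λ(da, df) + a E(f)` and `f` basic. This is affine for every affine `b`,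
which forces `ρ(a)(f)` to be basic (`anchorFun_basic`). Then `ρ(f a)(g) = f ρ(a)(g) + a Λ(df, dg)`
forces `Λ(df, dg) = 0` for basic `f`, `g` when the fibres have positive dimension
(`pairing_base_base`). Hence the bracket of `ā + f` and `b̄ + g` is the linear function of `{a, b}`
plus `ρ(a)(g) - ρ(b)(f)`, which is smooth on the whole hull (`pairing_hullBivector`). Finally, a
homogeneous bivector field on the hull is linear because a smooth function of degree one is linear
on the fibres (`exists_bar_eq`). -/

theorem update_pair_one {W : Type*} (α β γ : W) : Function.update ![α, β] 1 γ = ![α, γ] := by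
  ext i : 1
  fin_cases i <;> rfl

theorem update_pair_zero {W : Type*} (α β γ : W) : Function.update ![α, β] 0 γ = ![γ, β] := by
  ext i : 1
  fin_cases i <;> rfl

variable {W W' : Type*} [AddCommGroup W] [Module ℝ W] [AddCommGroup W'] [Module ℝ W']

/-- An alternating form of degree two as a bilinear map. -/
def altBilin (Λ : W [⋀^Fin 2]→ₗ[ℝ] ℝ) : W →ₗ[ℝ] W →ₗ[ℝ] ℝ :=
  LinearMap.mk₂ ℝ (fun α β => Λ ![α, β])
    (fun α α' β => by
      have h := Λ.map_update_add ![0, β] 0 α α'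
      simpa only [update_pair_zero] using h)
    (fun c α β => by
      have h := Λ.map_update_smul ![0, β] 0 c α
      simpa only [update_pair_zero] using h)
    (fun α β β' => by
      have h := Λ.map_update_add ![α, 0] 1 β β'
      simpa only [update_pair_one] using h)
    (fun c α β => by
      have h := Λ.map_update_smul ![α, 0] 1 c β
      simpa only [update_pair_one] using h)

theorem altBilin_apply (Λ : W [⋀^Fin 2]→ₗ[ℝ] ℝ) (α β : W) : altBilin Λ α β = Λ ![α, β] := rfl

theorem altBilin_self (Λ : W [⋀^Fin 2]→ₗ[ℝ] ℝ) (α : W) : altBilin Λ α α = 0 :=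
  Λ.map_eq_zero_of_eq ![α, α] (i := 0) (j := 1) rfl (by decide)

theorem altBilin_swap (Λ : W [⋀^Fin 2]→ₗ[ℝ] ℝ) (α β : W) :
    altBilin Λ α β = -altBilin Λ β α := by
  have h := altBilin_self Λ (α + β)
  simp only [map_add, LinearMap.add_apply, altBilin_self] at h
  linarith

theorem altBilin_injective {Λ Λ' : W [⋀^Fin 2]→ₗ[ℝ] ℝ} (h : altBilin Λ = altBilin Λ') :
    Λ = Λ' := by
  ext v
  have hv : v = ![v 0, v 1] := by
    ext i : 1
    fin_cases i <;> rfl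
  rw [hv]
  exact LinearMap.congr_fun (LinearMap.congr_fun h (v 0)) (v 1)

theorem altBilin_compLinearMap (Λ : W [⋀^Fin 2]→ₗ[ℝ] ℝ) (L : W' →ₗ[ℝ] W) (α β : W') :
    altBilin (Λ.compLinearMap L) α β = altBilin Λ (L α) (L β) := by
  rw [altBilin_apply, altBilin_apply, AlternatingMap.compLinearMap_apply]
  congr 1
  ext i : 1
  fin_cases i <;> rfl

/-- An alternating bilinear map as an alternating form of degree two. -/
def altOfBilin (B : W →ₗ[ℝ] W →ₗ[ℝ] ℝ) (hB : ∀ α, B α α = 0) : W [⋀^Fin 2]→ₗ[ℝ] ℝ where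
  toFun v := B (v 0) (v 1)
  map_update_add' v i α β := by
    fin_cases i <;> simp
  map_update_smul' v i c α := by
    fin_cases i <;> simp
  map_eq_zero_of_eq' v i j hv hij := by
    fin_cases i <;> fin_cases j
    · exact absurd rfl hij
    · have h : v 0 = v 1 := hv
      rw [h]; exact hB _
    · have h : v 1 = v 0 := hv
      rw [h]; exact hB _
    · exact absurd rfl hij

end AlternatingForms

/-! ### Calculus with vector fields and bivector fields -/

section Calculus

variable {EN : Type*} [NormedAddCommGroup EN] [NormedSpace ℝ EN]
  {HN : Type*} [TopologicalSpace HN] {I : ModelWithCorners ℝ EN HN}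
  {N : Type*} [TopologicalSpace N] [ChartedSpace HN N]

theorem altBilin_wedge {x : N} (u v : TangentSpace I x) (α β : Cotangent I x) :
    altBilin (wedge I u v) α β = α u * β v - α v * β u := by
  rw [altBilin_apply]
  simp only [wedge, AlternatingMap.compLinearMap_apply]
  refine (Matrix.det_fin_two _).trans ?_
  simp

theorem apply_sharp [FiniteDimensional ℝ EN] {x : N} (Λ : Bivector I x) (α β : Cotangent I x) :
    β (sharp I Λ α) = altBilin Λ α β := by
  have : FiniteDimensional ℝ (TangentSpace I x) := inferInstanceAs (FiniteDimensional ℝ EN)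
  exact apply_evalEquiv_symm_apply (R := ℝ) (M := TangentSpace I x) β _

theorem pairing_apply (Λ : ∀ x : N, Bivector I x) (f g : N → ℝ) (x : N) :
    pairing Λ f g x = altBilin (Λ x) (dif I f x) (dif I g x) := rfl

theorem lieFun_apply (X : ∀ x : N, TangentSpace I x) (f : N → ℝ) (x : N) :
    lieFun X f x = dif I f x (X x) := rfl

theorem lieFun_sharp [FiniteDimensional ℝ EN] (Λ : ∀ x : N, Bivector I x) (f g : N → ℝ) :
    lieFun (fun x => sharp I (Λ x) (dif I f x)) g = pairing Λ f g := by
  ext x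
  rw [lieFun_apply, apply_sharp, pairing_apply]

theorem pairing_swap (Λ : ∀ x : N, Bivector I x) (f g : N → ℝ) :
    pairing Λ f g = -pairing Λ g f := by
  ext x
  exact altBilin_swap _ _ _

theorem pairing_self (Λ : ∀ x : N, Bivector I x) (f : N → ℝ) : pairing Λ f f = 0 := by
  ext x
  exact altBilin_self _ _

theorem SmoothFun.mdifferentiableAt {f : N → ℝ} (hf : SmoothFun I f) (x : N) :
    MDifferentiableAt I 𝓘(ℝ, ℝ) f x :=
  (hf x).mdifferentiableAt (by simp)

theorem dif_add {f g : N → ℝ} {x : N} (hf : MDifferentiableAt I 𝓘(ℝ, ℝ) f x)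
    (hg : MDifferentiableAt I 𝓘(ℝ, ℝ) g x) : dif I (f + g) x = dif I f x + dif I g x := by
  rw [dif, mvfderiv_add hf hg]; rfl

theorem dif_sub {f g : N → ℝ} {x : N} (hf : MDifferentiableAt I 𝓘(ℝ, ℝ) f x)
    (hg : MDifferentiableAt I 𝓘(ℝ, ℝ) g x) : dif I (f - g) x = dif I f x - dif I g x := by
  rw [dif, mvfderiv_sub hf hg]; rfl

theorem dif_neg_fun (f : N → ℝ) (x : N) : dif I (-f) x = -dif I f x := by
  rw [dif, mvfderiv_neg]; rfl

theorem dif_mul {f g : N → ℝ} {x : N} (hf : MDifferentiableAt I 𝓘(ℝ, ℝ) f x)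
    (hg : MDifferentiableAt I 𝓘(ℝ, ℝ) g x) :
    dif I (f * g) x = f x • dif I g x + g x • dif I f x := by
  rw [dif, mvfderiv_mul hf hg]; rfl

theorem dif_const (c : ℝ) (x : N) : dif I (fun _ : N => c) x = 0 := by
  rw [dif, mvfderiv_const]; rfl

theorem dif_smul (c : ℝ) {f : N → ℝ} {x : N} (hf : MDifferentiableAt I 𝓘(ℝ, ℝ) f x) :
    dif I (c • f) x = c • dif I f x := by
  have h := dif_mul (I := I) (f := fun _ => c) mdifferentiableAt_const hf
  rw [dif_const, smul_zero, add_zero] at h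
  exact h

theorem dif_sum {ι : Type*} (s : Finset ι) {f : ι → N → ℝ} {x : N}
    (hf : ∀ i ∈ s, MDifferentiableAt I 𝓘(ℝ, ℝ) (f i) x) :
    MDifferentiableAt I 𝓘(ℝ, ℝ) (∑ i ∈ s, f i) x ∧
      dif I (∑ i ∈ s, f i) x = ∑ i ∈ s, dif I (f i) x := by
  classical
  induction s using Finset.induction_on with
  | empty =>
    simp only [Finset.sum_empty]
    exact ⟨mdifferentiableAt_const, dif_const 0 x⟩
  | insert i s hi ih =>
    obtain ⟨h1, h2⟩ := ih fun j hj => hf j (Finset.mem_insert_of_mem hj)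
    have h3 := hf i (Finset.mem_insert_self i s)
    rw [Finset.sum_insert hi, Finset.sum_insert hi]
    exact ⟨h3.add h1, by rw [dif_add h3 h1, h2]⟩

theorem Filter.EventuallyEq.dif_eq {f g : N → ℝ} {x : N} (h : f =ᶠ[𝓝 x] g) :
    dif I f x = dif I g x := by
  rw [dif, dif, mvfderiv, mvfderiv, h.mfderiv_eq]
  ext v
  simp
  rfl

variable {EN' : Type*} [NormedAddCommGroup EN'] [NormedSpace ℝ EN']
  {HN' : Type*} [TopologicalSpace HN'] {I' : ModelWithCorners ℝ EN' HN'}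
  {N' : Type*} [TopologicalSpace N'] [ChartedSpace HN' N']

theorem dif_comp {φ : N → N'} {f : N' → ℝ} {x : N} (hf : MDifferentiableAt I' 𝓘(ℝ, ℝ) f (φ x))
    (hφ : MDifferentiableAt I I' φ x) :
    dif I (f ∘ φ) x = (dif I' f (φ x)).comp (mfderiv I I' φ x).toLinearMap := by
  rw [dif, mvfderiv_comp x hf hφ]; rfl

theorem dif_comp_apply {φ : N → N'} {f : N' → ℝ} {x : N}
    (hf : MDifferentiableAt I' 𝓘(ℝ, ℝ) f (φ x)) (hφ : MDifferentiableAt I I' φ x)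
    (v : TangentSpace I x) : dif I (f ∘ φ) x v = dif I' f (φ x) (mfderiv I I' φ x v) := by
  rw [dif_comp hf hφ]; rfl

theorem SmoothFun.add {f g : N → ℝ} (hf : SmoothFun I f) (hg : SmoothFun I g) :
    SmoothFun I (f + g) := ContMDiff.add hf hg

theorem SmoothFun.sub {f g : N → ℝ} (hf : SmoothFun I f) (hg : SmoothFun I g) :
    SmoothFun I (f - g) := ContMDiff.sub hf hg

theorem SmoothFun.mul {f g : N → ℝ} (hf : SmoothFun I f) (hg : SmoothFun I g) :
    SmoothFun I (f * g) := ContMDiff.mul hf hg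

theorem SmoothFun.neg {f : N → ℝ} (hf : SmoothFun I f) : SmoothFun I (-f) := ContMDiff.neg hf

theorem SmoothFun.const_smul (c : ℝ) {f : N → ℝ} (hf : SmoothFun I f) : SmoothFun I (c • f) :=
  ContMDiff.mul (contMDiff_const (c := c)) hf

theorem smoothFun_const (c : ℝ) : SmoothFun I (fun _ : N => c) := contMDiff_const

theorem smoothFun_one : SmoothFun I (1 : N → ℝ) := contMDiff_const

/-! ### Additivity and the Leibniz rule -/

section Leibniz

variable (X : ∀ x : N, TangentSpace I x) (Λ : ∀ x : N, Bivector I x) {f g h : N → ℝ}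

theorem lieFun_add (hf : SmoothFun I f) (hg : SmoothFun I g) :
    lieFun X (f + g) = lieFun X f + lieFun X g := by
  ext x
  simp only [Pi.add_apply, lieFun_apply, dif_add (hf.mdifferentiableAt x) (hg.mdifferentiableAt x),
    LinearMap.add_apply]

theorem lieFun_sub (hf : SmoothFun I f) (hg : SmoothFun I g) :
    lieFun X (f - g) = lieFun X f - lieFun X g := by
  ext x
  simp only [Pi.sub_apply, lieFun_apply, dif_sub (hf.mdifferentiableAt x) (hg.mdifferentiableAt x),
    LinearMap.sub_apply]

theorem lieFun_neg (f : N → ℝ) : lieFun X (-f) = -lieFun X f := by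
  ext x
  simp only [Pi.neg_apply, lieFun_apply, dif_neg_fun, LinearMap.neg_apply]

theorem lieFun_mul (hf : SmoothFun I f) (hg : SmoothFun I g) :
    lieFun X (f * g) = f * lieFun X g + g * lieFun X f := by
  ext x
  simp only [Pi.add_apply, Pi.mul_apply, lieFun_apply,
    dif_mul (hf.mdifferentiableAt x) (hg.mdifferentiableAt x),
    LinearMap.add_apply, LinearMap.smul_apply, smul_eq_mul]

theorem lieFun_const (c : ℝ) : lieFun X (fun _ => c) = 0 := by
  ext x
  rw [lieFun_apply, dif_const]; rfl

theorem lieFun_one : lieFun X 1 = 0 := lieFun_const X 1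

theorem pairing_add_right (f : N → ℝ) (hg : SmoothFun I g) (hh : SmoothFun I h) :
    pairing Λ f (g + h) = pairing Λ f g + pairing Λ f h := by
  ext x
  simp only [Pi.add_apply, pairing_apply,
    dif_add (hg.mdifferentiableAt x) (hh.mdifferentiableAt x), map_add]

theorem pairing_sub_right (f : N → ℝ) (hg : SmoothFun I g) (hh : SmoothFun I h) :
    pairing Λ f (g - h) = pairing Λ f g - pairing Λ f h := by
  ext x
  simp only [Pi.sub_apply, pairing_apply,
    dif_sub (hg.mdifferentiableAt x) (hh.mdifferentiableAt x), map_sub]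

theorem pairing_neg_right (f g : N → ℝ) : pairing Λ f (-g) = -pairing Λ f g := by
  ext x
  simp only [Pi.neg_apply, pairing_apply, dif_neg_fun, map_neg]

theorem pairing_mul_right (f : N → ℝ) (hg : SmoothFun I g) (hh : SmoothFun I h) :
    pairing Λ f (g * h) = g * pairing Λ f h + h * pairing Λ f g := by
  ext x
  simp only [Pi.add_apply, Pi.mul_apply, pairing_apply,
    dif_mul (hg.mdifferentiableAt x) (hh.mdifferentiableAt x), map_add, map_smul, smul_eq_mul]

theorem pairing_mul_left (hf : SmoothFun I f) (hg : SmoothFun I g) (h : N → ℝ) :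
    pairing Λ (f * g) h = f * pairing Λ g h + g * pairing Λ f h := by
  rw [pairing_swap, pairing_mul_right Λ h hf hg, pairing_swap Λ h f, pairing_swap Λ h g]
  ring

theorem pairing_const_right (f : N → ℝ) (c : ℝ) : pairing Λ f (fun _ => c) = 0 := by
  ext x
  rw [pairing_apply, dif_const, map_zero]; rfl

end Leibniz

theorem JacobiStructure.bracket_apply (J : JacobiStructure I N) (f g : N → ℝ) (x : N) :
    J.bracket f g x =
      pairing J.Λ f g x + f x * lieFun J.E g x - g x * lieFun J.E f x := rfl

theorem JacobiStructure.smooth_bracket (J : JacobiStructure I N) {f g : N → ℝ}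
    (hf : SmoothFun I f) (hg : SmoothFun I g) : SmoothFun I (J.bracket f g) :=
  ((J.smoothΛ f g hf hg).add (hf.mul (J.smoothE g hg))).sub (hg.mul (J.smoothE f hf))

theorem schouten_self_eq (Λ : ∀ x : N, Bivector I x) (f g h : N → ℝ) :
    schouten Λ Λ f g h = (2 : ℝ) • (pairing Λ f (pairing Λ g h) + pairing Λ g (pairing Λ h f) +
      pairing Λ h (pairing Λ f g)) := by
  ext x
  simp only [schouten, Pi.add_apply, Pi.smul_apply, smul_eq_mul]
  ring

/-- The Jacobi identity of the Jacobi bracket. -/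
theorem JacobiStructure.jacobi (J : JacobiStructure I N) {f g h : N → ℝ}
    (hf : SmoothFun I f) (hg : SmoothFun I g) (hh : SmoothFun I h) :
    J.bracket f (J.bracket g h) + J.bracket g (J.bracket h f) + J.bracket h (J.bracket f g) =
      0 := by
  have key := J.schouten_self f g h hf hg hh
  rw [schouten_self_eq] at key
  have key2 : pairing J.Λ f (pairing J.Λ g h) + pairing J.Λ g (pairing J.Λ h f) +
      pairing J.Λ h (pairing J.Λ f g) = -wedgeVB J.E J.Λ f g h := by
    ext x
    have := congrFun key x
    simp only [Pi.smul_apply, smul_eq_mul] at this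
    simp only [Pi.neg_apply]
    linarith
  have e1 := J.lie_E f g hf hg
  have e2 := J.lie_E g h hg hh
  have e3 := J.lie_E h f hh hf
  have sf := J.smoothE f hf
  have sg := J.smoothE g hg
  have sh := J.smoothE h hh
  have sfg := J.smoothΛ f g hf hg
  have sgh := J.smoothΛ g h hg hh
  have shf := J.smoothΛ h f hh hf
  simp only [lieBivector, wedgeVB] at e1 e2 e3 key2
  simp only [JacobiStructure.bracket]
  rw [pairing_sub_right _ _ (sgh.add (hg.mul sh)) (hh.mul sg),
    pairing_add_right _ _ sgh (hg.mul sh), pairing_mul_right _ _ hg sh,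
    pairing_mul_right _ _ hh sg,
    pairing_sub_right _ _ (shf.add (hh.mul sf)) (hf.mul sh),
    pairing_add_right _ _ shf (hh.mul sf), pairing_mul_right _ _ hh sf,
    pairing_mul_right _ _ hf sh,
    pairing_sub_right _ _ (sfg.add (hf.mul sg)) (hg.mul sf),
    pairing_add_right _ _ sfg (hf.mul sg), pairing_mul_right _ _ hf sg,
    pairing_mul_right _ _ hg sf,
    lieFun_sub _ (sgh.add (hg.mul sh)) (hh.mul sg),
    lieFun_add _ sgh (hg.mul sh), lieFun_mul _ hg sh, lieFun_mul _ hh sg,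
    lieFun_sub _ (shf.add (hh.mul sf)) (hf.mul sh),
    lieFun_add _ shf (hh.mul sf), lieFun_mul _ hh sf, lieFun_mul _ hf sh,
    lieFun_sub _ (sfg.add (hf.mul sg)) (hg.mul sf),
    lieFun_add _ sfg (hf.mul sg), lieFun_mul _ hf sg, lieFun_mul _ hg sf]
  rw [pairing_swap J.Λ g f, pairing_swap J.Λ h g, pairing_swap J.Λ f h,
    pairing_swap J.Λ (lieFun J.E f) g, pairing_swap J.Λ (lieFun J.E g) h,
    pairing_swap J.Λ (lieFun J.E h) f] at *
  linear_combination key2 + h * e1 + f * e2 + g * e3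

end Calculus

/-! ### The Jacobi structure of a homogeneous Poisson structure -/

section HomogeneousPoissonJacobi

variable {EN : Type*} [NormedAddCommGroup EN] [NormedSpace ℝ EN]
  {HN : Type*} [TopologicalSpace HN] {I : ModelWithCorners ℝ EN HN}
  {N : Type*} [TopologicalSpace N] [ChartedSpace HN N]

theorem PoissonStructure.jacobi (P : PoissonStructure I N) {f g h : N → ℝ}
    (hf : SmoothFun I f) (hg : SmoothFun I g) (hh : SmoothFun I h) :
    pairing P.Λ f (pairing P.Λ g h) + pairing P.Λ g (pairing P.Λ h f) +
      pairing P.Λ h (pairing P.Λ f g) = 0 := by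
  have key := P.schouten_self f g h hf hg hh
  rw [schouten_self_eq] at key
  exact (smul_eq_zero.1 key).resolve_left (by norm_num)

/-- The Jacobi identity, read as saying that the hamiltonian field of `ι` is a derivation of the
bracket. -/
theorem PoissonStructure.hamiltonian_pairing (P : PoissonStructure I N) {ι f g : N → ℝ}
    (hι : SmoothFun I ι) (hf : SmoothFun I f) (hg : SmoothFun I g) :
    pairing P.Λ ι (pairing P.Λ f g) =
      pairing P.Λ (pairing P.Λ ι f) g + pairing P.Λ f (pairing P.Λ ι g) := by
  have h := P.jacobi hι hf hg
  rw [pairing_swap P.Λ g ι, pairing_swap P.Λ g (pairing P.Λ ι f), pairing_neg_right] at h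
  linear_combination h

/-- The fields `X` and `#dι` commute: the degree `-1` of `Λ` and the degree `1` of `ι` cancel. -/
theorem lieFun_hamiltonian {X : ∀ x : N, TangentSpace I x} {Λ : ∀ x : N, Bivector I x}
    (hΛ : IsHomogeneous X Λ) {ι f : N → ℝ} (hι : SmoothFun I ι) (hXι : lieFun X ι = ι)
    (hf : SmoothFun I f) : lieFun X (pairing Λ ι f) = pairing Λ ι (lieFun X f) := by
  have h := hΛ ι f hι hf
  rw [lieBivector, hXι] at h
  linear_combination h

theorem pairing_sub_wedge (Λ : ∀ x : N, Bivector I x) (X E : ∀ x : N, TangentSpace I x)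
    (f g : N → ℝ) :
    pairing (fun x => Λ x - wedge I (X x) (E x)) f g =
      pairing Λ f g - (lieFun X f * lieFun E g - lieFun E f * lieFun X g) := by
  ext x
  change (Λ x - wedge I (X x) (E x)) ![dif I f x, dif I g x] = _
  rw [AlternatingMap.sub_apply]
  exact congrArg (_ - ·) (altBilin_wedge _ _ _ _)

variable [FiniteDimensional ℝ EN]

/-- If `Λ` is a Poisson structure, homogeneous with respect to `X`, and `E` is the hamiltonian
vector field of a function `ι` with `X(ι) = ι`, then `(Λ - X ∧ E, E)` is a Jacobi structure. -/
def PoissonStructure.toJacobi (P : PoissonStructure I N) (X : ∀ x : N, TangentSpace I x)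
    (hX : SmoothVectorField I X) (hP : IsHomogeneous X P.Λ) (ι : N → ℝ) (hι : SmoothFun I ι)
    (hXι : lieFun X ι = ι) : JacobiStructure I N where
  Λ x := P.Λ x - wedge I (X x) (sharp I (P.Λ x) (dif I ι x))
  E x := sharp I (P.Λ x) (dif I ι x)
  smoothΛ f g hf hg := by
    rw [pairing_sub_wedge, lieFun_sharp, lieFun_sharp]
    exact (P.smoothΛ f g hf hg).sub (((hX f hf).mul (P.smoothΛ ι g hι hg)).sub
      ((P.smoothΛ ι f hι hf).mul (hX g hg)))
  smoothE f hf := by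
    rw [lieFun_sharp]
    exact P.smoothΛ ι f hι hf
  lie_E f g hf hg := by
    -- The field `E` preserves `P.Λ` and commutes with `X`, so it preserves `X ∧ E` too.
    have hXE := fun f hf => lieFun_hamiltonian hP hι hXι (f := f) hf
    have hE := fun f g hf hg => P.hamiltonian_pairing hι (f := f) (g := g) hf hg
    have sf := P.smoothΛ ι f hι hf
    have sg := P.smoothΛ ι g hι hg
    have xf := hX f hf
    have xg := hX g hg
    simp only [lieBivector, pairing_sub_wedge, lieFun_sharp]
    rw [pairing_sub_right _ _ (P.smoothΛ f g hf hg) ((xf.mul sg).sub (sf.mul xg)),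
      pairing_sub_right _ _ (xf.mul sg) (sf.mul xg), pairing_mul_right _ _ xf sg,
      pairing_mul_right _ _ sf xg, hXE f hf, hXE g hg, hE f g hf hg]
    ring
  schouten_self f g h hf hg hh := by
    have hXE := fun f hf => lieFun_hamiltonian hP hι hXι (f := f) hf
    have hE := fun f g hf hg => P.hamiltonian_pairing hι (f := f) (g := g) hf hg
    -- The last term here, due to homogeneity, gets multiplied by `E(f)`; its cyclic sum is the
    -- source of `-E ∧ Λ` in the Schouten square.
    have hXΛ : ∀ f g, SmoothFun I f → SmoothFun I g → lieFun X (pairing P.Λ f g) =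
        pairing P.Λ (lieFun X f) g + pairing P.Λ f (lieFun X g) - pairing P.Λ f g :=
      fun f g hf hg => by
        have h := hP f g hf hg
        rw [lieBivector] at h
        linear_combination h
    have main : ∀ f g h, SmoothFun I f → SmoothFun I g → SmoothFun I h →
        pairing (fun x => P.Λ x - wedge I (X x) (sharp I (P.Λ x) (dif I ι x))) f
          (pairing (fun x => P.Λ x - wedge I (X x) (sharp I (P.Λ x) (dif I ι x))) g h) =
        pairing P.Λ f (pairing P.Λ g h)
          - (lieFun X g * pairing P.Λ f (pairing P.Λ ι h) +
              pairing P.Λ ι h * pairing P.Λ f (lieFun X g)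
            - (pairing P.Λ ι g * pairing P.Λ f (lieFun X h) +
              lieFun X h * pairing P.Λ f (pairing P.Λ ι g)))
          - lieFun X f * (pairing P.Λ (pairing P.Λ ι g) h + pairing P.Λ g (pairing P.Λ ι h)
            - (lieFun X g * pairing P.Λ ι (pairing P.Λ ι h) +
              pairing P.Λ ι h * pairing P.Λ ι (lieFun X g)
            - (pairing P.Λ ι g * pairing P.Λ ι (lieFun X h) +
              lieFun X h * pairing P.Λ ι (pairing P.Λ ι g))))
          + pairing P.Λ ι f * (pairing P.Λ (lieFun X g) h + pairing P.Λ g (lieFun X h)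
            - pairing P.Λ g h
            - (lieFun X g * pairing P.Λ ι (lieFun X h) +
              pairing P.Λ ι h * lieFun X (lieFun X g)
            - (pairing P.Λ ι g * lieFun X (lieFun X h) +
              lieFun X h * pairing P.Λ ι (lieFun X g)))) := by
      intro f g h hf hg hh
      have sg := P.smoothΛ ι g hι hg
      have sh := P.smoothΛ ι h hι hh
      have xg := hX g hg
      have xh := hX h hh
      simp only [pairing_sub_wedge, lieFun_sharp]
      rw [pairing_sub_right _ _ (P.smoothΛ g h hg hh) ((xg.mul sh).sub (sg.mul xh)),
        pairing_sub_right _ _ (xg.mul sh) (sg.mul xh), pairing_mul_right _ _ xg sh,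
        pairing_mul_right _ _ sg xh,
        pairing_sub_right _ _ (P.smoothΛ g h hg hh) ((xg.mul sh).sub (sg.mul xh)),
        pairing_sub_right _ _ (xg.mul sh) (sg.mul xh), pairing_mul_right _ _ xg sh,
        pairing_mul_right _ _ sg xh,
        lieFun_sub _ (P.smoothΛ g h hg hh) ((xg.mul sh).sub (sg.mul xh)),
        lieFun_sub _ (xg.mul sh) (sg.mul xh), lieFun_mul _ xg sh,
        lieFun_mul _ sg xh, hXE g hg, hXE h hh, hE g h hg hh, hXΛ g h hg hh]
      ring
    rw [schouten_self_eq, main f g h hf hg hh, main g h f hg hh hf, main h f g hh hf hg]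
    simp only [wedgeVB, pairing_sub_wedge, lieFun_sharp]
    have hJ := P.jacobi hf hg hh
    rw [pairing_swap P.Λ h f, pairing_swap P.Λ (pairing P.Λ ι h) f,
      pairing_swap P.Λ (pairing P.Λ ι g) h, pairing_swap P.Λ (pairing P.Λ ι f) g,
      pairing_swap P.Λ (lieFun X h) f,
      pairing_swap P.Λ (lieFun X g) h, pairing_swap P.Λ (lieFun X f) g] at *
    ext x
    have hJx := congrFun hJ x
    simp only [Pi.add_apply, Pi.sub_apply, Pi.neg_apply, Pi.mul_apply, Pi.smul_apply, smul_eq_mul,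
      Pi.zero_apply] at hJx ⊢
    -- The Jacobiator of `P.Λ` is all that does not cancel identically; `X ∧ E` contributes nothing
    -- to `E ∧ (Λ - X ∧ E)`.
    linear_combination 2 * hJx

end HomogeneousPoissonJacobi

/-! ### Coordinate functions and tensoriality -/

section Coordinates

variable {EN : Type*} [NormedAddCommGroup EN] [NormedSpace ℝ EN]
  {HN : Type*} [TopologicalSpace HN] (I : ModelWithCorners ℝ EN HN)
  {N : Type*} [TopologicalSpace N] [ChartedSpace HN N]

/-- A set of smooth functions contains coordinates if, near every point, every linear coordinate
of the preferred chart agrees with a function of the set. -/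
structure ContainsCoordinates (S : Set (N → ℝ)) : Prop where
  smooth : ∀ f ∈ S, SmoothFun I f
  exists_coord : ∀ (p : N) (c : Dual ℝ EN), ∃ g ∈ S, g =ᶠ[𝓝 p] fun q => c (extChartAt I p q)

variable {I}

theorem ContainsCoordinates.mono {S T : Set (N → ℝ)} (hS : ContainsCoordinates I S)
    (hST : S ⊆ T) (hT : ∀ f ∈ T, SmoothFun I f) : ContainsCoordinates I T :=
  ⟨hT, fun p c => let ⟨g, hg, h⟩ := hS.exists_coord p c; ⟨g, hST hg, h⟩⟩

/-- The tangent space at `p` is the model space, read through the preferred chart at `p`; in that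
chart `g` is the linear form `c` itself. -/
theorem dif_coord [I.Boundaryless] {p : N} {g : N → ℝ} (hg : SmoothFun I g) {c : Dual ℝ EN}
    [FiniteDimensional ℝ EN] (h : g =ᶠ[𝓝 p] fun q => c (extChartAt I p q)) :
    dif I g p = c := by
  have h1 : dif I g p = (fderivWithin ℝ (writtenInExtChartAt I 𝓘(ℝ, ℝ) p g) (range I)
      (extChartAt I p p)).toLinearMap := by
    rw [dif, (hg.mdifferentiableAt p).mvfderiv]
  have h2 : writtenInExtChartAt I 𝓘(ℝ, ℝ) p g =ᶠ[𝓝 (extChartAt I p p)]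
      LinearMap.toContinuousLinearMap c := by
    have h3 := (continuousAt_extChartAt_symm (I := I) p).tendsto
    rw [extChartAt_to_inv] at h3
    filter_upwards [h3.eventually h, extChartAt_target_mem_nhds (I := I) p] with y hy hy'
    change g ((extChartAt I p).symm y) = _
    rw [hy, (extChartAt I p).right_inv hy']
    rfl
  rw [h1, I.range_eq_univ, fderivWithin_univ, h2.fderiv_eq,
    ContinuousLinearMap.fderiv]
  rfl

theorem ContainsCoordinates.exists_dif_eq [I.Boundaryless] [FiniteDimensional ℝ EN]
    {S : Set (N → ℝ)} (hS : ContainsCoordinates I S) (p : N) (c : Cotangent I p) :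
    ∃ g ∈ S, dif I g p = c := by
  obtain ⟨g, hg, h⟩ := hS.exists_coord p c
  exact ⟨g, hg, dif_coord (hS.smooth g hg) h⟩

/-- Near a point, the differential of a smooth function is a combination of the differentials of
coordinate functions, with smooth coefficients; at the point, the matrix of second derivatives is
symmetric. -/
theorem exists_expansion_of_coords [I.Boundaryless] [FiniteDimensional ℝ EN] {p : N}
    {x : Fin (finrank ℝ EN) → N → ℝ} (hxs : ∀ i, SmoothFun I (x i))
    (hx : ∀ i, x i =ᶠ[𝓝 p] fun q => (finBasis ℝ EN).coord i (extChartAt I p q)) {f : N → ℝ}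
    (hf : SmoothFun I f) :
    ∃ (F : Fin (finrank ℝ EN) → N → ℝ) (G : Fin (finrank ℝ EN) → Fin (finrank ℝ EN) → ℝ),
      (∀ i, ContMDiffAt I 𝓘(ℝ, ℝ) ∞ (F i) p) ∧
      (∀ᶠ q in 𝓝 p, dif I f q = ∑ i, F i q • dif I (x i) q) ∧
      (∀ i j, G i j = G j i) ∧ ∀ i, dif I (F i) p = ∑ j, G i j • dif I (x j) p := by
  let b := finBasis ℝ EN
  -- the chart, as a globally defined smooth map
  let φ : N → EN := fun q => ∑ i, x i q • b i
  have hφs : ContMDiff I 𝓘(ℝ, EN) ∞ φ :=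
    contMDiff_finsetSum fun i _ => (hxs i).smul contMDiff_const
  have hφ : φ =ᶠ[𝓝 p] extChartAt I p := by
    filter_upwards [Filter.eventually_all.2 hx] with q hq
    change ∑ i, x i q • b i = _
    simp only [hq, Basis.coord_apply]
    exact b.sum_repr _
  let H : EN → ℝ := f ∘ (extChartAt I p).symm
  have hH : ContDiffAt ℝ ∞ H (extChartAt I p p) := by
    have h := (contMDiffAt_iff.1 (hf p)).2
    rw [I.range_eq_univ] at h
    exact contDiffWithinAt_univ.1 h
  have hfH : f =ᶠ[𝓝 p] H ∘ φ := by
    filter_upwards [hφ, extChartAt_source_mem_nhds (I := I) p] with q hq hq'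
    simp only [Function.comp_apply, H, hq, (extChartAt I p).left_inv hq']
  have hφp : φ p = extChartAt I p p := hφ.eq_of_nhds
  have hdφ : ∀ (q : N) (c : EN →L[ℝ] ℝ), dif I (c ∘ φ) q = ∑ i, c (b i) • dif I (x i) q := by
    intro q c
    have h : c ∘ φ = ∑ i, c (b i) • x i := by
      ext q
      simp [φ, mul_comm]
    rw [h, (dif_sum (I := I) Finset.univ fun i _ =>
      ((hxs i).const_smul (c (b i))).mdifferentiableAt q).2]
    exact Finset.sum_congr rfl fun i _ => dif_smul _ ((hxs i).mdifferentiableAt q)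
  have hchain : ∀ (q : N) (K : EN → ℝ), DifferentiableAt ℝ K (φ q) →
      dif I (K ∘ φ) q = ∑ i, fderiv ℝ K (φ q) (b i) • dif I (x i) q := by
    intro q K hK
    have hφq := (hφs q).mdifferentiableAt (by simp)
    rw [← hdφ, dif_comp hK.mdifferentiableAt hφq, dif_comp
      (fderiv ℝ K (φ q)).differentiableAt.mdifferentiableAt hφq]
    congr 1
    ext v
    simp only [dif, mvfderiv, mfderiv_eq_fderiv, ContinuousLinearMap.fderiv]
    rfl
  have hH' : ContDiffAt ℝ ∞ (fderiv ℝ H) (φ p) := by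
    rw [hφp]; exact hH.fderiv_right (by simp)
  have hsymm : IsSymmSndFDerivAt ℝ H (φ p) := by
    rw [hφp]; exact hH.isSymmSndFDerivAt (by simpa using ENat.LEInfty.out)
  have hF : ∀ i, ContDiffAt ℝ ∞ (fun y => fderiv ℝ H y (b i)) (φ p) := fun i =>
    hH'.clm_apply contDiffAt_const
  -- With `f = H ∘ φ` near `p`, the coefficients are the partial derivatives of `H`, and `G` is its
  -- Hessian at `φ p`.
  refine ⟨fun i q => fderiv ℝ H (φ q) (b i), fun i j => fderiv ℝ (fderiv ℝ H) (φ p) (b j) (b i),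
    fun i => ?_, ?_, fun i j => hsymm.eq _ _, fun i => ?_⟩
  · exact (hF i).contMDiffAt.comp p (hφs p)
  · have h1 : ∀ᶠ y in 𝓝 (φ p), DifferentiableAt ℝ H y := by
      rw [hφp]
      filter_upwards [(hH.of_le (m := 1) (by simp)).eventually (by simp)] with y hy
      exact hy.differentiableAt (by simp)
    filter_upwards [hfH.eventuallyEq_nhds, (hφs p).continuousAt.eventually h1] with q hq hq'
    rw [hq.dif_eq, hchain q H hq']
  · change dif I ((fun y => fderiv ℝ H y (b i)) ∘ φ) p = _
    rw [hchain p _ ((hF i).differentiableAt (by simp))]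
    refine Finset.sum_congr rfl fun j _ => ?_
    have hd : HasFDerivAt (fun y => fderiv ℝ H y (b i))
        ((fderiv ℝ (fderiv ℝ H) (φ p)).flip (b i)) (φ p) := by
      have h := (hH'.differentiableAt (by simp)).hasFDerivAt.clm_apply
        (hasFDerivAt_const (b i) (φ p))
      simpa using h
    rw [hd.fderiv]
    rfl

theorem ContainsCoordinates.exists_expansion [I.Boundaryless] [FiniteDimensional ℝ EN]
    {S : Set (N → ℝ)} (hS : ContainsCoordinates I S) (p : N) :
    ∃ x : Fin (finrank ℝ EN) → N → ℝ, (∀ i, x i ∈ S) ∧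
      (∀ a : Fin (finrank ℝ EN) → ℝ, ∑ i, a i • dif I (x i) p = 0 → ∀ i, a i = 0) ∧
      ∀ f, SmoothFun I f →
        ∃ (F : Fin (finrank ℝ EN) → N → ℝ)
          (G : Fin (finrank ℝ EN) → Fin (finrank ℝ EN) → ℝ),
          (∀ i, ContMDiffAt I 𝓘(ℝ, ℝ) ∞ (F i) p) ∧
          (∀ᶠ q in 𝓝 p, dif I f q = ∑ i, F i q • dif I (x i) q) ∧
          (∀ i j, G i j = G j i) ∧ ∀ i, dif I (F i) p = ∑ j, G i j • dif I (x j) p := by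
  let b := finBasis ℝ EN
  choose x hxS hx using fun i => hS.exists_coord p (b.coord i)
  have hxs := fun i => hS.smooth _ (hxS i)
  refine ⟨x, hxS, ?_, fun f hf =>
    exists_expansion_of_coords hxs hx hf⟩
  intro a ha j
  have h : ∑ i, a i • b.coord i = 0 := by
    refine Eq.trans (Finset.sum_congr rfl fun i _ => ?_) ha
    rw [dif_coord (hxs i) (hx i)]
    rfl
  simpa [Finsupp.single_apply] using LinearMap.congr_fun h (b j)

theorem SmoothBivectorField.smooth_hamiltonian [FiniteDimensional ℝ EN] {Λ : ∀ x : N, Bivector I x}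
    (hΛ : SmoothBivectorField I Λ) {f : N → ℝ}
    (hf : SmoothFun I f) : SmoothVectorField I (fun x => sharp I (Λ x) (dif I f x)) :=
  fun g hg => by
    rw [lieFun_sharp]
    exact hΛ f g hf hg

theorem schouten_self_cyclic (Λ : ∀ x : N, Bivector I x) (f g h : N → ℝ) :
    schouten Λ Λ f g h = schouten Λ Λ g h f := by
  rw [schouten_self_eq, schouten_self_eq]
  congr 1
  ring

theorem wedgeVB_congr {Λ : ∀ x : N, Bivector I x} {E : ∀ x : N, TangentSpace I x}
    {f f' g g' h h' : N → ℝ} {p : N}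
    (h1 : dif I f p = dif I f' p) (h2 : dif I g p = dif I g' p) (h3 : dif I h p = dif I h' p) :
    wedgeVB E Λ f g h p = wedgeVB E Λ f' g' h' p := by
  simp only [wedgeVB, Pi.add_apply, Pi.mul_apply, lieFun_apply, pairing_apply, h1, h2, h3]

variable [I.Boundaryless] [FiniteDimensional ℝ EN] {S : Set (N → ℝ)}

theorem ContainsCoordinates.smoothVectorField (hS : ContainsCoordinates I S)
    {X : ∀ x : N, TangentSpace I x} (hX : ∀ f ∈ S, SmoothFun I (lieFun X f)) :
    SmoothVectorField I X := by
  intro f hf p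
  obtain ⟨x, hxS, -, hexp⟩ := hS.exists_expansion p
  obtain ⟨F, -, hF, hfF, -⟩ := hexp f hf
  have h : ContMDiffAt I 𝓘(ℝ, ℝ) ∞ (fun q => ∑ i, F i q * lieFun X (x i) q) p :=
    contMDiffAt_finsetSum fun i _ => (hF i).mul (hX _ (hxS i) p)
  refine h.congr_of_eventuallyEq ?_
  filter_upwards [hfF] with q hq
  simp [lieFun_apply, hq]

theorem ContainsCoordinates.smoothBivectorField (hS : ContainsCoordinates I S)
    {Λ : ∀ x : N, Bivector I x} (hΛ : ∀ f ∈ S, ∀ g ∈ S, SmoothFun I (pairing Λ f g)) :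
    SmoothBivectorField I Λ := by
  have key : ∀ f, SmoothFun I f → ∀ g ∈ S, SmoothFun I (pairing Λ f g) := by
    intro f hf g hg p
    obtain ⟨x, hxS, -, hexp⟩ := hS.exists_expansion p
    obtain ⟨F, -, hF, hfF, -⟩ := hexp f hf
    have h : ContMDiffAt I 𝓘(ℝ, ℝ) ∞ (fun q => ∑ i, F i q * pairing Λ (x i) g q) p :=
      contMDiffAt_finsetSum fun i _ => (hF i).mul (hΛ _ (hxS i) g hg p)
    refine h.congr_of_eventuallyEq ?_
    filter_upwards [hfF] with q hq
    simp [pairing_apply, hq]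
  intro f g hf hg p
  obtain ⟨x, hxS, -, hexp⟩ := hS.exists_expansion p
  obtain ⟨F, -, hF, hgF, -⟩ := hexp g hg
  have h : ContMDiffAt I 𝓘(ℝ, ℝ) ∞ (fun q => ∑ i, F i q * pairing Λ f (x i) q) p :=
    contMDiffAt_finsetSum fun i _ => (hF i).mul (key f hf _ (hxS i) p)
  refine h.congr_of_eventuallyEq ?_
  filter_upwards [hgF] with q hq
  simp [pairing_apply, hq]

/-- The commutator of two vector fields is of first order. -/
theorem ContainsCoordinates.commutator_congr (hS : ContainsCoordinates I S)
    {X Y : ∀ x : N, TangentSpace I x} (hX : SmoothVectorField I X) (hY : SmoothVectorField I Y)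
    {f g : N → ℝ} (hf : SmoothFun I f) (hg : SmoothFun I g) {p : N}
    (hfg : dif I f p = dif I g p) :
    lieFun X (lieFun Y f) p - lieFun Y (lieFun X f) p =
      lieFun X (lieFun Y g) p - lieFun Y (lieFun X g) p := by
  obtain ⟨x, hxS, hli, hexp⟩ := hS.exists_expansion p
  have hx := fun i => hS.smooth _ (hxS i)
  obtain ⟨F, G, hF, hfF, hG, hFG⟩ := hexp (f - g) (hf.sub hg)
  -- The coordinate differentials are independent at `p`, where `d(f - g)` vanishes. Hence only the
  -- derivatives of the `F i` survive when `∑ F i * Y(x i)` is differentiated at `p`.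
  have hF0 : ∀ i, F i p = 0 := by
    have h0 : ∑ i, F i p • dif I (x i) p = 0 := by
      rw [← hfF.self_of_nhds, dif_sub (hf.mdifferentiableAt p) (hg.mdifferentiableAt p), hfg,
        sub_self]
    exact hli _ h0
  have key : ∀ {X Y : ∀ x : N, TangentSpace I x}, SmoothVectorField I Y →
      lieFun X (lieFun Y (f - g)) p =
        ∑ i, ∑ j, G i j * lieFun X (x j) p * lieFun Y (x i) p := by
    intro X Y hY
    have h1 : lieFun Y (f - g) =ᶠ[𝓝 p] ∑ i, F i * lieFun Y (x i) := by
      filter_upwards [hfF] with q hq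
      simp [lieFun_apply, hq]
    have hFd := fun i => (hF i).mdifferentiableAt (n := ∞) (by simp)
    have hYd := fun i => (hY _ (hx i)).mdifferentiableAt p
    rw [lieFun_apply, h1.dif_eq,
      (dif_sum (I := I) Finset.univ fun i _ => (hFd i).mul (hYd i)).2, LinearMap.sum_apply]
    refine Finset.sum_congr rfl fun i _ => ?_
    rw [dif_mul (hFd i) (hYd i), hF0 i, zero_smul, zero_add, hFG i, LinearMap.smul_apply,
      LinearMap.sum_apply, smul_eq_mul, mul_comm, Finset.sum_mul]
    rfl
  have h1 := key (X := X) hY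
  have h2 := key (X := Y) hX
  -- At the critical point `p` of `f - g`, both sides are its Hessian evaluated on the two vectors.
  have h3 : lieFun X (lieFun Y (f - g)) p = lieFun Y (lieFun X (f - g)) p := by
    rw [h1, h2, Finset.sum_comm]
    refine Finset.sum_congr rfl fun i _ => Finset.sum_congr rfl fun j _ => ?_
    rw [hG]; ring
  rw [lieFun_sub _ hf hg, lieFun_sub _ hf hg, lieFun_sub _ (hY f hf) (hY g hg),
    lieFun_sub _ (hX f hf) (hX g hg), Pi.sub_apply, Pi.sub_apply] at h3
  linarith

variable {Λ : ∀ x : N, Bivector I x} {E : ∀ x : N, TangentSpace I x}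

/-- The Lie derivative of a bivector field is tensorial. -/
theorem ContainsCoordinates.lieBivector_congr (hS : ContainsCoordinates I S)
    (hΛ : SmoothBivectorField I Λ) (hE : SmoothVectorField I E) {f f' g g' : N → ℝ}
    (hf : SmoothFun I f) (hf' : SmoothFun I f') (hg : SmoothFun I g) (hg' : SmoothFun I g') {p : N}
    (h1 : dif I f p = dif I f' p) (h2 : dif I g p = dif I g' p) :
    lieBivector E Λ f g p = lieBivector E Λ f' g' p := by
  have right : ∀ {f g g' : N → ℝ}, SmoothFun I f → SmoothFun I g → SmoothFun I g' →
      dif I g p = dif I g' p → lieBivector E Λ f g p = lieBivector E Λ f g' p := by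
    intro f g g' hf hg hg' h
    -- As operators on `g`, two of the three terms form the commutator of `E` with the hamiltonian
    -- field of `f`; the third one sees only `dg`.
    have hc := hS.commutator_congr hE (hΛ.smooth_hamiltonian hf) hg hg' h
    simp only [lieFun_sharp] at hc
    simp only [lieBivector, Pi.sub_apply]
    rw [pairing_apply _ (lieFun E f), pairing_apply _ (lieFun E f), h]
    linarith
  have swap : ∀ f g : N → ℝ, lieBivector E Λ f g = -lieBivector E Λ g f := by
    intro f g
    rw [lieBivector, lieBivector, pairing_swap Λ f, pairing_swap Λ g, pairing_swap Λ f (lieFun E g),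
      lieFun_neg]
    rw [pairing_swap Λ (lieFun E f) g, pairing_swap Λ f g]
    simp only [lieFun_neg]
    ring
  rw [right hf hg hg' h2, swap f g', swap f' g', Pi.neg_apply, Pi.neg_apply, right hg' hf hf' h1]

/-- The Schouten square of a bivector field is tensorial. -/
theorem ContainsCoordinates.schouten_congr (hS : ContainsCoordinates I S)
    (hΛ : SmoothBivectorField I Λ) {f f' g g' h h' : N → ℝ}
    (hf : SmoothFun I f) (hf' : SmoothFun I f') (hg : SmoothFun I g) (hg' : SmoothFun I g')
    (hh : SmoothFun I h) (hh' : SmoothFun I h') {p : N}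
    (h1 : dif I f p = dif I f' p) (h2 : dif I g p = dif I g' p) (h3 : dif I h p = dif I h' p) :
    schouten Λ Λ f g h p = schouten Λ Λ f' g' h' p := by
  have last : ∀ {f g h h' : N → ℝ}, SmoothFun I f → SmoothFun I g → SmoothFun I h →
      SmoothFun I h' → dif I h p = dif I h' p →
      schouten Λ Λ f g h p = schouten Λ Λ f g h' p := by
    intro f g h h' hf hg hh hh' e
    -- The two terms in which `h` is differentiated twice form the commutator of the hamiltonian
    -- fields of `f` and `g`.
    have hc := hS.commutator_congr (hΛ.smooth_hamiltonian hf) (hΛ.smooth_hamiltonian hg) hh hh' e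
    simp only [lieFun_sharp] at hc
    rw [schouten_self_eq, schouten_self_eq, pairing_swap Λ h f, pairing_swap Λ h' f,
      pairing_neg_right, pairing_neg_right]
    simp only [Pi.smul_apply, Pi.add_apply, Pi.neg_apply]
    rw [pairing_apply Λ h, pairing_apply Λ h', e]
    congr 1
    linarith
  rw [last hf hg hh hh' h3, schouten_self_cyclic, last hg hh' hf hf' h1, schouten_self_cyclic,
    last hh' hf' hg hg' h2, schouten_self_cyclic]

end Coordinates

/-! ### Related tensors -/

section Related

variable {EN : Type*} [NormedAddCommGroup EN] [NormedSpace ℝ EN]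
  {HN : Type*} [TopologicalSpace HN] {I : ModelWithCorners ℝ EN HN}
  {N : Type*} [TopologicalSpace N] [ChartedSpace HN N]
  {EN' : Type*} [NormedAddCommGroup EN'] [NormedSpace ℝ EN']
  {HN' : Type*} [TopologicalSpace HN'] {I' : ModelWithCorners ℝ EN' HN'}
  {N' : Type*} [TopologicalSpace N'] [ChartedSpace HN' N']
  {φ : N → N'}

theorem lieFun_comp_of_related (hφ : ContMDiff I I' ∞ φ) {X : ∀ x : N, TangentSpace I x}
    {X' : ∀ x : N', TangentSpace I' x} (h : ∀ x, X' (φ x) = mfderiv I I' φ x (X x)) {f : N' → ℝ}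
    (hf : SmoothFun I' f) : lieFun X (f ∘ φ) = lieFun X' f ∘ φ := by
  ext x
  rw [lieFun_apply, dif_comp_apply (hf.mdifferentiableAt _) ((hφ x).mdifferentiableAt (by simp)),
    Function.comp_apply, lieFun_apply, h]

theorem altBilin_pushBivector (x : N) (Λ : Bivector I x) (α β : Cotangent I' (φ x)) :
    altBilin (pushBivector I I' φ x Λ) α β =
      altBilin Λ (α.comp (mfderiv I I' φ x).toLinearMap)
        (β.comp (mfderiv I I' φ x).toLinearMap) :=
  altBilin_compLinearMap _ _ _ _

theorem pairing_comp_of_related (hφ : ContMDiff I I' ∞ φ) {Λ : ∀ x : N, Bivector I x}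
    {Λ' : ∀ x : N', Bivector I' x} (h : ∀ x, Λ' (φ x) = pushBivector I I' φ x (Λ x))
    {f g : N' → ℝ} (hf : SmoothFun I' f) (hg : SmoothFun I' g) :
    pairing Λ (f ∘ φ) (g ∘ φ) = pairing Λ' f g ∘ φ := by
  ext x
  have hx := (hφ x).mdifferentiableAt (n := ∞) (by simp)
  rw [pairing_apply, dif_comp (hf.mdifferentiableAt _) hx, dif_comp (hg.mdifferentiableAt _) hx,
    Function.comp_apply, pairing_apply, h, altBilin_pushBivector]

theorem IsRelated.bracket_comp {J : JacobiStructure I N} {K : JacobiStructure I' N'}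
    (h : IsRelated φ J K) (hφ : ContMDiff I I' ∞ φ) {f g : N' → ℝ} (hf : SmoothFun I' f)
    (hg : SmoothFun I' g) : J.bracket (f ∘ φ) (g ∘ φ) = K.bracket f g ∘ φ := by
  have h1 := pairing_comp_of_related hφ (fun x => (h x).2) hf hg
  have h2 := lieFun_comp_of_related hφ (fun x => (h x).1) hf
  have h3 := lieFun_comp_of_related hφ (fun x => (h x).1) hg
  ext x
  rw [JacobiStructure.bracket_apply, h1, h2, h3]
  rfl

theorem schouten_comp_of_related (hφ : ContMDiff I I' ∞ φ) {Λ : ∀ x : N, Bivector I x}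
    {Λ' : ∀ x : N', Bivector I' x} (h : ∀ x, Λ' (φ x) = pushBivector I I' φ x (Λ x))
    (hΛ' : SmoothBivectorField I' Λ') {f g k : N' → ℝ} (hf : SmoothFun I' f)
    (hg : SmoothFun I' g) (hk : SmoothFun I' k) :
    schouten Λ Λ (f ∘ φ) (g ∘ φ) (k ∘ φ) = schouten Λ' Λ' f g k ∘ φ := by
  simp only [schouten, pairing_comp_of_related hφ h hg hk, pairing_comp_of_related hφ h hk hf,
    pairing_comp_of_related hφ h hf hg, pairing_comp_of_related hφ h hf (hΛ' _ _ hg hk),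
    pairing_comp_of_related hφ h hg (hΛ' _ _ hk hf),
    pairing_comp_of_related hφ h hk (hΛ' _ _ hf hg)]
  rfl

theorem wedgeVB_comp_of_related (hφ : ContMDiff I I' ∞ φ) {Λ : ∀ x : N, Bivector I x}
    {Λ' : ∀ x : N', Bivector I' x} (h : ∀ x, Λ' (φ x) = pushBivector I I' φ x (Λ x))
    {X : ∀ x : N, TangentSpace I x} {X' : ∀ x : N', TangentSpace I' x}
    (hX : ∀ x, X' (φ x) = mfderiv I I' φ x (X x)) {f g k : N' → ℝ} (hf : SmoothFun I' f)
    (hg : SmoothFun I' g) (hk : SmoothFun I' k) :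
    wedgeVB X Λ (f ∘ φ) (g ∘ φ) (k ∘ φ) = wedgeVB X' Λ' f g k ∘ φ := by
  simp only [wedgeVB, pairing_comp_of_related hφ h hg hk, pairing_comp_of_related hφ h hk hf,
    pairing_comp_of_related hφ h hf hg, lieFun_comp_of_related hφ hX hf,
    lieFun_comp_of_related hφ hX hg, lieFun_comp_of_related hφ hX hk]
  rfl

theorem lieBivector_comp_of_related (hφ : ContMDiff I I' ∞ φ) {Λ : ∀ x : N, Bivector I x}
    {Λ' : ∀ x : N', Bivector I' x} (h : ∀ x, Λ' (φ x) = pushBivector I I' φ x (Λ x))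
    (hΛ' : SmoothBivectorField I' Λ') {X : ∀ x : N, TangentSpace I x}
    {X' : ∀ x : N', TangentSpace I' x} (hX : ∀ x, X' (φ x) = mfderiv I I' φ x (X x))
    (hX' : SmoothVectorField I' X') {f g : N' → ℝ} (hf : SmoothFun I' f) (hg : SmoothFun I' g) :
    lieBivector X Λ (f ∘ φ) (g ∘ φ) = lieBivector X' Λ' f g ∘ φ := by
  simp only [lieBivector, pairing_comp_of_related hφ h hf hg, lieFun_comp_of_related hφ hX hf,
    lieFun_comp_of_related hφ hX hg, lieFun_comp_of_related hφ hX (hΛ' _ _ hf hg),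
    pairing_comp_of_related hφ h (hX' f hf) hg, pairing_comp_of_related hφ h hf (hX' g hg)]
  rfl

/-- Tensors that are related to those of a Jacobi structure by a map through which coordinate
functions factor form a Jacobi structure. -/
def JacobiStructure.ofRelated [I.Boundaryless] [FiniteDimensional ℝ EN]
    (hφ : ContMDiff I I' ∞ φ) {S : Set (N → ℝ)} (hS : ContainsCoordinates I S)
    (hSφ : ∀ f ∈ S, ∃ g : N' → ℝ, SmoothFun I' g ∧ g ∘ φ = f) (K : JacobiStructure I' N')
    (Λ : ∀ x : N, Bivector I x) (E : ∀ x : N, TangentSpace I x)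
    (hΛ : ∀ x, K.Λ (φ x) = pushBivector I I' φ x (Λ x))
    (hE : ∀ x, K.E (φ x) = mfderiv I I' φ x (E x)) : JacobiStructure I N :=
  have hsΛ : SmoothBivectorField I Λ := hS.smoothBivectorField fun f hf g hg => by
    obtain ⟨f, hf', rfl⟩ := hSφ f hf
    obtain ⟨g, hg', rfl⟩ := hSφ g hg
    rw [pairing_comp_of_related hφ hΛ hf' hg']
    exact (K.smoothΛ f g hf' hg').comp hφ
  have hsE : SmoothVectorField I E := hS.smoothVectorField fun f hf => by
    obtain ⟨f, hf', rfl⟩ := hSφ f hf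
    rw [lieFun_comp_of_related hφ hE hf']
    exact (K.smoothE f hf').comp hφ
  { Λ, E
    smoothΛ := hsΛ
    smoothE := hsE
    schouten_self := fun f g h hf hg hh => by
      ext p
      -- By tensoriality, the arguments may be replaced at `p` by functions of `S`. These are pulled
      -- back from `N'`, where the identity is known.
      obtain ⟨a, ha, hfa⟩ := hS.exists_dif_eq p (dif I f p)
      obtain ⟨b, hb, hgb⟩ := hS.exists_dif_eq p (dif I g p)
      obtain ⟨c, hc, hhc⟩ := hS.exists_dif_eq p (dif I h p)
      have h1 := hS.schouten_congr hsΛ hf (hS.smooth a ha) hg (hS.smooth b hb) hh (hS.smooth c hc)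
        hfa.symm hgb.symm hhc.symm
      have h2 := wedgeVB_congr (Λ := Λ) (E := E) hfa.symm hgb.symm hhc.symm
      obtain ⟨a, ha', rfl⟩ := hSφ a ha
      obtain ⟨b, hb', rfl⟩ := hSφ b hb
      obtain ⟨c, hc', rfl⟩ := hSφ c hc
      rw [Pi.smul_apply, h1, h2, schouten_comp_of_related hφ hΛ K.smoothΛ ha' hb' hc',
        wedgeVB_comp_of_related hφ hΛ hE ha' hb' hc', K.schouten_self a b c ha' hb' hc']
      rfl
    lie_E := fun f g hf hg => by
      ext p
      obtain ⟨a, ha, hfa⟩ := hS.exists_dif_eq p (dif I f p)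
      obtain ⟨b, hb, hgb⟩ := hS.exists_dif_eq p (dif I g p)
      have h1 := hS.lieBivector_congr hsΛ hsE hf (hS.smooth a ha) hg (hS.smooth b hb)
        hfa.symm hgb.symm
      obtain ⟨a, ha', rfl⟩ := hSφ a ha
      obtain ⟨b, hb', rfl⟩ := hSφ b hb
      rw [h1, lieBivector_comp_of_related hφ hΛ K.smoothΛ hE K.smoothE ha' hb', K.lie_E a b ha' hb']
      rfl }

end Related

/-! ### Hulls -/

/-- Let `R` be a left inverse of `L`. A covector and its image under `R* L*` agree on the range of
`L`, which is the kernel of `θ`, so they differ by a multiple of `θ`; and `Λ` does not see `θ`. This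
is the linear algebra of a bivector tangent to a hypersurface. -/
theorem exists_eq_compLinearMap_dualMap {W W' : Type*} [AddCommGroup W] [Module ℝ W]
    [AddCommGroup W'] [Module ℝ W'] (L : W →ₗ[ℝ] W') (hL : Function.Injective L)
    {θ : Dual ℝ W'} {u : W'} (hu : θ u = 1) (hθ : LinearMap.range L = LinearMap.ker θ)
    {Λ : Dual ℝ W' [⋀^Fin 2]→ₗ[ℝ] ℝ} (hΛ : ∀ β, altBilin Λ θ β = 0) :
    ∃ Λ₀ : Dual ℝ W [⋀^Fin 2]→ₗ[ℝ] ℝ, Λ = Λ₀.compLinearMap L.dualMap := by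
  obtain ⟨R, hR⟩ := L.exists_leftInverse_of_injective (LinearMap.ker_eq_bot.2 hL)
  have key : ∀ α : Dual ℝ W', ∃ k : ℝ, α = R.dualMap (L.dualMap α) + k • θ := by
    intro α
    refine ⟨(α - R.dualMap (L.dualMap α)) u, LinearMap.ext fun v => ?_⟩
    obtain ⟨w, hw⟩ : v - θ v • u ∈ LinearMap.range L := by
      rw [hθ, LinearMap.mem_ker, map_sub, map_smul, hu, smul_eq_mul, mul_one, sub_self]
    have hv : v = L w + θ v • u := by rw [hw, sub_add_cancel]
    have hRL : R (L w) = w := LinearMap.congr_fun hR w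
    conv_lhs => rw [hv]
    conv_rhs => rw [LinearMap.add_apply, hv]
    have hLw : θ (L w) = 0 := by
      have : L w ∈ LinearMap.ker θ := hθ ▸ LinearMap.mem_range_self L w
      exact this
    simp [hRL, hLw, hu]
    ring
  refine ⟨Λ.compLinearMap R.dualMap, altBilin_injective (LinearMap.ext₂ fun α β => ?_)⟩
  rw [altBilin_compLinearMap, altBilin_compLinearMap]
  obtain ⟨k, hk⟩ := key α
  obtain ⟨l, hl⟩ := key β
  conv_lhs => rw [hk, hl]
  simp only [map_add, map_smul, LinearMap.add_apply, LinearMap.smul_apply, hΛ,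
    altBilin_swap Λ _ θ]
  simp

section Hulls

variable {EN : Type*} [NormedAddCommGroup EN] [NormedSpace ℝ EN]
  {HN : Type*} [TopologicalSpace HN] (I : ModelWithCorners ℝ EN HN)
  {N : Type*} [TopologicalSpace N] [ChartedSpace HN N]
  {EN' : Type*} [NormedAddCommGroup EN'] [NormedSpace ℝ EN']
  {HN' : Type*} [TopologicalSpace HN'] (I' : ModelWithCorners ℝ EN' HN')
  {N' : Type*} [TopologicalSpace N'] [ChartedSpace HN' N'] {S : Type*}

/-- The situation of a manifold `N` that is included in a manifold `N'` of one more dimension with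
a Liouville vector field `Δ`, such that the functions `fn a` on `N` are the restrictions of
homogeneous functions `bar a` on `N'`, and `N` is contained in the hypersurface on which the
homogeneous function `bar one` is equal to one. -/
structure IsHull (φ : N → N') (Δ : ∀ x : N', TangentSpace I' x) (one : S) (fn : S → N → ℝ)
    (bar : S → N' → ℝ) : Prop where
  smooth_incl : ContMDiff I I' ∞ φ
  smooth_bar : ∀ a, SmoothFun I' (bar a)
  smooth_liouville : SmoothVectorField I' Δ
  lie_bar : ∀ a, lieFun Δ (bar a) = bar a
  bar_comp : ∀ a, bar a ∘ φ = fn a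
  fn_one : fn one = 1
  ext_bar : ∀ a b, fn a = fn b → bar a = bar b
  exists_add : ∀ a b, ∃ c, fn c = fn a + fn b ∧ bar c = bar a + bar b
  coords : ContainsCoordinates I (range fn)
  coords' : ContainsCoordinates I' {f : N' → ℝ | SmoothFun I' f}
  dense : Dense {y | bar one y ≠ 0}
  span : ∀ y, bar one y ≠ 0 → ∀ c : Cotangent I' y, ∃ a, dif I' (bar a) y = c
  finrank_eq : finrank ℝ EN' = finrank ℝ EN + 1

variable {I I'} {φ : N → N'} {Δ : ∀ x : N', TangentSpace I' x} {one : S} {fn : S → N → ℝ}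
  {bar : S → N' → ℝ}

/-- A bivector field is linear if the bracket of the functions `bar a` and `bar b` is a function
`bar c`. -/
def IsLinearFor (bar : S → N' → ℝ) (Λ : ∀ x : N', Bivector I' x) : Prop :=
  ∀ a b, ∃ c, pairing Λ (bar a) (bar b) = bar c

namespace IsHull

theorem smooth_fn (h : IsHull I I' φ Δ one fn bar) (a : S) : SmoothFun I (fn a) :=
  h.coords.smooth _ (mem_range_self a)

theorem eq_of_eq_on (h : IsHull I I' φ Δ one fn bar) {f g : N' → ℝ}
    (hf : SmoothFun I' f) (hg : SmoothFun I' g)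
    (hfg : ∀ y, bar one y ≠ 0 → f y = g y) : f = g :=
  Continuous.ext_on h.dense hf.continuous hg.continuous fun y hy => hfg y hy

section

variable [I'.Boundaryless] [FiniteDimensional ℝ EN']

/-- Where `bar one` does not vanish, every covector is the differential of some `bar a`; density and
continuity reach the remaining points. -/
theorem bivector_ext (h : IsHull I I' φ Δ one fn bar)
    {Λ Λ' : ∀ x : N', Bivector I' x} (hΛ : SmoothBivectorField I' Λ)
    (hΛ' : SmoothBivectorField I' Λ')
    (hb : ∀ a b, pairing Λ (bar a) (bar b) = pairing Λ' (bar a) (bar b)) : Λ = Λ' := by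
  have key : ∀ f g, SmoothFun I' f → SmoothFun I' g → pairing Λ f g = pairing Λ' f g := by
    intro f g hf hg
    refine h.eq_of_eq_on (hΛ f g hf hg) (hΛ' f g hf hg) fun y hy => ?_
    obtain ⟨a, ha⟩ := h.span y hy (dif I' f y)
    obtain ⟨b, hb'⟩ := h.span y hy (dif I' g y)
    rw [pairing_apply, pairing_apply, ← ha, ← hb', ← pairing_apply, ← pairing_apply, hb]
  ext1 y
  refine altBilin_injective (LinearMap.ext₂ fun α β => ?_)
  obtain ⟨f, hf, rfl⟩ := h.coords'.exists_dif_eq y α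
  obtain ⟨g, hg, rfl⟩ := h.coords'.exists_dif_eq y β
  exact congrFun (key f g hf hg) y

/-- Both sides are tensorial, so functions `bar a`, `bar b` suffice where they span. There the Lie
derivative is one copy of the bracket, which has degree one, minus two copies. -/
theorem isHomogeneous (h : IsHull I I' φ Δ one fn bar)
    {Λ : ∀ x : N', Bivector I' x} (hΛ : SmoothBivectorField I' Λ)
    (hlin : IsLinearFor bar Λ) : IsHomogeneous Δ Λ := by
  intro f g hf hg
  have hs : SmoothFun I' (lieBivector Δ Λ f g) :=
    ((h.smooth_liouville _ (hΛ f g hf hg)).sub (hΛ _ _ (h.smooth_liouville f hf) hg)).sub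
      (hΛ _ _ hf (h.smooth_liouville g hg))
  refine h.eq_of_eq_on hs (hΛ f g hf hg).neg fun y hy => ?_
  obtain ⟨a, ha⟩ := h.span y hy (dif I' f y)
  obtain ⟨b, hb⟩ := h.span y hy (dif I' g y)
  rw [h.coords'.lieBivector_congr hΛ h.smooth_liouville hf (h.smooth_bar a) hg (h.smooth_bar b)
    ha.symm hb.symm, Pi.neg_apply, pairing_apply, ← ha, ← hb, ← pairing_apply]
  obtain ⟨c, hc⟩ := hlin a b
  rw [lieBivector, h.lie_bar, h.lie_bar, hc, h.lie_bar]
  simp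

/-- A smooth bivector field for which the functions `bar a` have the brackets given by a Jacobi
structure is a Poisson structure. -/
def toPoisson (h : IsHull I I' φ Δ one fn bar) (J : JacobiStructure I N)
    {Λ : ∀ x : N', Bivector I' x}
    (hΛ : SmoothBivectorField I' Λ)
    (hJ : ∀ a b, ∃ c, pairing Λ (bar a) (bar b) = bar c ∧ fn c = J.bracket (fn a) (fn b)) :
    PoissonStructure I' N' where
  Λ := Λ
  smoothΛ := hΛ
  schouten_self f g k hf hg hk := by
    have hs : SmoothFun I' (schouten Λ Λ f g k) := by
      rw [schouten_self_eq]
      exact (((hΛ _ _ hf (hΛ _ _ hg hk)).add (hΛ _ _ hg (hΛ _ _ hk hf))).add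
        (hΛ _ _ hk (hΛ _ _ hf hg))).const_smul 2
    refine h.eq_of_eq_on hs (smoothFun_const 0) fun y hy => ?_
    obtain ⟨a, ha⟩ := h.span y hy (dif I' f y)
    obtain ⟨b, hb⟩ := h.span y hy (dif I' g y)
    obtain ⟨c, hc⟩ := h.span y hy (dif I' k y)
    rw [h.coords'.schouten_congr hΛ hf (h.smooth_bar a) hg (h.smooth_bar b) hk (h.smooth_bar c)
      ha.symm hb.symm hc.symm, schouten_self_eq]
    obtain ⟨ab, hab, hab'⟩ := hJ a b
    obtain ⟨bc, hbc, hbc'⟩ := hJ b c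
    obtain ⟨ca, hca, hca'⟩ := hJ c a
    obtain ⟨abc, habc, habc'⟩ := hJ a bc
    obtain ⟨bca, hbca, hbca'⟩ := hJ b ca
    obtain ⟨cab, hcab, hcab'⟩ := hJ c ab
    rw [hbc, hca, hab, habc, hbca, hcab]
    -- the sum of the three functions vanishes because its restriction to `N` does
    obtain ⟨z, hz, -⟩ := hJ one one
    obtain ⟨s, hs, hs'⟩ := h.exists_add abc bca
    obtain ⟨t, ht, ht'⟩ := h.exists_add s cab
    -- The class is not assumed to contain zero, so `z`, the bracket of `one` with itself, stands
    -- for it.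
    have hfn : fn t = fn z := by
      rw [ht, hs, habc', hbca', hcab', hab', hbc', hca',
        J.jacobi (h.smooth_fn a) (h.smooth_fn b) (h.smooth_fn c), ← h.bar_comp, ← hz, pairing_self]
      rfl
    rw [← hs', ← ht', h.ext_bar t z hfn, ← hz, pairing_self, smul_zero]

end

theorem dif_one_mfderiv (h : IsHull I I' φ Δ one fn bar) (x : N) (v : TangentSpace I x) :
    dif I' (bar one) (φ x) (mfderiv I I' φ x v) = 0 := by
  rw [← dif_comp_apply ((h.smooth_bar one).mdifferentiableAt _)
    ((h.smooth_incl x).mdifferentiableAt (by simp)), h.bar_comp, h.fn_one]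
  exact LinearMap.congr_fun (dif_const 1 x) v

theorem bar_one_incl (h : IsHull I I' φ Δ one fn bar) (x : N) : bar one (φ x) = 1 := by
  have := congrFun (h.bar_comp one) x
  rw [h.fn_one] at this
  exact this

theorem dif_one_liouville (h : IsHull I I' φ Δ one fn bar) (x : N) :
    dif I' (bar one) (φ x) (Δ (φ x)) = 1 := by
  rw [← lieFun_apply, h.lie_bar, h.bar_one_incl]

section

variable [I.Boundaryless] [FiniteDimensional ℝ EN]

/-- Since `fn a` factors through `φ`, a vector killed by the tangent map is killed by every `d(fn
a)`, and these exhaust the covectors. -/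
theorem mfderiv_injective (h : IsHull I I' φ Δ one fn bar) (x : N) :
    Function.Injective (mfderiv I I' φ x) := by
  rw [injective_iff_map_eq_zero]
  intro v hv
  refine (forall_dual_apply_eq_zero_iff ℝ v).1 fun c => ?_
  obtain ⟨_, ⟨a, rfl⟩, rfl⟩ := h.coords.exists_dif_eq x c
  rw [← h.bar_comp, dif_comp_apply ((h.smooth_bar a).mdifferentiableAt _)
    ((h.smooth_incl x).mdifferentiableAt (by simp)), hv, map_zero]

/-- The inclusion holds because `bar one` is constant on `N`. Equality follows by counting
dimensions, as `d(bar one)` takes the value `1` on `Δ` and so is onto. -/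
theorem range_mfderiv [FiniteDimensional ℝ EN'] (h : IsHull I I' φ Δ one fn bar) (x : N) :
    LinearMap.range (mfderiv I I' φ x).toLinearMap = LinearMap.ker (dif I' (bar one) (φ x)) := by
  have : FiniteDimensional ℝ (TangentSpace I x) := inferInstanceAs (FiniteDimensional ℝ EN)
  have : FiniteDimensional ℝ (TangentSpace I' (φ x)) := inferInstanceAs (FiniteDimensional ℝ EN')
  refine Submodule.eq_of_le_of_finrank_le ?_ ?_
  · rintro _ ⟨v, rfl⟩
    exact h.dif_one_mfderiv x v
  · have h1 := LinearMap.finrank_range_of_inj (f := (mfderiv I I' φ x).toLinearMap)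
      (h.mfderiv_injective x)
    have h2 := LinearMap.finrank_range_add_finrank_ker (dif I' (bar one) (φ x))
    have h3 : LinearMap.range (dif I' (bar one) (φ x)) = ⊤ := by
      rw [LinearMap.range_eq_top]
      intro t
      exact ⟨t • Δ (φ x), by rw [map_smul, h.dif_one_liouville, smul_eq_mul, mul_one]⟩
    rw [h3, finrank_top, finrank_self] at h2
    have h4 : finrank ℝ (TangentSpace I' (φ x)) = finrank ℝ (TangentSpace I x) + 1 := h.finrank_eq
    omega

variable [I'.Boundaryless] [FiniteDimensional ℝ EN']

/-- The Jacobi structure on `N'` that a linear Poisson structure induces. -/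
def hullJacobi (h : IsHull I I' φ Δ one fn bar) (P : PoissonStructure I' N')
    (hP : IsLinearFor bar P.Λ) : JacobiStructure I' N' :=
  P.toJacobi Δ h.smooth_liouville (h.isHomogeneous P.smoothΛ hP) (bar one) (h.smooth_bar one)
    (h.lie_bar one)

/-- Write `ι` for `bar one`. At points of `N`, `Δ(ι) = ι = 1`, and `E(ι) = 0` by antisymmetry.
Contraction of `Λ̄ - Δ ∧ E` with `dι` is therefore `E - E = 0`. Being annihilated by `dι` amounts to
being tangent. -/
theorem exists_tangent (h : IsHull I I' φ Δ one fn bar) (P : PoissonStructure I' N')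
    (hP : IsLinearFor bar P.Λ) (x : N) : ∃ (E : TangentSpace I x) (Λ : Bivector I x),
      (h.hullJacobi P hP).E (φ x) = mfderiv I I' φ x E ∧
      (h.hullJacobi P hP).Λ (φ x) = pushBivector I I' φ x Λ := by
  have hE : dif I' (bar one) (φ x) ((h.hullJacobi P hP).E (φ x)) = 0 :=
    (apply_sharp _ _ _).trans (altBilin_self _ _)
  have hΛ : ∀ β, altBilin ((h.hullJacobi P hP).Λ (φ x)) (dif I' (bar one) (φ x)) β = 0 := by
    intro β
    change altBilin (P.Λ (φ x) - wedge I' (Δ (φ x)) (sharp I' (P.Λ (φ x)) _)) _ β = 0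
    rw [altBilin_apply, AlternatingMap.sub_apply, ← altBilin_apply, ← altBilin_apply,
      altBilin_wedge, apply_sharp, apply_sharp, altBilin_self, h.dif_one_liouville]
    ring
  obtain ⟨E, hE'⟩ := (h.range_mfderiv x).ge hE
  obtain ⟨Λ, hΛ'⟩ := exists_eq_compLinearMap_dualMap (mfderiv I I' φ x).toLinearMap
    (h.mfderiv_injective x) (h.dif_one_liouville x) (h.range_mfderiv x) hΛ
  exact ⟨E, Λ, hE'.symm, hΛ'⟩

/-- The Jacobi structure on `N` that a linear Poisson structure induces. -/
def restrict (h : IsHull I I' φ Δ one fn bar) (P : PoissonStructure I' N')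
    (hP : IsLinearFor bar P.Λ) : JacobiStructure I N :=
  JacobiStructure.ofRelated h.smooth_incl h.coords
    (by rintro _ ⟨a, rfl⟩; exact ⟨bar a, h.smooth_bar a, h.bar_comp a⟩) (h.hullJacobi P hP)
    (fun x => (h.exists_tangent P hP x).choose_spec.choose)
    (fun x => (h.exists_tangent P hP x).choose)
    (fun x => (h.exists_tangent P hP x).choose_spec.choose_spec.2)
    (fun x => (h.exists_tangent P hP x).choose_spec.choose_spec.1)

theorem isRelated_restrict (h : IsHull I I' φ Δ one fn bar) (P : PoissonStructure I' N')
    (hP : IsLinearFor bar P.Λ) : IsRelated φ (h.restrict P hP) (h.hullJacobi P hP) :=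
  fun x => (h.exists_tangent P hP x).choose_spec.choose_spec

/-- On functions of degree one, the term `-Δ ∧ E` of the bivector field cancels the first-order part
`ā E(b̄) - b̄ E(ā)` of the Jacobi bracket. -/
theorem bracket_restrict (h : IsHull I I' φ Δ one fn bar) (P : PoissonStructure I' N')
    (hP : IsLinearFor bar P.Λ) (a b : S) :
    (h.restrict P hP).bracket (fn a) (fn b) = P.bracket (bar a) (bar b) ∘ φ := by
  have h1 := (h.isRelated_restrict P hP).bracket_comp h.smooth_incl (h.smooth_bar a)
    (h.smooth_bar b)
  rw [h.bar_comp, h.bar_comp] at h1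
  rw [h1]
  congr 1
  simp only [JacobiStructure.bracket, PoissonStructure.bracket, hullJacobi,
    PoissonStructure.toJacobi, pairing_sub_wedge, h.lie_bar]
  ring

end

/-- A Jacobi structure is determined by the brackets of the functions `fn a`. -/
theorem jacobi_ext [I.Boundaryless] [FiniteDimensional ℝ EN] (h : IsHull I I' φ Δ one fn bar)
    {J J' : JacobiStructure I N}
    (hJ : ∀ a b, J.bracket (fn a) (fn b) = J'.bracket (fn a) (fn b)) : J = J' := by
  have hE : ∀ a, lieFun J.E (fn a) = lieFun J'.E (fn a) := fun a => by
    have h1 := hJ one a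
    -- The bracket with the constant `1` recovers `E`; then `Λ` is what remains of the bracket.
    have h2 : ∀ J : JacobiStructure I N,
        J.bracket (fn one) (fn a) = lieFun J.E (fn a) := fun J => by
      rw [JacobiStructure.bracket, h.fn_one, lieFun_one, pairing_swap]
      have h3 : pairing J.Λ (fn a) 1 = 0 := pairing_const_right _ _ 1
      rw [h3]
      ring
    rwa [h2, h2] at h1
  have hΛ : ∀ a b, pairing J.Λ (fn a) (fn b) = pairing J'.Λ (fn a) (fn b) := fun a b => by
    have h1 := hJ a b
    rw [JacobiStructure.bracket, JacobiStructure.bracket, hE a, hE b] at h1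
    linear_combination h1
  apply JacobiStructure.ext
  · ext1 x
    refine altBilin_injective (LinearMap.ext₂ fun α β => ?_)
    obtain ⟨_, ⟨a, rfl⟩, rfl⟩ := h.coords.exists_dif_eq x α
    obtain ⟨_, ⟨b, rfl⟩, rfl⟩ := h.coords.exists_dif_eq x β
    exact congrFun (hΛ a b) x
  · ext1 x
    rw [← sub_eq_zero]
    refine (forall_dual_apply_eq_zero_iff ℝ _).1 fun c => ?_
    obtain ⟨_, ⟨a, rfl⟩, rfl⟩ := h.coords.exists_dif_eq x c
    rw [map_sub, sub_eq_zero]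
    exact congrFun (hE a) x

/-- A linear Poisson structure is determined by the restrictions to `N` of the brackets of the
functions `bar a`. -/
theorem poisson_ext [I'.Boundaryless] [FiniteDimensional ℝ EN']
    (h : IsHull I I' φ Δ one fn bar) {P P' : PoissonStructure I' N'}
    (hP : IsLinearFor bar P.Λ) (hP' : IsLinearFor bar P'.Λ)
    (hb : ∀ a b, P.bracket (bar a) (bar b) ∘ φ = P'.bracket (bar a) (bar b) ∘ φ) : P = P' := by
  refine PoissonStructure.ext (h.bivector_ext P.smoothΛ P'.smoothΛ fun a b => ?_)
  obtain ⟨c, hc⟩ := hP a b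
  obtain ⟨c', hc'⟩ := hP' a b
  have h1 := hb a b
  rw [PoissonStructure.bracket, PoissonStructure.bracket, hc, hc', h.bar_comp, h.bar_comp] at h1
  rw [hc, hc', h.ext_bar c c' h1]

/-- The correspondence between Jacobi structures on `N` and linear Poisson structures on `N'`,
provided that every Jacobi structure of the class considered has a smooth bivector field on `N'`
that induces it. -/
theorem exists_equiv [I.Boundaryless] [FiniteDimensional ℝ EN] [I'.Boundaryless]
    [FiniteDimensional ℝ EN'] (h : IsHull I I' φ Δ one fn bar)
    {p : JacobiStructure I N → Prop} {q : PoissonStructure I' N' → Prop}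
    (hp : ∀ J, p J ↔ ∀ a b, ∃ c, J.bracket (fn a) (fn b) = fn c)
    (hq : ∀ P, q P ↔ IsLinearFor bar P.Λ)
    (hex : ∀ J, p J → ∃ Λ : ∀ y : N', Bivector I' y, SmoothBivectorField I' Λ ∧
      ∀ a b, ∃ c, pairing Λ (bar a) (bar b) = bar c ∧ fn c = J.bracket (fn a) (fn b)) :
    ∃ Φ : {J // p J} ≃ {P // q P},
      (∀ J P, P = Φ J ↔ ∀ a b x,
        J.1.bracket (fn a) (fn b) x = P.1.bracket (bar a) (bar b) (φ x)) ∧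
      ∀ J (hJ : IsLinearFor bar (Φ J).1.Λ), IsRelated φ J.1 (h.hullJacobi (Φ J).1 hJ) := by
  have hto : ∀ J : {J // p J}, ∃ P : {P // q P}, ∀ a b,
      J.1.bracket (fn a) (fn b) = P.1.bracket (bar a) (bar b) ∘ φ := by
    intro J
    obtain ⟨Λ, hΛ, hb⟩ := hex J.1 J.2
    refine ⟨⟨h.toPoisson J.1 hΛ hb, (hq _).2 fun a b => ?_⟩, fun a b => ?_⟩
    · obtain ⟨c, hc, -⟩ := hb a b
      exact ⟨c, hc⟩
    · obtain ⟨c, hc, hc'⟩ := hb a b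
      rw [← hc', ← h.bar_comp]
      exact congrArg (· ∘ φ) hc.symm
  choose toP hto using hto
  have huniq : ∀ (J : {J // p J}) (P : {P // q P}),
      (∀ a b, J.1.bracket (fn a) (fn b) = P.1.bracket (bar a) (bar b) ∘ φ) → P = toP J :=
    fun J P hJP => Subtype.ext <| h.poisson_ext ((hq _).1 P.2) ((hq _).1 (toP J).2)
      fun a b => by rw [← hJP, hto]
  let inv : {P // q P} → {J // p J} := fun P => ⟨h.restrict P.1 ((hq _).1 P.2), (hp _).2 <| by
    intro a b
    obtain ⟨c, hc⟩ := (hq _).1 P.2 a b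
    refine ⟨c, ?_⟩
    rw [h.bracket_restrict, PoissonStructure.bracket, hc, h.bar_comp]⟩
  have hinv : ∀ J, inv (toP J) = J := fun J => Subtype.ext <| h.jacobi_ext fun a b =>
    (h.bracket_restrict _ _ a b).trans (hto J a b).symm
  refine ⟨⟨toP, inv, hinv, fun P => (huniq _ _ fun a b => ?_).symm⟩, fun J P => ?_, fun J hJ => ?_⟩
  · exact h.bracket_restrict _ _ a b
  · constructor
    · rintro rfl a b x
      exact congrFun (hto J a b) x
    · exact fun hJP => huniq J P fun a b => funext fun x => hJP a b x
  · have h1 := h.isRelated_restrict (toP J).1 hJ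
    have h2 : h.restrict (toP J).1 hJ = J.1 := congrArg Subtype.val (hinv J)
    rwa [h2] at h1

end IsHull

end Hulls

/-! ### Elements of the hull -/

section HullEval

variable {M : Type*} {F : Type*} {V : M → Type*} [∀ x, AddCommGroup (V x)] [∀ x, Module ℝ (V x)]
  {A : M → Type*} [∀ x, AddTorsor (V x) (A x)]

theorem Hull.eval_smul {x : M} (s : ℝ) (ψ : Hull F A x) (a : A x →ᵃ[ℝ] ℝ) :
    (s • ψ).eval a = s * ψ.eval a := rfl

theorem Hull.eval_add_right {x : M} (ψ : Hull F A x) (a b : A x →ᵃ[ℝ] ℝ) :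
    ψ.eval (a + b) = ψ.eval a + ψ.eval b := LinearMap.map_add _ _ _

theorem Hull.eval_smul_right {x : M} (ψ : Hull F A x) (c : ℝ) (a : A x →ᵃ[ℝ] ℝ) :
    ψ.eval (c • a) = c * ψ.eval a := LinearMap.map_smul _ _ _

end HullEval

/-! ### Smooth functions and maps on affine bundles and their hulls -/

theorem triv_eventually_mem {M F : Type*} [TopologicalSpace M] [TopologicalSpace F] {A : M → Type*}
    [TopologicalSpace (TotalSpace F A)] [∀ x, TopologicalSpace (A x)] [FiberBundle F A]
    (x : M) : ∀ᶠ y in 𝓝 x, y ∈ (trivializationAt F A x).baseSet :=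
  (trivializationAt F A x).open_baseSet.mem_nhds (mem_baseSet_trivializationAt F A x)

section BundleCalculus

variable {EM : Type*} [NormedAddCommGroup EM] [NormedSpace ℝ EM]
  {M : Type*} [TopologicalSpace M] [ChartedSpace EM M]
  {F : Type*} [NormedAddCommGroup F] [NormedSpace ℝ F]
  {V : M → Type*} [∀ x, AddCommGroup (V x)] [∀ x, Module ℝ (V x)]
  {A : M → Type*} [∀ x, AddTorsor (V x) (A x)]
  [TopologicalSpace (TotalSpace F A)] [∀ x, TopologicalSpace (A x)]
  [FiberBundle F A]

section Trivializations

variable [IsAffineBundle F A]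

theorem triv_symm_eq (e : Trivialization F (π F A)) [MemTrivializationAtlas e] {x : M}
    (hx : x ∈ e.baseSet) (v : F) :
    e.toOpenPartialHomeomorph.symm (x, v) = ⟨x, (fibreAff F A e x).symm v⟩ := by
  have hs : (⟨x, (fibreAff F A e x).symm v⟩ : TotalSpace F A) ∈ e.source := by
    rw [e.mem_source]; exact hx
  have h3 : e ⟨x, (fibreAff F A e x).symm v⟩ = (x, v) := by
    refine Prod.ext (e.coe_fst' hx) ?_
    rw [← fibreAff_apply F A e hx]
    simp
  rw [← h3]
  exact e.toOpenPartialHomeomorph.left_inv hs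

variable [FiniteDimensional ℝ F]

theorem hull_triv_apply (x : M) (ψ : TotalSpace (ℝ × F) (Hull F A)) :
    trivializationAt (ℝ × F) (Hull F A) x ψ =
      (ψ.1, hullFibre F A (trivializationAt F A x) ψ.1 ψ.2) := rfl

/-- The value of an element of the hull, in the coordinates of a trivialization. -/
theorem Hull.eval_eq (e : Trivialization F (π F A)) [MemTrivializationAtlas e] {x : M}
    (ψ : Hull F A x) (a : A x →ᵃ[ℝ] ℝ) :
    ψ.eval a = a ((fibreAff F A e x).symm (hullFibre F A e x ψ).2) +
      ((hullFibre F A e x ψ).1 - 1) * a ((fibreAff F A e x).symm 0) := by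
  have h1 : ψ.eval a = Hull.eval ((hullFibre F A e x).symm (hullFibre F A e x ψ)) a := by
    rw [LinearEquiv.symm_apply_apply]
  have h2 : Hull.eval ((hullFibre F A e x).symm (hullFibre F A e x ψ)) a =
      (hullFibre F A e x ψ).1 * a ((fibreAff F A e x).symm 0) +
        (a.comp (fibreAff F A e x).symm.toAffineMap).linear (hullFibre F A e x ψ).2 := rfl
  -- For an affine map `b`, the linear part at `w` is `b w - b 0`, so `t b(0) + b.linear w = b(w) +
  -- (t - 1) b(0)`.
  have h3 := congrFun (AffineMap.decomp (a.comp (fibreAff F A e x).symm.toAffineMap))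
    (hullFibre F A e x ψ).2
  simp only [Pi.add_apply, AffineMap.coe_comp, Function.comp_apply,
    AffineEquiv.coe_toAffineMap] at h3
  rw [h1, h2, h3]
  ring

theorem hullFibre_fst (e : Trivialization F (π F A)) [MemTrivializationAtlas e] {x : M}
    (ψ : Hull F A x) : (hullFibre F A e x ψ).1 = ψ.eval (AffineMap.const ℝ (A x) 1) := rfl

theorem hullFibre_inclHull (e : Trivialization F (π F A)) [MemTrivializationAtlas e]
    (p : TotalSpace F A) :
    hullFibre F A e p.1 (inclHull F A p).2 = (1, fibreAff F A e p.1 p.2) := by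
  refine Prod.ext rfl ?_
  change (evalEquiv ℝ F).symm _ = _
  rw [LinearEquiv.symm_apply_eq]
  rfl

end Trivializations

section Smoothness

variable [IsSmoothAffineBundle F A 𝓘(ℝ, EM)]
  {EX : Type*} [NormedAddCommGroup EX] [NormedSpace ℝ EX]
  {HX : Type*} [TopologicalSpace HX] {IX : ModelWithCorners ℝ EX HX}
  {X : Type*} [TopologicalSpace X] [ChartedSpace HX X]

theorem contMDiffOn_fibreAff_change (x x' : M) :
    ContMDiffOn (𝓘(ℝ, EM).prod 𝓘(ℝ, F)) 𝓘(ℝ, F) ∞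
      (fun q : M × F => fibreAff F A (trivializationAt F A x') q.1
        ((fibreAff F A (trivializationAt F A x) q.1).symm q.2))
      (((trivializationAt F A x).baseSet ∩ (trivializationAt F A x').baseSet) ×ˢ univ) := by
  refine (‹IsSmoothAffineBundle F A 𝓘(ℝ, EM)›.smooth (trivializationAt F A x)
    (trivializationAt F A x')).congr fun q hq => ?_
  rw [show q = (q.1, q.2) from rfl, triv_symm_eq _ hq.1.1, fibreAff_apply F A _ hq.1.2]

theorem contMDiffAt_fibreAff_change {b : X → M} {v : X → F} {y : X} {x x' : M}
    (hb : ContMDiffAt IX 𝓘(ℝ, EM) ∞ b y) (hv : ContMDiffAt IX 𝓘(ℝ, F) ∞ v y)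
    (hx : b y ∈ (trivializationAt F A x).baseSet) (hx' : b y ∈ (trivializationAt F A x').baseSet) :
    ContMDiffAt IX 𝓘(ℝ, F) ∞ (fun z => fibreAff F A (trivializationAt F A x') (b z)
        ((fibreAff F A (trivializationAt F A x) (b z)).symm (v z))) y := by
  have hn : ((trivializationAt F A x).baseSet ∩ (trivializationAt F A x').baseSet) ×ˢ
      (univ : Set F) ∈ 𝓝 (b y, v y) :=
    (((trivializationAt F A x).open_baseSet.inter
      (trivializationAt F A x').open_baseSet).prod isOpen_univ).mem_nhds ⟨⟨hx, hx'⟩, mem_univ _⟩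
  exact ((contMDiffOn_fibreAff_change x x').contMDiffAt hn).comp y (hb.prodMk hv)

/-- The fibre coordinates of a trivialization are smooth. -/
theorem contMDiffAt_fibreAff {x : M} {p : TotalSpace F A}
    (hp : p.1 ∈ (trivializationAt F A x).baseSet) :
    ContMDiffAt (𝓘(ℝ, EM).prod 𝓘(ℝ, F)) 𝓘(ℝ, F) ∞
      (fun q : TotalSpace F A => fibreAff F A (trivializationAt F A x) q.1 q.2) p := by
  have hid : ContMDiffAt (𝓘(ℝ, EM).prod 𝓘(ℝ, F)) (𝓘(ℝ, EM).prod 𝓘(ℝ, F)) ∞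
      (id : TotalSpace F A → TotalSpace F A) p := contMDiffAt_id
  -- Smoothness of the identity unfolds to smoothness of the preferred coordinates at `p.1`; a
  -- change of trivialization then gives those at `x`.
  rw [contMDiffAt_totalSpace] at hid
  refine (contMDiffAt_fibreAff_change hid.1 hid.2 (x := p.1)
    (mem_baseSet_trivializationAt F A p.1) hp).congr_of_eventuallyEq ?_
  filter_upwards [(FiberBundle.continuous_proj F A).continuousAt.eventually
    (triv_eventually_mem (F := F) (A := A) p.1)] with q hq
  change _ = fibreAff F A _ q.1 ((fibreAff F A _ q.1).symm (trivializationAt F A p.1 ⟨q.1, q.2⟩).2)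
  rw [← fibreAff_apply F A _ hq, AffineEquiv.symm_apply_apply]

theorem contMDiffAt_fibreAff_symm {b : X → M} {v : X → F} {y : X} {x : M}
    (hb : ContMDiffAt IX 𝓘(ℝ, EM) ∞ b y) (hv : ContMDiffAt IX 𝓘(ℝ, F) ∞ v y)
    (hx : b y ∈ (trivializationAt F A x).baseSet) :
    ContMDiffAt IX (𝓘(ℝ, EM).prod 𝓘(ℝ, F)) ∞
      (fun z => (⟨b z, (fibreAff F A (trivializationAt F A x) (b z)).symm (v z)⟩ :
        TotalSpace F A)) y := by
  rw [contMDiffAt_totalSpace]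
  refine ⟨hb, (contMDiffAt_fibreAff_change hb hv hx
    (mem_baseSet_trivializationAt F A (b y))).congr_of_eventuallyEq ?_⟩
  filter_upwards [hb.continuousAt.eventually
    (triv_eventually_mem (F := F) (A := A) (b y))] with z hz
  rw [fibreAff_apply F A _ hz]

variable [FiniteDimensional ℝ F]

theorem contMDiffAt_hullFibre_change {b : X → M} {w : X → ℝ × F} {y : X} {x x' : M}
    (hb : ContMDiffAt IX 𝓘(ℝ, EM) ∞ b y) (hw : ContMDiffAt IX 𝓘(ℝ, ℝ × F) ∞ w y)
    (hx : b y ∈ (trivializationAt F A x).baseSet) (hx' : b y ∈ (trivializationAt F A x').baseSet) :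
    ContMDiffAt IX 𝓘(ℝ, ℝ × F) ∞ (fun z => hullFibre F A (trivializationAt F A x') (b z)
        ((hullFibre F A (trivializationAt F A x) (b z)).symm (w z))) y := by
  have h1 : ContMDiffAt IX 𝓘(ℝ, ℝ) ∞ (fun z => (w z).1) y :=
    (ContinuousLinearMap.fst ℝ ℝ F).contMDiff.contMDiffAt.comp y hw
  have h2 : ContMDiffAt IX 𝓘(ℝ, F) ∞ (fun z => (w z).2) y :=
    (ContinuousLinearMap.snd ℝ ℝ F).contMDiff.contMDiffAt.comp y hw
  have h3 := contMDiffAt_fibreAff_change (A := A) hb h2 hx hx'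
  have h4 := contMDiffAt_fibreAff_change (A := A) hb (contMDiffAt_const (c := (0 : F))) hx hx'
  exact (h1.prodMk_space ((h1.smul h4).add (h3.sub h4))).congr_of_eventuallyEq
    (Filter.Eventually.of_forall fun z => hullCoord_comp_symm F _ _ (w z))

/-- The fibre coordinates of a trivialization are smooth on the hull. -/
theorem contMDiffAt_hullFibre {x : M} {ψ : TotalSpace (ℝ × F) (Hull F A)}
    (hψ : ψ.1 ∈ (trivializationAt F A x).baseSet) :
    ContMDiffAt (𝓘(ℝ, EM).prod 𝓘(ℝ, ℝ × F)) 𝓘(ℝ, ℝ × F) ∞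
      (fun η : TotalSpace (ℝ × F) (Hull F A) =>
        hullFibre F A (trivializationAt F A x) η.1 η.2) ψ := by
  have hid : ContMDiffAt (𝓘(ℝ, EM).prod 𝓘(ℝ, ℝ × F)) (𝓘(ℝ, EM).prod 𝓘(ℝ, ℝ × F)) ∞
      (id : TotalSpace (ℝ × F) (Hull F A) → TotalSpace (ℝ × F) (Hull F A)) ψ := contMDiffAt_id
  rw [contMDiffAt_totalSpace] at hid
  refine (contMDiffAt_hullFibre_change hid.1 hid.2 (x := ψ.1)
    (mem_baseSet_trivializationAt F A ψ.1) hψ).congr_of_eventuallyEq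
    (Filter.Eventually.of_forall fun η => ?_)
  exact (congrArg (hullFibre F A _ η.1) (LinearEquiv.symm_apply_apply _ _)).symm

theorem contMDiffAt_hull_mk {ψ : X → TotalSpace (ℝ × F) (Hull F A)} {y : X}
    (hb : ContMDiffAt IX 𝓘(ℝ, EM) ∞ (fun z => (ψ z).1) y)
    (hψ : ContMDiffAt IX 𝓘(ℝ, ℝ × F) ∞
      (fun z => hullFibre F A (trivializationAt F A (ψ y).1) (ψ z).1 (ψ z).2) y) :
    ContMDiffAt IX (𝓘(ℝ, EM).prod 𝓘(ℝ, ℝ × F)) ∞ ψ y := by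
  rw [contMDiffAt_totalSpace]
  exact ⟨hb, hψ⟩

theorem contMDiff_inclHull : ContMDiff (𝓘(ℝ, EM).prod 𝓘(ℝ, F)) (𝓘(ℝ, EM).prod 𝓘(ℝ, ℝ × F)) ∞
    (inclHull F A) := by
  intro p
  refine contMDiffAt_hull_mk (contMDiffAt_proj A) ?_
  have h := contMDiffAt_fibreAff (EM := EM) (mem_baseSet_trivializationAt F A p.1)
  exact ((contMDiffAt_const (c := (1 : ℝ))).prodMk_space h).congr_of_eventuallyEq
    (Filter.Eventually.of_forall fun q => hullFibre_inclHull _ q)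

/-- The map `ψ ↦ s • ψ` of the affine bundle into its hull. -/
theorem contMDiff_smul_inclHull (s : ℝ) :
    ContMDiff (𝓘(ℝ, EM).prod 𝓘(ℝ, F)) (𝓘(ℝ, EM).prod 𝓘(ℝ, ℝ × F)) ∞
      (fun p : TotalSpace F A =>
        (⟨p.1, s • (inclHull F A p).2⟩ : TotalSpace (ℝ × F) (Hull F A))) := by
  intro p
  refine contMDiffAt_hull_mk (contMDiffAt_proj A) ?_
  have h := contMDiffAt_fibreAff (EM := EM) (mem_baseSet_trivializationAt F A p.1)
  have hs : ContMDiffAt (𝓘(ℝ, EM).prod 𝓘(ℝ, F)) 𝓘(ℝ, ℝ) ∞ (fun _ : TotalSpace F A => s) p :=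
    contMDiffAt_const
  refine hs.smul ((contMDiffAt_const (c := (1 : ℝ))).prodMk_space h)
    |>.congr_of_eventuallyEq (Filter.Eventually.of_forall fun q => ?_)
  exact (map_smul _ _ _).trans (congrArg (s • ·) (hullFibre_inclHull _ q))

/-- Lines in the fibres of the hull are smooth. -/
theorem contMDiff_hull_line {x : M} (ψ η : Hull F A x) {r : ℝ → ℝ} {s : ℝ → ℝ}
    (hr : ContDiff ℝ ∞ r) (hs : ContDiff ℝ ∞ s) :
    ContMDiff 𝓘(ℝ, ℝ) (𝓘(ℝ, EM).prod 𝓘(ℝ, ℝ × F)) ∞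
      (fun t : ℝ => (⟨x, r t • ψ + s t • η⟩ : TotalSpace (ℝ × F) (Hull F A))) := by
  intro t
  refine contMDiffAt_hull_mk contMDiffAt_const ?_
  simp only [map_add, map_smul]
  exact ((hr.smul contDiff_const).add (hs.smul contDiff_const)).contMDiff.contMDiffAt

theorem AffineFunction.bar_eq (a : AffineFunction 𝓘(ℝ, EM) F A) (x : M)
    (ψ : TotalSpace (ℝ × F) (Hull F A)) : a.bar ψ =
      a.fn ⟨ψ.1, (fibreAff F A (trivializationAt F A x) ψ.1).symm
        (hullFibre F A (trivializationAt F A x) ψ.1 ψ.2).2⟩ +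
      ((hullFibre F A (trivializationAt F A x) ψ.1 ψ.2).1 - 1) *
        a.fn ⟨ψ.1, (fibreAff F A (trivializationAt F A x) ψ.1).symm 0⟩ :=
  Hull.eval_eq _ _ _

theorem AffineFunction.smooth_bar (a : AffineFunction 𝓘(ℝ, EM) F A) :
    SmoothFun (𝓘(ℝ, EM).prod 𝓘(ℝ, ℝ × F)) a.bar := by
  intro ψ
  have hx := mem_baseSet_trivializationAt F A ψ.1
  have hw := contMDiffAt_hullFibre (EM := EM) (ψ := ψ) hx
  have h1 : ContMDiffAt (𝓘(ℝ, EM).prod 𝓘(ℝ, ℝ × F)) 𝓘(ℝ, ℝ) ∞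
      (fun η : TotalSpace (ℝ × F) (Hull F A) =>
        (hullFibre F A (trivializationAt F A ψ.1) η.1 η.2).1) ψ :=
    (ContinuousLinearMap.fst ℝ ℝ F).contMDiff.contMDiffAt.comp ψ hw
  have h2 : ContMDiffAt (𝓘(ℝ, EM).prod 𝓘(ℝ, ℝ × F)) 𝓘(ℝ, F) ∞
      (fun η : TotalSpace (ℝ × F) (Hull F A) =>
        (hullFibre F A (trivializationAt F A ψ.1) η.1 η.2).2) ψ :=
    (ContinuousLinearMap.snd ℝ ℝ F).contMDiff.contMDiffAt.comp ψ hw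
  have h3 := (a.smooth _).comp ψ
    (contMDiffAt_fibreAff_symm (A := A) (contMDiffAt_proj (Hull F A)) h2 hx)
  have h4 := (a.smooth _).comp ψ
    (contMDiffAt_fibreAff_symm (A := A) (contMDiffAt_proj (Hull F A))
      (contMDiffAt_const (c := (0 : F))) hx)
  exact (h3.add ((h1.sub (contMDiffAt_const (c := (1 : ℝ)))).mul h4)).congr_of_eventuallyEq
    (Filter.Eventually.of_forall fun η => a.bar_eq ψ.1 η)

end Smoothness

end BundleCalculus

/-! ### Affine functions and coordinates on affine bundles and their hulls -/

section AffineFunctions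

variable {EM : Type*} [NormedAddCommGroup EM] [NormedSpace ℝ EM]
  {M : Type*} [TopologicalSpace M] [ChartedSpace EM M]
  {F : Type*} [NormedAddCommGroup F] [NormedSpace ℝ F]
  {V : M → Type*} [∀ x, AddCommGroup (V x)] [∀ x, Module ℝ (V x)]
  {A : M → Type*} [∀ x, AddTorsor (V x) (A x)]
  [TopologicalSpace (TotalSpace F A)] [∀ x, TopologicalSpace (A x)]
  [FiberBundle F A]

/-- The sum of affine functions. -/
def AffineFunction.add (a b : AffineFunction 𝓘(ℝ, EM) F A) : AffineFunction 𝓘(ℝ, EM) F A where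
  onFibre x := a.onFibre x + b.onFibre x
  smooth := SmoothFun.add a.smooth b.smooth

variable (EM F A) in
/-- The constant affine function `1`. -/
def AffineFunction.one : AffineFunction 𝓘(ℝ, EM) F A where
  onFibre x := AffineMap.const ℝ (A x) 1
  smooth := smoothFun_const 1

theorem smooth_comp_proj {f : M → ℝ} (hf : SmoothFun 𝓘(ℝ, EM) f) :
    SmoothFun (𝓘(ℝ, EM).prod 𝓘(ℝ, F)) (f ∘ π F A) :=
  ContMDiff.comp hf (contMDiff_proj A)

/-- The product of a function on the base and an affine function. -/
def AffineFunction.mulBase {f : M → ℝ} (hf : SmoothFun 𝓘(ℝ, EM) f)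
    (a : AffineFunction 𝓘(ℝ, EM) F A) : AffineFunction 𝓘(ℝ, EM) F A where
  onFibre x := f x • a.onFibre x
  smooth := (smooth_comp_proj hf).mul a.smooth

theorem AffineFunction.fn_add (a b : AffineFunction 𝓘(ℝ, EM) F A) :
    (a.add b).fn = a.fn + b.fn := rfl

theorem AffineFunction.fn_one : (AffineFunction.one EM F A).fn = 1 := rfl

theorem AffineFunction.fn_mulBase {f : M → ℝ} (hf : SmoothFun 𝓘(ℝ, EM) f)
    (a : AffineFunction 𝓘(ℝ, EM) F A) : (a.mulBase hf).fn = (f ∘ π F A) * a.fn := rfl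

theorem AffineFunction.bar_add (a b : AffineFunction 𝓘(ℝ, EM) F A) :
    (a.add b).bar = a.bar + b.bar := funext fun _ => Hull.eval_add_right _ _ _

theorem AffineFunction.bar_mulBase {f : M → ℝ} (hf : SmoothFun 𝓘(ℝ, EM) f)
    (a : AffineFunction 𝓘(ℝ, EM) F A) :
    (a.mulBase hf).bar = (f ∘ π (ℝ × F) (Hull F A)) * a.bar :=
  funext fun _ => Hull.eval_smul_right _ _ _

theorem AffineFunction.bar_one : (AffineFunction.one EM F A).bar = iotaOne F A := rfl

theorem AffineFunction.bar_injective {a b : AffineFunction 𝓘(ℝ, EM) F A} (h : a.fn = b.fn) :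
    a.bar = b.bar := by
  ext ψ
  have h1 : a.onFibre ψ.1 = b.onFibre ψ.1 := by
    ext p
    exact congrFun h ⟨ψ.1, p⟩
  exact congrArg ψ.2.eval h1

theorem extChartAt_totalSpace_eventuallyEq {F : Type*} [NormedAddCommGroup F] [NormedSpace ℝ F]
    {A : M → Type*} [TopologicalSpace (TotalSpace F A)] [∀ x, TopologicalSpace (A x)]
    [FiberBundle F A] {p : TotalSpace F A} {x : M} (hx : p.1 = x) :
    ∀ᶠ q in 𝓝 p, extChartAt (𝓘(ℝ, EM).prod 𝓘(ℝ, F)) p q =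
      (extChartAt 𝓘(ℝ, EM) x q.1, (trivializationAt F A x q).2) := by
  subst hx
  filter_upwards [(FiberBundle.continuous_proj F A).continuousAt.eventually
    (triv_eventually_mem (F := F) (A := A) p.1)] with q hq
  rw [FiberBundle.extChartAt]
  refine Prod.ext ?_ rfl
  exact congrArg (extChartAt 𝓘(ℝ, EM) p.1) ((trivializationAt F A p.1).coe_fst' hq)

/-! ### Extension of local coordinates by bump functions on the base -/

section Bump

variable [FiniteDimensional ℝ EM] [IsManifold 𝓘(ℝ, EM) ∞ M] [T2Space M]

theorem exists_bump {x : M} {U : Set M} (hU : U ∈ 𝓝 x) :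
    ∃ χ : M → ℝ, SmoothFun 𝓘(ℝ, EM) χ ∧ χ =ᶠ[𝓝 x] 1 ∧ tsupport χ ⊆ U := by
  obtain ⟨f, -, hf⟩ := (SmoothBumpFunction.nhds_basis_tsupport (I := 𝓘(ℝ, EM)) x).mem_iff.1 hU
  exact ⟨f, f.contMDiff, f.eventuallyEq_one, hf⟩

theorem exists_bundle_bump (F : Type*) [NormedAddCommGroup F] (A : M → Type*)
    [TopologicalSpace (TotalSpace F A)] [∀ x, TopologicalSpace (A x)] [FiberBundle F A] (x : M) :
    ∃ χ : M → ℝ, SmoothFun 𝓘(ℝ, EM) χ ∧ χ =ᶠ[𝓝 x] 1 ∧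
      tsupport χ ⊆ (trivializationAt F A x).baseSet ∩ (chartAt EM x).source :=
  exists_bump (Filter.inter_mem (triv_eventually_mem x) (chart_source_mem_nhds EM x))

theorem exists_base_coord (x : M) (c : Dual ℝ EM) : ∃ f : M → ℝ, SmoothFun 𝓘(ℝ, EM) f ∧
    f =ᶠ[𝓝 x] fun y => c (extChartAt 𝓘(ℝ, EM) x y) := by
  obtain ⟨χ, hχ, hχ1, hχs⟩ := exists_bump (EM := EM) (chart_source_mem_nhds EM x)
  refine ⟨fun y => χ y * c (extChartAt 𝓘(ℝ, EM) x y), ?_, ?_⟩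
  · refine contMDiff_of_tsupport fun y hy => ?_
    have hy' : y ∈ (chartAt EM x).source := hχs (tsupport_mul_subset_left hy)
    exact (hχ y).mul ((LinearMap.toContinuousLinearMap c).contMDiff.contMDiffAt.comp y
      (contMDiffAt_extChartAt' hy'))
  · filter_upwards [hχ1] with y hy
    simp [hy]

theorem containsCoordinates_smooth :
    ContainsCoordinates 𝓘(ℝ, EM) {f : M → ℝ | SmoothFun 𝓘(ℝ, EM) f} :=
  ⟨fun _ hf => hf, exists_base_coord⟩

/-- Affine functions on `F` are the restrictions to `1 × F` of linear forms on `ℝ × F`. A cutoff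
that depends only on the base point preserves affinity on the fibres. -/
theorem exists_local_affineFunction [FiniteDimensional ℝ F] [IsSmoothAffineBundle F A 𝓘(ℝ, EM)]
    (x : M) (c : Dual ℝ (ℝ × F)) : ∃ a : AffineFunction 𝓘(ℝ, EM) F A,
      ∀ᶠ y in 𝓝 x, ∀ p : A y,
        a.onFibre y p = c (1, fibreAff F A (trivializationAt F A x) y p) := by
  obtain ⟨χ, hχ, hχ1, hχs⟩ := exists_bundle_bump (EM := EM) F A x
  let r : ∀ y, A y →ᵃ[ℝ] ℝ := fun y =>
    (c ∘ₗ LinearMap.inr ℝ ℝ F).toAffineMap.comp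
      (fibreAff F A (trivializationAt F A x) y).toAffineMap + AffineMap.const ℝ (A y) (c (1, 0))
  have hr : ∀ y p, r y p = c (1, fibreAff F A (trivializationAt F A x) y p) := by
    intro y p
    change c (0, _) + c (1, 0) = _
    rw [← map_add]
    simp
  refine ⟨⟨fun y => χ y • r y, ?_⟩, ?_⟩
  · intro p
    change ContMDiffAt _ _ _ (fun p : TotalSpace F A => χ p.1 * r p.1 p.2) p
    by_cases hp : p.1 ∈ tsupport χ
    · refine (ContMDiffAt.comp p (hχ p.1) (contMDiffAt_proj A)).mul ?_
      simp only [hr]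
      exact (LinearMap.toContinuousLinearMap c).contMDiff.contMDiffAt.comp p
        ((contMDiffAt_const (c := (1 : ℝ))).prodMk_space (contMDiffAt_fibreAff (hχs hp).1))
    · refine (contMDiffAt_const (c := (0 : ℝ))).congr_of_eventuallyEq ?_
      filter_upwards [(FiberBundle.continuous_proj F A).continuousAt.eventually
        (notMem_tsupport_iff_eventuallyEq.1 hp)] with q hq
      rw [hq]
      simp
  · filter_upwards [hχ1] with y hy p
    change χ y * r y p = _
    rw [hy, hr]
    simp

end Bump

variable [FiniteDimensional ℝ EM] [IsManifold 𝓘(ℝ, EM) ∞ M] [T2Space M]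

/-- A function on the base that represents a covector at a point, in the preferred chart. -/
def baseCoord (x : M) (c : Dual ℝ EM) : M → ℝ := (exists_base_coord x c).choose

theorem smooth_baseCoord (x : M) (c : Dual ℝ EM) : SmoothFun 𝓘(ℝ, EM) (baseCoord x c) :=
  (exists_base_coord x c).choose_spec.1

theorem baseCoord_eventuallyEq (x : M) (c : Dual ℝ EM) :
    baseCoord x c =ᶠ[𝓝 x] fun y => c (extChartAt 𝓘(ℝ, EM) x y) :=
  (exists_base_coord x c).choose_spec.2

variable [FiniteDimensional ℝ F] [IsSmoothAffineBundle F A 𝓘(ℝ, EM)]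

/-- An affine function that represents an element of the dual of `ℝ × F` near a point of the base,
in the preferred trivialization. -/
def fibreCoord (x : M) (c : Dual ℝ (ℝ × F)) : AffineFunction 𝓘(ℝ, EM) F A :=
  (exists_local_affineFunction x c).choose

theorem fibreCoord_eventually (x : M) (c : Dual ℝ (ℝ × F)) :
    ∀ᶠ y in 𝓝 x, ∀ p : A y, (fibreCoord (A := A) (EM := EM) x c).onFibre y p =
      c (1, fibreAff F A (trivializationAt F A x) y p) :=
  (exists_local_affineFunction x c).choose_spec

theorem bar_fibreCoord_eventually (x : M) (c : Dual ℝ (ℝ × F)) :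
    ∀ᶠ y in 𝓝 x, ∀ ψ : Hull F A y, ψ.eval ((fibreCoord (A := A) (EM := EM) x c).onFibre y) =
      c (hullFibre F A (trivializationAt F A x) y ψ) := by
  filter_upwards [fibreCoord_eventually (EM := EM) (A := A) x c] with y hy ψ
  rw [Hull.eval_eq (trivializationAt F A x), hy, hy, AffineEquiv.apply_symm_apply,
    AffineEquiv.apply_symm_apply, ← smul_eq_mul, ← map_smul, ← map_add]
  congr 1
  ext <;> simp

/-- Base coordinates are constant on the fibres and fibre coordinates are affine on them, so every
chart coordinate is locally an affine function. -/
theorem containsCoordinates_affine : ContainsCoordinates (𝓘(ℝ, EM).prod 𝓘(ℝ, F))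
    (range (AffineFunction.fn (I := 𝓘(ℝ, EM)) (F := F) (E := A))) := by
  refine ⟨?_, fun p c => ?_⟩
  · rintro _ ⟨a, rfl⟩
    exact a.smooth
  · let c₁ : Dual ℝ EM := c ∘ₗ LinearMap.inl ℝ EM F
    let c₂ : Dual ℝ (ℝ × F) := c ∘ₗ LinearMap.inr ℝ EM F ∘ₗ LinearMap.snd ℝ ℝ F
    refine ⟨_, ⟨((AffineFunction.one EM F A).mulBase (smooth_baseCoord p.1 c₁)).add
      (fibreCoord p.1 c₂), rfl⟩, ?_⟩
    have hπ := (FiberBundle.continuous_proj F A).continuousAt (x := p)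
    filter_upwards [extChartAt_totalSpace_eventuallyEq (EM := EM) (p := p) rfl,
      hπ.eventually (fibreCoord_eventually (EM := EM) (A := A) p.1 c₂),
      hπ.eventually (baseCoord_eventuallyEq (EM := EM) p.1 c₁),
      hπ.eventually (triv_eventually_mem (F := F) (A := A) p.1)] with q h1 h2 h3 h4
    rw [h1, AffineFunction.fn_add, AffineFunction.fn_mulBase, AffineFunction.fn_one]
    simp only [Pi.add_apply, Function.comp_apply, mul_one, h3]
    rw [AffineFunction.fn, h2, fibreAff_apply F A _ h4]
    change c (_, 0) + c (0, _) = _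
    rw [← map_add]
    simp

/-- A function on the hull that represents a covector at a point, in the preferred chart. -/
def hullCoordFun (x : M) (c : Dual ℝ (EM × (ℝ × F))) : TotalSpace (ℝ × F) (Hull F A) → ℝ :=
  (fibreCoord (EM := EM) (A := A) x (c ∘ₗ LinearMap.inr ℝ EM (ℝ × F))).bar +
    baseCoord x (c ∘ₗ LinearMap.inl ℝ EM (ℝ × F)) ∘ π (ℝ × F) (Hull F A)

theorem smooth_hullCoordFun (x : M) (c : Dual ℝ (EM × (ℝ × F))) :
    SmoothFun (𝓘(ℝ, EM).prod 𝓘(ℝ, ℝ × F)) (hullCoordFun (A := A) x c) :=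
  (AffineFunction.smooth_bar _).add (smooth_comp_proj (smooth_baseCoord _ _))

theorem hullCoordFun_eventuallyEq {x : M} (c : Dual ℝ (EM × (ℝ × F)))
    {ψ : TotalSpace (ℝ × F) (Hull F A)} (hψ : ψ.1 = x) : hullCoordFun (A := A) x c =ᶠ[𝓝 ψ]
      fun η => c (extChartAt (𝓘(ℝ, EM).prod 𝓘(ℝ, ℝ × F)) ψ η) := by
  have hπ := (FiberBundle.continuous_proj (ℝ × F) (Hull F A)).continuousAt (x := ψ)
  subst hψ
  filter_upwards [extChartAt_totalSpace_eventuallyEq (EM := EM) (p := ψ) rfl,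
    hπ.eventually (bar_fibreCoord_eventually (EM := EM) (A := A) ψ.1
      (c ∘ₗ LinearMap.inr ℝ EM (ℝ × F))),
    hπ.eventually (baseCoord_eventuallyEq (EM := EM) ψ.1 (c ∘ₗ LinearMap.inl ℝ EM (ℝ × F)))]
    with η h1 h2 h3
  rw [h1, hullCoordFun]
  simp only [Pi.add_apply, Function.comp_apply, h3]
  rw [AffineFunction.bar, h2, hull_triv_apply]
  change c (0, _) + c (_, 0) = _
  rw [← map_add]
  simp

/-- The same function works at all points of the fibre over `x`, because the preferred chart of the
total space varies only with the base point. Limits along a fibre rely on this. -/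
theorem dif_hullCoordFun {x : M} (c : Dual ℝ (EM × (ℝ × F)))
    {ψ : TotalSpace (ℝ × F) (Hull F A)} (hψ : ψ.1 = x) :
    dif (𝓘(ℝ, EM).prod 𝓘(ℝ, ℝ × F)) (hullCoordFun (A := A) x c) ψ = c :=
  dif_coord (smooth_hullCoordFun x c) (hullCoordFun_eventuallyEq c hψ)

/-- The sums of a linear function and a basic function on the hull. -/
theorem containsCoordinates_hull : ContainsCoordinates (𝓘(ℝ, EM).prod 𝓘(ℝ, ℝ × F))
    {G : TotalSpace (ℝ × F) (Hull F A) → ℝ | ∃ (a : AffineFunction 𝓘(ℝ, EM) F A) (f : M → ℝ),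
      SmoothFun 𝓘(ℝ, EM) f ∧ G = a.bar + f ∘ π (ℝ × F) (Hull F A)} := by
  refine ⟨?_, fun ψ c => ⟨hullCoordFun ψ.1 c, ⟨_, _, smooth_baseCoord _ _, rfl⟩,
    hullCoordFun_eventuallyEq c rfl⟩⟩
  rintro _ ⟨a, f, hf, rfl⟩
  exact a.smooth_bar.add (smooth_comp_proj hf)

theorem containsCoordinates_hull_smooth : ContainsCoordinates (𝓘(ℝ, EM).prod 𝓘(ℝ, ℝ × F))
    {G : TotalSpace (ℝ × F) (Hull F A) → ℝ | SmoothFun (𝓘(ℝ, EM).prod 𝓘(ℝ, ℝ × F)) G} :=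
  containsCoordinates_hull.mono (fun _ hG => containsCoordinates_hull.smooth _ hG) fun _ hG => hG

end AffineFunctions

/-! ### The vector hull as a hull -/

section VectorHull

/-- Euler's equation makes `h s / s` constant for `s > 0`. Its value is `h 1`, and its limit at `0`
is `h' 0`, as `h 0 = 0`. -/
theorem hasDerivAt_zero_of_euler {h : ℝ → ℝ} (hd : Differentiable ℝ h)
    (he : ∀ s, s * deriv h s = h s) : h 1 = deriv h 0 := by
  have h0 : h 0 = 0 := by rw [← he, zero_mul]
  have hk : ∀ s ∈ Ioi (0 : ℝ), HasDerivAt (fun s => h s / s) 0 s := by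
    intro s hs
    have hs' : s ≠ 0 := ne_of_gt hs
    have h1 := (hd s).hasDerivAt.div (hasDerivAt_id s) hs'
    refine h1.congr_deriv ?_
    simp only [id, mul_one]
    rw [mul_comm, he, sub_self, zero_div]
  have hconst : ∀ s ∈ Ioi (0 : ℝ), h s / s = h 1 := by
    intro s hs
    have := isOpen_Ioi.is_const_of_deriv_eq_zero isPreconnected_Ioi
      (fun t ht => (hk t ht).differentiableAt.differentiableWithinAt) (fun t ht => (hk t ht).deriv)
      hs (show (1 : ℝ) ∈ Ioi (0 : ℝ) by simp)
    simpa using this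
  have ht := (hasDerivAt_iff_tendsto_slope_zero.1 (hd 0).hasDerivAt).mono_left
    (nhdsGT_le_nhdsNE (0 : ℝ))
  refine tendsto_nhds_unique (tendsto_const_nhds.congr' ?_) ht
  filter_upwards [self_mem_nhdsWithin] with s hs
  rw [zero_add, h0, sub_zero, smul_eq_mul, ← hconst s hs, div_eq_inv_mul]

variable {EM : Type*} [NormedAddCommGroup EM] [NormedSpace ℝ EM]
  {M : Type*} [TopologicalSpace M] [ChartedSpace EM M]
  {F : Type*} [NormedAddCommGroup F] [NormedSpace ℝ F] [FiniteDimensional ℝ F]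
  {V : M → Type*} [∀ x, AddCommGroup (V x)] [∀ x, Module ℝ (V x)]
  {A : M → Type*} [∀ x, AddTorsor (V x) (A x)]
  [TopologicalSpace (TotalSpace F A)] [∀ x, TopologicalSpace (A x)]
  [FiberBundle F A] [IsSmoothAffineBundle F A 𝓘(ℝ, EM)]

theorem contMDiff_hull_scaling (ψ : TotalSpace (ℝ × F) (Hull F A)) :
    ContMDiff 𝓘(ℝ, ℝ) (𝓘(ℝ, EM).prod 𝓘(ℝ, ℝ × F)) ∞
      (fun s : ℝ => (⟨ψ.1, s • ψ.2⟩ : TotalSpace (ℝ × F) (Hull F A))) := by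
  have h := contMDiff_hull_line (EM := EM) ψ.2 0 (r := id) (s := fun _ => 0) contDiff_id
    contDiff_const
  simpa only [smul_zero, add_zero, id] using h

theorem lieFun_liouville {G : TotalSpace (ℝ × F) (Hull F A) → ℝ}
    (hG : SmoothFun (𝓘(ℝ, EM).prod 𝓘(ℝ, ℝ × F)) G) (ψ : TotalSpace (ℝ × F) (Hull F A)) :
    lieFun (liouville 𝓘(ℝ, EM) F A) G ψ = deriv (fun s : ℝ => G ⟨ψ.1, s • ψ.2⟩) 1 := by
  have h1 : (fun s : ℝ => (⟨ψ.1, s • ψ.2⟩ : TotalSpace (ℝ × F) (Hull F A))) 1 = ψ := by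
    simp only [one_smul]
  have h2 := mvfderiv_comp_apply_of_eq (1 : ℝ) (hG.mdifferentiableAt ψ)
    ((contMDiff_hull_scaling ψ 1).mdifferentiableAt (by simp)) h1 (1 : ℝ)
  refine h2.symm.trans ?_
  rw [mvfderiv, mfderiv_eq_fderiv]
  rfl

theorem lieFun_liouville_bar (a : AffineFunction 𝓘(ℝ, EM) F A) :
    lieFun (liouville 𝓘(ℝ, EM) F A) a.bar = a.bar := by
  ext ψ
  rw [lieFun_liouville a.smooth_bar]
  have h : (fun s : ℝ => a.bar ⟨ψ.1, s • ψ.2⟩) = fun s => s * a.bar ψ :=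
    funext fun s => Hull.eval_smul _ _ _
  rw [h, deriv_mul_const_field, deriv_id'', one_mul]

theorem lieFun_liouville_base {f : M → ℝ} (hf : SmoothFun 𝓘(ℝ, EM) f) :
    lieFun (liouville 𝓘(ℝ, EM) F A) (f ∘ π (ℝ × F) (Hull F A)) = 0 := by
  ext ψ
  rw [lieFun_liouville (smooth_comp_proj hf)]
  exact deriv_const (1 : ℝ) (f ψ.1)

theorem smooth_on_hull_fibre {G : TotalSpace (ℝ × F) (Hull F A) → ℝ}
    (hG : SmoothFun (𝓘(ℝ, EM).prod 𝓘(ℝ, ℝ × F)) G) (x : M) :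
    ContDiff ℝ ∞ fun w : ℝ × F =>
      G ⟨x, (hullFibre F A (trivializationAt F A x) x).symm w⟩ := by
  rw [← contMDiff_iff_contDiff]
  refine ContMDiff.comp hG fun w => contMDiffAt_hull_mk contMDiffAt_const ?_
  simp only [LinearEquiv.apply_symm_apply]
  exact contMDiffAt_id

/-- A smooth function on the hull that is homogeneous of degree one is linear on the fibres, and
so corresponds to an affine function. -/
theorem exists_bar_eq {G : TotalSpace (ℝ × F) (Hull F A) → ℝ}
    (hG : SmoothFun (𝓘(ℝ, EM).prod 𝓘(ℝ, ℝ × F)) G)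
    (hΔ : lieFun (liouville 𝓘(ℝ, EM) F A) G = G) :
    ∃ a : AffineFunction 𝓘(ℝ, EM) F A, G = a.bar := by
  -- On each fibre, `G` is its own derivative at the origin: Euler's equation is applied along the
  -- line through `ψ`. Smoothness at the zero section is essential.
  have hlin : ∀ x, ∃ L : Dual ℝ (ℝ × F), ∀ ψ : Hull F A x,
      G ⟨x, ψ⟩ = L (hullFibre F A (trivializationAt F A x) x ψ) := by
    intro x
    have hs := smooth_on_hull_fibre hG x
    set e := hullFibre F A (trivializationAt F A x) x
    refine ⟨(fderiv ℝ (fun w => G ⟨x, e.symm w⟩) 0).toLinearMap, fun ψ => ?_⟩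
    have hd : HasFDerivAt (fun w => G ⟨x, e.symm w⟩) (fderiv ℝ (fun w => G ⟨x, e.symm w⟩) 0) 0 :=
      ((hs.differentiable (by simp)) 0).hasFDerivAt
    have hh : (fun s : ℝ => G ⟨x, s • ψ⟩) = fun s : ℝ => G ⟨x, e.symm (s • e ψ)⟩ := by
      ext s
      rw [← map_smul, LinearEquiv.symm_apply_apply]
    have hdiff : Differentiable ℝ (fun s : ℝ => G ⟨x, s • ψ⟩) := by
      rw [hh]
      exact (hs.differentiable (by simp)).comp (differentiable_id.smul_const (e ψ))
    have heul : ∀ s : ℝ, s * deriv (fun s : ℝ => G ⟨x, s • ψ⟩) s = G ⟨x, s • ψ⟩ := by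
      intro s
      have h1 := congrFun hΔ ⟨x, s • ψ⟩
      rw [lieFun_liouville hG] at h1
      have h2 : (fun u : ℝ => G ⟨x, u • s • ψ⟩) = fun u => (fun s : ℝ => G ⟨x, s • ψ⟩) (u * s) := by
        ext u
        rw [smul_smul]
      rw [← h1]
      change _ = deriv (fun u : ℝ => G ⟨x, u • s • ψ⟩) 1
      rw [h2]
      have h3 : HasDerivAt (fun u : ℝ => u * s) s 1 := by
        simpa using (hasDerivAt_id (1 : ℝ)).mul_const s
      have h4 := (hdiff (1 * s)).hasDerivAt.comp (1 : ℝ) h3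
      rw [one_mul] at h4
      rw [mul_comm]
      exact h4.deriv.symm
    have h1 := hasDerivAt_zero_of_euler hdiff heul
    simp only [one_smul] at h1
    rw [h1, hh]
    have h2 : HasDerivAt (fun s : ℝ => s • e ψ) (e ψ) 0 := by
      simpa using (hasDerivAt_id (0 : ℝ)).smul_const (e ψ)
    have h3 : HasFDerivAt (fun w => G ⟨x, e.symm w⟩) (fderiv ℝ (fun w => G ⟨x, e.symm w⟩) 0)
        ((0 : ℝ) • e ψ) := by rwa [zero_smul]
    exact (h3.comp_hasDerivAt (0 : ℝ) h2).deriv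
  choose L hL using hlin
  let r : ∀ x, A x →ᵃ[ℝ] ℝ := fun x =>
    (L x ∘ₗ LinearMap.inr ℝ ℝ F).toAffineMap.comp
      (fibreAff F A (trivializationAt F A x) x).toAffineMap + AffineMap.const ℝ (A x) (L x (1, 0))
  have hr : ∀ x p, r x p = L x (1, fibreAff F A (trivializationAt F A x) x p) := by
    intro x p
    change L x (0, _) + L x (1, 0) = _
    rw [← map_add]
    simp
  refine ⟨⟨r, ?_⟩, ?_⟩
  -- The linear forms `L x` were chosen fibre by fibre; smoothness in `x` comes from recognizing the
  -- restriction of `G`.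
  · have : (fun p : TotalSpace F A => r p.1 p.2) = G ∘ inclHull F A := by
      ext p
      exact (hr _ _).trans ((congrArg (L p.1) (hullFibre_inclHull _ p)).symm.trans
        (hL p.1 (inclHull F A p).2).symm)
    rw [this]
    exact ContMDiff.comp hG contMDiff_inclHull
  · ext ψ
    rw [AffineFunction.bar, Hull.eval_eq (trivializationAt F A ψ.1), hr, hr,
      AffineEquiv.apply_symm_apply, AffineEquiv.apply_symm_apply, ← smul_eq_mul, ← map_smul,
      ← map_add]
    refine (hL ψ.1 ψ.2).trans (congrArg _ ?_)
    ext <;> simp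

/-- From a zero `ψ` of `iotaOne`, move along `ψ + s η` with `η` the image of a point of the fibre:
there `iotaOne` equals `s`. -/
theorem dense_iotaOne_ne_zero : Dense {ψ | iotaOne F A ψ ≠ 0} := by
  intro ψ
  by_cases hψ : iotaOne F A ψ = 0
  · obtain ⟨p⟩ : Nonempty (A ψ.1) := inferInstance
    let η : Hull F A ψ.1 := (inclHull F A ⟨ψ.1, p⟩).2
    have hc := (contMDiff_hull_line (EM := EM) ψ.2 η (r := fun _ => 1)
      (s := id) contDiff_const contDiff_id).continuous.tendsto 0
    simp only [id, one_smul, zero_smul, add_zero] at hc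
    refine mem_closure_of_tendsto (hc.mono_left (nhdsWithin_le_nhds (s := {0}ᶜ))) ?_
    filter_upwards [self_mem_nhdsWithin] with s hs
    have h1 : iotaOne F A ⟨ψ.1, ψ.2 + s • η⟩ = s := by
      have h2 : iotaOne F A ⟨ψ.1, ψ.2 + s • η⟩ =
          iotaOne F A ψ + s * 1 := rfl
      rw [h2, hψ, zero_add, mul_one]
    change _ ≠ _
    rw [h1]
    exact hs
  · exact subset_closure hψ

variable [FiniteDimensional ℝ EM] [IsManifold 𝓘(ℝ, EM) ∞ M] [T2Space M]

theorem isHull_vectorHull :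
    IsHull (𝓘(ℝ, EM).prod 𝓘(ℝ, F)) (𝓘(ℝ, EM).prod 𝓘(ℝ, ℝ × F)) (inclHull F A)
      (liouville 𝓘(ℝ, EM) F A) (AffineFunction.one EM F A) AffineFunction.fn
      AffineFunction.bar where
  smooth_incl := contMDiff_inclHull
  smooth_bar a := a.smooth_bar
  smooth_liouville := containsCoordinates_hull.smoothVectorField <| by
    rintro _ ⟨a, f, hf, rfl⟩
    rw [lieFun_add _ a.smooth_bar (smooth_comp_proj hf), lieFun_liouville_bar,
      lieFun_liouville_base hf, add_zero]
    exact a.smooth_bar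
  lie_bar := lieFun_liouville_bar
  bar_comp _ := rfl
  fn_one := rfl
  ext_bar _ _ := AffineFunction.bar_injective
  exists_add a b := ⟨a.add b, a.fn_add b, a.bar_add b⟩
  coords := containsCoordinates_affine
  coords' := containsCoordinates_hull_smooth
  dense := dense_iotaOne_ne_zero (EM := EM)
  span ψ hψ c := by
    have hψ' : iotaOne F A ψ ≠ 0 := hψ
    obtain ⟨_, ⟨a, f, hf, rfl⟩, hc⟩ := containsCoordinates_hull.exists_dif_eq ψ c
    -- The basic part is replaced by a linear function with the same differential at `ψ`: the
    -- coefficient of `iotaOne` vanishes at `ψ.1`, so only its derivative counts, and `iotaOne F A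
    -- ψ` cancels.
    have hf' : SmoothFun 𝓘(ℝ, EM) (fun y => (iotaOne F A ψ)⁻¹ * (f y - f ψ.1)) :=
      (hf.sub (smoothFun_const (f ψ.1))).const_smul (iotaOne F A ψ)⁻¹
    refine ⟨a.add ((AffineFunction.one EM F A).mulBase hf'), ?_⟩
    have hfs := smooth_comp_proj (F := ℝ × F) (A := Hull F A) hf
    have h1 := (AffineFunction.one EM F A).smooth_bar.mdifferentiableAt ψ
    have h2 : dif (𝓘(ℝ, EM).prod 𝓘(ℝ, ℝ × F))
        ((fun y => (iotaOne F A ψ)⁻¹ * (f y - f ψ.1)) ∘ π (ℝ × F) (Hull F A)) ψ =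
        (iotaOne F A ψ)⁻¹ • dif (𝓘(ℝ, EM).prod 𝓘(ℝ, ℝ × F)) (f ∘ π (ℝ × F) (Hull F A)) ψ := by
      have h3 : (fun y => (iotaOne F A ψ)⁻¹ * (f y - f ψ.1)) ∘ π (ℝ × F) (Hull F A) =
          (iotaOne F A ψ)⁻¹ • (f ∘ π (ℝ × F) (Hull F A) - fun _ => f ψ.1) := rfl
      rw [h3, dif_smul _ ((hfs.sub (smoothFun_const _)).mdifferentiableAt ψ),
        dif_sub (hfs.mdifferentiableAt ψ) ((smoothFun_const _).mdifferentiableAt ψ), dif_const,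
        sub_zero]
    rw [← hc, AffineFunction.bar_add, AffineFunction.bar_mulBase,
      dif_add (a.smooth_bar.mdifferentiableAt ψ)
        (((smooth_comp_proj hf').mul (AffineFunction.smooth_bar _)).mdifferentiableAt ψ),
      dif_add (a.smooth_bar.mdifferentiableAt ψ) (hfs.mdifferentiableAt ψ),
      dif_mul ((smooth_comp_proj hf').mdifferentiableAt ψ) h1, h2]
    simp only [Function.comp_apply, sub_self, mul_zero, zero_smul, zero_add, smul_smul]
    rw [AffineFunction.bar_one, mul_inv_cancel₀ hψ', one_smul]
  finrank_eq := by
    simp only [finrank_prod, finrank_self]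
    ring

end VectorHull

/-! ### The linear bivector field of an affine Jacobi structure -/

section FibrePoints

variable {M : Type*} [TopologicalSpace M]
  (F : Type*) [NormedAddCommGroup F] [NormedSpace ℝ F]
  {V : M → Type*} [∀ x, AddCommGroup (V x)] [∀ x, Module ℝ (V x)]
  (A : M → Type*) [∀ x, AddTorsor (V x) (A x)]
  [TopologicalSpace (TotalSpace F A)] [∀ x, TopologicalSpace (A x)]
  [FiberBundle F A] [IsAffineBundle F A]

/-- The point of the fibre with given coordinates in the preferred trivialization. -/
def fibrePoint (x : M) (v : F) : TotalSpace F A :=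
  ⟨x, (fibreAff F A (trivializationAt F A x) x).symm v⟩

variable {F A}

theorem exists_fibrePoint_eq (p : TotalSpace F A) : ∃ v, p = fibrePoint F A p.1 v :=
  ⟨fibreAff F A (trivializationAt F A p.1) p.1 p.2, by
    rw [fibrePoint, AffineEquiv.symm_apply_apply]⟩

theorem AffineFunction.exists_fibrePoint {EM H : Type*} [NormedAddCommGroup EM] [NormedSpace ℝ EM]
    [TopologicalSpace H] {I : ModelWithCorners ℝ EM H} [ChartedSpace H M]
    (a : AffineFunction I F A) (x : M) :
    ∃ (ℓ : Dual ℝ F) (r : ℝ), ∀ v, a.fn (fibrePoint F A x v) = ℓ v + r := by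
  refine ⟨((a.onFibre x).comp (fibreAff F A (trivializationAt F A x) x).symm.toAffineMap).linear,
    a.fn (fibrePoint F A x 0), fun v => ?_⟩
  exact congrFun (AffineMap.decomp ((a.onFibre x).comp
    (fibreAff F A (trivializationAt F A x) x).symm.toAffineMap)) v

end FibrePoints

/-! ### The anchor, and the candidate bivector field on the hull -/

section Linearization

variable {EM : Type*} [NormedAddCommGroup EM] [NormedSpace ℝ EM] [FiniteDimensional ℝ EM]
  {M : Type*} [TopologicalSpace M] [ChartedSpace EM M] [IsManifold 𝓘(ℝ, EM) ∞ M] [T2Space M]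
  {F : Type*} [NormedAddCommGroup F] [NormedSpace ℝ F] [FiniteDimensional ℝ F]
  {V : M → Type*} [∀ x, AddCommGroup (V x)] [∀ x, Module ℝ (V x)]
  {A : M → Type*} [∀ x, AddTorsor (V x) (A x)]
  [TopologicalSpace (TotalSpace F A)] [∀ x, TopologicalSpace (A x)]
  [FiberBundle F A] [IsSmoothAffineBundle F A 𝓘(ℝ, EM)]

theorem fibreCoord_fibrePoint (x : M) (c : Dual ℝ (ℝ × F)) (v : F) :
    (fibreCoord (EM := EM) (A := A) x c).fn (fibrePoint F A x v) = c (1, v) :=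
  ((fibreCoord_eventually x c).self_of_nhds _).trans
    (congrArg (fun w => c (1, w)) (AffineEquiv.apply_symm_apply _ v))

variable {J : JacobiStructure (𝓘(ℝ, EM).prod 𝓘(ℝ, F)) (TotalSpace F A)}

/-- A function whose products with affine functions are affine is basic. -/
theorem basic_of_mul_affine {r : TotalSpace F A → ℝ}
    (hr : ∀ b : AffineFunction 𝓘(ℝ, EM) F A, ∃ c : AffineFunction 𝓘(ℝ, EM) F A, b.fn * r = c.fn)
    (x : M) (v : F) : r (fibrePoint F A x v) = r (fibrePoint F A x 0) := by
  obtain ⟨c, hc⟩ := hr (AffineFunction.one EM F A)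
  rw [AffineFunction.fn_one, one_mul] at hc
  obtain ⟨ℓ, s, hℓ⟩ := c.exists_fibrePoint x
  have hrv : ∀ v, r (fibrePoint F A x v) = ℓ v + s := fun v => by rw [hc, hℓ]
  by_contra hne
  have hv : ℓ v ≠ 0 := fun h => hne (by rw [hrv, hrv, h, map_zero])
  -- the product with a fibre coordinate that takes the value `ℓ v` at `v` is not affine
  let b := fibreCoord (EM := EM) (A := A) x (ℓ ∘ₗ LinearMap.snd ℝ ℝ F)
  have hb : ∀ v, b.fn (fibrePoint F A x v) = ℓ v := fun v =>
    fibreCoord_fibrePoint x _ v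
  obtain ⟨d, hd⟩ := hr b
  obtain ⟨m, t, hm⟩ := d.exists_fibrePoint x
  have key : ∀ v, ℓ v * (ℓ v + s) = m v + t := fun v => by
    rw [← hm, ← hd, Pi.mul_apply, hb, hrv]
  -- The second difference over `v`, `-v`, `0` vanishes on affine functions, while on the product it
  -- is `2 (ℓ v)²`.
  have h1 := key v
  have h2 := key (-v)
  have h3 := key 0
  simp only [map_neg, map_zero] at h1 h2 h3
  have h4 : ℓ v * ℓ v = 0 := by linarith
  exact hv (mul_self_eq_zero.1 h4)

/-- The anchor `ρ(a)(f) = Λ(da, df) + a E(f)` of an affine Jacobi structure, as a function on the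
affine bundle. -/
def anchorFun (J : JacobiStructure (𝓘(ℝ, EM).prod 𝓘(ℝ, F)) (TotalSpace F A))
    (a : TotalSpace F A → ℝ) (f : M → ℝ) : TotalSpace F A → ℝ :=
  pairing J.Λ a (f ∘ π F A) + a * lieFun J.E (f ∘ π F A)

theorem smooth_anchorFun (J : JacobiStructure (𝓘(ℝ, EM).prod 𝓘(ℝ, F)) (TotalSpace F A))
    (a : AffineFunction 𝓘(ℝ, EM) F A) {f : M → ℝ} (hf : SmoothFun 𝓘(ℝ, EM) f) :
    SmoothFun (𝓘(ℝ, EM).prod 𝓘(ℝ, F)) (anchorFun J a.fn f) :=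
  (J.smoothΛ _ _ a.smooth (smooth_comp_proj hf)).add
    (a.smooth.mul (J.smoothE _ (smooth_comp_proj hf)))

/-- By the Leibniz rule, `{a, f b} - f {a, b} = b ρ(a)(f)`, so the product of the anchor with any
affine `b` is affine. -/
theorem anchorFun_basic (hJ : IsAffineJacobi J) (a : AffineFunction 𝓘(ℝ, EM) F A) {f : M → ℝ}
    (hf : SmoothFun 𝓘(ℝ, EM) f) (x : M) (v : F) :
    anchorFun J a.fn f (fibrePoint F A x v) = anchorFun J a.fn f (fibrePoint F A x 0) := by
  refine basic_of_mul_affine (EM := EM) (fun b => ?_) x v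
  obtain ⟨c, hc⟩ := hJ a (b.mulBase hf)
  obtain ⟨d, hd⟩ := hJ a b
  have hneg : SmoothFun 𝓘(ℝ, EM) (-f) := hf.neg
  refine ⟨c.add (d.mulBase hneg), ?_⟩
  rw [AffineFunction.fn_add, AffineFunction.fn_mulBase, ← hc, ← hd, AffineFunction.fn_mulBase]
  have hfs := smooth_comp_proj (F := F) (A := A) hf
  have hb : SmoothFun (𝓘(ℝ, EM).prod 𝓘(ℝ, F)) b.fn := b.smooth
  simp only [JacobiStructure.bracket, anchorFun]
  rw [pairing_mul_right _ _ hfs hb, lieFun_mul _ hfs hb]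
  have : (-f) ∘ π F A = -(f ∘ π F A) := rfl
  rw [this]
  ring

/-- For a bundle of positive rank, the bivector field of an affine Jacobi structure vanishes on
pairs of basic functions. -/
theorem pairing_base_base (hJ : IsAffineJacobi J) (hF : 0 < finrank ℝ F) {f g : M → ℝ}
    (hf : SmoothFun 𝓘(ℝ, EM) f) (hg : SmoothFun 𝓘(ℝ, EM) g) :
    pairing J.Λ (f ∘ π F A) (g ∘ π F A) = 0 := by
  have hfs := smooth_comp_proj (F := F) (A := A) hf
  -- The defect of linearity of the anchor over basic functions is `a Λ(df, dg)`, which must then be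
  -- basic for every affine `a`.
  have key : ∀ a : AffineFunction 𝓘(ℝ, EM) F A, anchorFun J (a.mulBase hf).fn g =
      (f ∘ π F A) * anchorFun J a.fn g + a.fn * pairing J.Λ (f ∘ π F A) (g ∘ π F A) := by
    intro a
    have ha : SmoothFun (𝓘(ℝ, EM).prod 𝓘(ℝ, F)) a.fn := a.smooth
    rw [AffineFunction.fn_mulBase, anchorFun, anchorFun, pairing_mul_left _ hfs ha]
    ring
  have hbasic : ∀ (a : AffineFunction 𝓘(ℝ, EM) F A) (x : M) (v : F),
      a.fn (fibrePoint F A x v) * pairing J.Λ (f ∘ π F A) (g ∘ π F A) (fibrePoint F A x v) =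
      a.fn (fibrePoint F A x 0) * pairing J.Λ (f ∘ π F A) (g ∘ π F A) (fibrePoint F A x 0) := by
    intro a x v
    have h1 := anchorFun_basic hJ (a.mulBase hf) hg x v
    rw [key] at h1
    simp only [Pi.add_apply, Pi.mul_apply] at h1
    rw [anchorFun_basic hJ a hg x v] at h1
    exact add_left_cancel h1
  ext p
  obtain ⟨v, hv⟩ := exists_fibrePoint_eq p
  have h0 : ∀ v, pairing J.Λ (f ∘ π F A) (g ∘ π F A) (fibrePoint F A p.1 v) =
      pairing J.Λ (f ∘ π F A) (g ∘ π F A) (fibrePoint F A p.1 0) := fun v => by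
    have h := hbasic (AffineFunction.one EM F A) p.1 v
    rwa [AffineFunction.fn_one, Pi.one_apply, Pi.one_apply, one_mul, one_mul] at h
  -- The case `a = 1` shows that the pairing is constant on the fibre. In positive rank there is a
  -- fibre coordinate that is zero at the origin and nonzero at `w`; its product with the pairing is
  -- also constant, so the pairing vanishes.
  have := nontrivial_of_finrank_pos hF
  obtain ⟨w, hw⟩ := exists_ne (0 : F)
  obtain ⟨ℓ, hℓ⟩ : ∃ ℓ : Dual ℝ F, ℓ w ≠ 0 := by
    by_contra! h
    exact hw ((forall_dual_apply_eq_zero_iff ℝ w).1 h)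
  have hb : ∀ v, (fibreCoord (EM := EM) (A := A) p.1 (ℓ ∘ₗ LinearMap.snd ℝ ℝ F)).fn
      (fibrePoint F A p.1 v) = ℓ v := fun v =>
    fibreCoord_fibrePoint p.1 _ v
  have h1 := hbasic (fibreCoord (EM := EM) p.1 (ℓ ∘ₗ LinearMap.snd ℝ ℝ F)) p.1 w
  rw [hb, hb, map_zero, zero_mul, h0] at h1
  have h2 := (mul_eq_zero.1 h1).resolve_left hℓ
  rw [hv, h0, h2]
  rfl

/-- The anchor of an affine Jacobi structure, as a function on the base. -/
def anchorBase (J : JacobiStructure (𝓘(ℝ, EM).prod 𝓘(ℝ, F)) (TotalSpace F A))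
    (a : TotalSpace F A → ℝ) (f : M → ℝ) (x : M) : ℝ := anchorFun J a f (fibrePoint F A x 0)

theorem anchorFun_eq (hJ : IsAffineJacobi J) (a : AffineFunction 𝓘(ℝ, EM) F A) {f : M → ℝ}
    (hf : SmoothFun 𝓘(ℝ, EM) f) (p : TotalSpace F A) :
    anchorFun J a.fn f p = anchorBase J a.fn f p.1 := by
  obtain ⟨v, hv⟩ := exists_fibrePoint_eq p
  rw [hv]
  exact anchorFun_basic hJ a hf p.1 v

/-- The points `fibrePoint F A y 0` use a trivialization that varies with `y` and need not form a
smooth section. As the anchor is basic, they may be replaced near `x` by the zero section of one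
trivialization. -/
theorem smooth_anchorBase (hJ : IsAffineJacobi J) (a : AffineFunction 𝓘(ℝ, EM) F A) {f : M → ℝ}
    (hf : SmoothFun 𝓘(ℝ, EM) f) : SmoothFun 𝓘(ℝ, EM) (anchorBase J a.fn f) := by
  intro x
  have h : anchorBase J a.fn f = fun y => anchorFun J a.fn f
      ⟨y, (fibreAff F A (trivializationAt F A x) y).symm 0⟩ :=
    funext fun y => (anchorFun_eq hJ a hf ⟨y, _⟩).symm
  rw [h]
  exact (smooth_anchorFun J a hf _).comp x (contMDiffAt_fibreAff_symm contMDiffAt_id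
    contMDiffAt_const (mem_baseSet_trivializationAt F A x))

/-- The affine function by which a covector of the hull is represented. -/
def covAffine (x : M) (c : Dual ℝ (EM × (ℝ × F))) : AffineFunction 𝓘(ℝ, EM) F A :=
  fibreCoord x (c ∘ₗ LinearMap.inr ℝ EM (ℝ × F))

/-- The basic function by which a covector of the hull is represented. -/
def covBase (x : M) (c : Dual ℝ (EM × (ℝ × F))) : M → ℝ :=
  baseCoord x (c ∘ₗ LinearMap.inl ℝ EM (ℝ × F))

theorem smooth_covBase (x : M) (c : Dual ℝ (EM × (ℝ × F))) :
    SmoothFun 𝓘(ℝ, EM) (covBase (M := M) x c) := smooth_baseCoord _ _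

/-- The representing functions are arbitrary choices, linear in the covector only as germs; this
suffices for values and differentials at `p`. -/
theorem covAffine_add (p : TotalSpace F A) (c c' : Dual ℝ (EM × (ℝ × F))) :
    (covAffine (A := A) p.1 (c + c')).fn =ᶠ[𝓝 p]
      (covAffine (A := A) p.1 c).fn + (covAffine (A := A) p.1 c').fn := by
  have hπ := (FiberBundle.continuous_proj F A).continuousAt (x := p)
  filter_upwards [hπ.eventually (fibreCoord_eventually (EM := EM) (A := A) p.1
      ((c + c') ∘ₗ LinearMap.inr ℝ EM (ℝ × F))),
    hπ.eventually (fibreCoord_eventually (EM := EM) (A := A) p.1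
      (c ∘ₗ LinearMap.inr ℝ EM (ℝ × F))),
    hπ.eventually (fibreCoord_eventually (EM := EM) (A := A) p.1
      (c' ∘ₗ LinearMap.inr ℝ EM (ℝ × F)))] with q h1 h2 h3
  rw [Pi.add_apply, AffineFunction.fn, AffineFunction.fn, AffineFunction.fn, covAffine, covAffine,
    covAffine, h1, h2, h3]
  rfl

theorem covAffine_smul (p : TotalSpace F A) (k : ℝ) (c : Dual ℝ (EM × (ℝ × F))) :
    (covAffine (A := A) p.1 (k • c)).fn =ᶠ[𝓝 p] k • (covAffine (A := A) p.1 c).fn := by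
  have hπ := (FiberBundle.continuous_proj F A).continuousAt (x := p)
  filter_upwards [hπ.eventually (fibreCoord_eventually (EM := EM) (A := A) p.1
      ((k • c) ∘ₗ LinearMap.inr ℝ EM (ℝ × F))),
    hπ.eventually (fibreCoord_eventually (EM := EM) (A := A) p.1
      (c ∘ₗ LinearMap.inr ℝ EM (ℝ × F)))] with q h1 h2
  rw [Pi.smul_apply, AffineFunction.fn, AffineFunction.fn, covAffine, covAffine, h1, h2]
  rfl

theorem covBase_add (p : TotalSpace F A) (c c' : Dual ℝ (EM × (ℝ × F))) :
    covBase p.1 (c + c') ∘ π F A =ᶠ[𝓝 p]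
      covBase p.1 c ∘ π F A + covBase p.1 c' ∘ π F A := by
  have hπ := (FiberBundle.continuous_proj F A).continuousAt (x := p)
  filter_upwards [hπ.eventually (baseCoord_eventuallyEq p.1
      ((c + c') ∘ₗ LinearMap.inl ℝ EM (ℝ × F))),
    hπ.eventually (baseCoord_eventuallyEq p.1 (c ∘ₗ LinearMap.inl ℝ EM (ℝ × F))),
    hπ.eventually (baseCoord_eventuallyEq p.1 (c' ∘ₗ LinearMap.inl ℝ EM (ℝ × F)))] with q h1 h2 h3
  rw [Pi.add_apply, Function.comp_apply, Function.comp_apply, Function.comp_apply, covBase,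
    covBase, covBase, h1, h2, h3]
  rfl

theorem covBase_smul (p : TotalSpace F A) (k : ℝ) (c : Dual ℝ (EM × (ℝ × F))) :
    covBase p.1 (k • c) ∘ π F A =ᶠ[𝓝 p] k • (covBase p.1 c ∘ π F A) := by
  have hπ := (FiberBundle.continuous_proj F A).continuousAt (x := p)
  filter_upwards [hπ.eventually (baseCoord_eventuallyEq p.1
      ((k • c) ∘ₗ LinearMap.inl ℝ EM (ℝ × F))),
    hπ.eventually (baseCoord_eventuallyEq p.1 (c ∘ₗ LinearMap.inl ℝ EM (ℝ × F)))] with q h1 h2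
  rw [Pi.smul_apply, Function.comp_apply, Function.comp_apply, covBase, covBase, h1, h2]
  rfl

theorem AffineFunction.mdifferentiableAt (a : AffineFunction 𝓘(ℝ, EM) F A) (p : TotalSpace F A) :
    MDifferentiableAt (𝓘(ℝ, EM).prod 𝓘(ℝ, F)) 𝓘(ℝ, ℝ) a.fn p :=
  SmoothFun.mdifferentiableAt a.smooth p

/-- The value at a point of the affine function that represents a covector of the hull. -/
def covVal (p : TotalSpace F A) : Dual ℝ (EM × (ℝ × F)) →ₗ[ℝ] ℝ where
  toFun c := (covAffine (EM := EM) p.1 c).fn p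
  map_add' c c' := (covAffine_add p c c').eq_of_nhds
  map_smul' k c := (covAffine_smul p k c).eq_of_nhds

/-- The differential of the affine function that represents a covector of the hull. -/
def covDif (p : TotalSpace F A) :
    Dual ℝ (EM × (ℝ × F)) →ₗ[ℝ] Cotangent (𝓘(ℝ, EM).prod 𝓘(ℝ, F)) p where
  toFun c := dif (𝓘(ℝ, EM).prod 𝓘(ℝ, F)) (covAffine (EM := EM) p.1 c).fn p
  map_add' c c' := by
    rw [(covAffine_add p c c').dif_eq, dif_add (AffineFunction.mdifferentiableAt _ _)
      (AffineFunction.mdifferentiableAt _ _)]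
  map_smul' k c := by
    rw [(covAffine_smul p k c).dif_eq, dif_smul _ (AffineFunction.mdifferentiableAt _ _),
      RingHom.id_apply]

/-- The differential of the basic function that represents a covector of the hull. -/
def covBaseDif (p : TotalSpace F A) :
    Dual ℝ (EM × (ℝ × F)) →ₗ[ℝ] Cotangent (𝓘(ℝ, EM).prod 𝓘(ℝ, F)) p where
  toFun c := dif (𝓘(ℝ, EM).prod 𝓘(ℝ, F)) (covBase p.1 c ∘ π F A) p
  map_add' c c' := by
    rw [(covBase_add p c c').dif_eq,
      dif_add ((smooth_comp_proj (smooth_covBase _ _)).mdifferentiableAt _)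
        ((smooth_comp_proj (smooth_covBase _ _)).mdifferentiableAt _)]
  map_smul' k c := by
    rw [(covBase_smul p k c).dif_eq,
      dif_smul _ ((smooth_comp_proj (smooth_covBase _ _)).mdifferentiableAt _), RingHom.id_apply]

/-- The Jacobi bracket of the affine functions that represent two covectors of the hull. -/
def covBracket (J : JacobiStructure (𝓘(ℝ, EM).prod 𝓘(ℝ, F)) (TotalSpace F A))
    (p : TotalSpace F A) :
    Dual ℝ (EM × (ℝ × F)) →ₗ[ℝ] Dual ℝ (EM × (ℝ × F)) →ₗ[ℝ] ℝ :=
  LinearMap.mk₂ ℝ (fun c c' => altBilin (J.Λ p) (covDif p c) (covDif p c') +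
      covVal p c * covDif p c' (J.E p) - covVal p c' * covDif p c (J.E p))
    (fun c c' d => by simp only [map_add, LinearMap.add_apply]; ring)
    (fun k c d => by simp only [map_smul, LinearMap.smul_apply, smul_eq_mul]; ring)
    (fun c d d' => by simp only [map_add, LinearMap.add_apply]; ring)
    (fun k c d => by simp only [map_smul, LinearMap.smul_apply, smul_eq_mul]; ring)

/-- The anchor, on the functions that represent two covectors of the hull. -/
def covAnchor (J : JacobiStructure (𝓘(ℝ, EM).prod 𝓘(ℝ, F)) (TotalSpace F A))
    (p : TotalSpace F A) :
    Dual ℝ (EM × (ℝ × F)) →ₗ[ℝ] Dual ℝ (EM × (ℝ × F)) →ₗ[ℝ] ℝ :=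
  LinearMap.mk₂ ℝ (fun c c' => altBilin (J.Λ p) (covDif p c) (covBaseDif p c') +
      covVal p c * covBaseDif p c' (J.E p))
    (fun c c' d => by simp only [map_add, LinearMap.add_apply]; ring)
    (fun k c d => by simp only [map_smul, LinearMap.smul_apply, smul_eq_mul]; ring)
    (fun c d d' => by simp only [map_add, LinearMap.add_apply]; ring)
    (fun k c d => by simp only [map_smul, LinearMap.smul_apply, smul_eq_mul]; ring)

theorem covBracket_self (J : JacobiStructure (𝓘(ℝ, EM).prod 𝓘(ℝ, F)) (TotalSpace F A))
    (p : TotalSpace F A) (c : Dual ℝ (EM × (ℝ × F))) : covBracket J p c c = 0 := by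
  change altBilin (J.Λ p) (covDif p c) (covDif p c) + _ - _ = (0 : ℝ)
  rw [altBilin_self]
  ring

/-- The bivector field on the hull that corresponds to an affine Jacobi structure. -/
def hullBivector (J : JacobiStructure (𝓘(ℝ, EM).prod 𝓘(ℝ, F)) (TotalSpace F A))
    (ψ : TotalSpace (ℝ × F) (Hull F A)) : Bivector (𝓘(ℝ, EM).prod 𝓘(ℝ, ℝ × F)) ψ :=
  -- The first two terms are the formula of `Hull.eval_eq` for the linear function of a bracket; the
  -- last one pairs affine with basic parts through the anchor. No division by `iotaOne` occurs, so
  -- the formula makes sense where `iotaOne` vanishes. The term that would pair basic with basic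
  -- parts is omitted, as it is zero in positive rank.
  altOfBilin (W := Dual ℝ (EM × (ℝ × F)))
    (covBracket J (fibrePoint F A ψ.1
        (hullFibre F A (trivializationAt F A ψ.1) ψ.1 ψ.2).2) +
      (iotaOne F A ψ - 1) • covBracket J (fibrePoint F A ψ.1 0) +
      (covAnchor J (fibrePoint F A ψ.1 0) - (covAnchor J (fibrePoint F A ψ.1 0)).flip))
    (fun c => by
      simp only [LinearMap.add_apply, LinearMap.smul_apply, covBracket_self, LinearMap.sub_apply,
        LinearMap.flip_apply]
      simp)

/-- Evaluating the affine function `d` at the coordinates of `ψ` and at the origin, as in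
`AffineFunction.bar_eq`, gives exactly the first two terms of the definition. -/
theorem hullBivector_apply {J : JacobiStructure (𝓘(ℝ, EM).prod 𝓘(ℝ, F)) (TotalSpace F A)}
    (ψ : TotalSpace (ℝ × F) (Hull F A)) (c c' : Dual ℝ (EM × (ℝ × F)))
    {d : AffineFunction 𝓘(ℝ, EM) F A}
    (hd : J.bracket (covAffine ψ.1 c).fn (covAffine ψ.1 c').fn = d.fn) :
    altBilin (hullBivector J ψ) c c' = d.bar ψ +
      anchorBase J (covAffine ψ.1 c).fn (covBase ψ.1 c') ψ.1 -
      anchorBase J (covAffine ψ.1 c').fn (covBase ψ.1 c) ψ.1 := by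
  have h := d.bar_eq ψ.1 ψ
  rw [← hd] at h
  rw [h, add_sub_assoc]
  rfl

end Linearization

/-! ### Points of the hull off the hyperplanes `iotaOne = 0` -/

section HullPoints

variable {M : Type*} [TopologicalSpace M]
  {F : Type*} [NormedAddCommGroup F] [NormedSpace ℝ F] [FiniteDimensional ℝ F]
  {V : M → Type*} [∀ x, AddCommGroup (V x)] [∀ x, Module ℝ (V x)]
  {A : M → Type*} [∀ x, AddTorsor (V x) (A x)]
  [TopologicalSpace (TotalSpace F A)] [∀ x, TopologicalSpace (A x)]
  [FiberBundle F A] [IsAffineBundle F A]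

/-- In coordinates `ψ = (t, w)` with `t ≠ 0`, and `(t, w) = t (1, t⁻¹ w)`. -/
theorem exists_eq_smul_inclHull (ψ : TotalSpace (ℝ × F) (Hull F A)) (hψ : iotaOne F A ψ ≠ 0) :
    ∃ p : TotalSpace F A, ψ = ⟨p.1, iotaOne F A ψ • (inclHull F A p).2⟩ := by
  obtain ⟨x, ψ⟩ := ψ
  have h1 := hullFibre_fst (trivializationAt F A x) ψ
  change (hullFibre F A (trivializationAt F A x) x ψ).1 = iotaOne F A ⟨x, ψ⟩ at h1
  let v : F := (iotaOne F A ⟨x, ψ⟩)⁻¹ • (hullFibre F A (trivializationAt F A x) x ψ).2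
  let p : TotalSpace F A := ⟨x, (fibreAff F A (trivializationAt F A x) x).symm v⟩
  refine ⟨p, congrArg (TotalSpace.mk x) ((hullFibre F A (trivializationAt F A x) x).injective ?_)⟩
  have h2 : hullFibre F A (trivializationAt F A x) x (inclHull F A p).2 = (1, v) :=
    (hullFibre_inclHull _ p).trans (congrArg _ (AffineEquiv.apply_symm_apply _ v))
  refine Eq.trans ?_ (map_smul (hullFibre F A (trivializationAt F A x) x) _ _).symm
  rw [h2]
  refine Prod.ext ?_ ?_
  · rw [h1]
    simp
  · simp [v, smul_smul, mul_inv_cancel₀ hψ]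

end HullPoints

/-! ### Brackets and smoothness of the bivector field on the hull -/

section LinearizationFormula

variable {EM : Type*} [NormedAddCommGroup EM] [NormedSpace ℝ EM] [FiniteDimensional ℝ EM]
  {M : Type*} [TopologicalSpace M] [ChartedSpace EM M] [IsManifold 𝓘(ℝ, EM) ∞ M] [T2Space M]
  {F : Type*} [NormedAddCommGroup F] [NormedSpace ℝ F] [FiniteDimensional ℝ F]
  {V : M → Type*} [∀ x, AddCommGroup (V x)] [∀ x, Module ℝ (V x)]
  {A : M → Type*} [∀ x, AddTorsor (V x) (A x)]
  [TopologicalSpace (TotalSpace F A)] [∀ x, TopologicalSpace (A x)]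
  [FiberBundle F A] [IsSmoothAffineBundle F A 𝓘(ℝ, EM)]
  {J : JacobiStructure (𝓘(ℝ, EM).prod 𝓘(ℝ, F)) (TotalSpace F A)}

/-- Let `S` be the map `q ↦ t q` into the hull, with `t` the value of `iotaOne` at `ψ`. The bivector
is `t⁻¹ (S_* Λ + Δ ∧ S_* E)`. Since `ā + f` pulls back to `t a + f` and `Δ(ā + f) = t a` at `ψ`,
expanding in powers of `t` gives `t {a, b}`, then `ρ(a)(g) - ρ(b)(f)`, and `t⁻¹ Λ(df, dg)`, which
vanishes. Being an honest bivector, it shows that the prescribed values depend only on the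
differentials. -/
theorem exists_bivector_hull (hJ : IsAffineJacobi J) (hF : 0 < finrank ℝ F)
    (ψ : TotalSpace (ℝ × F) (Hull F A)) (hψ : iotaOne F A ψ ≠ 0) :
    ∃ Θ : Bivector (𝓘(ℝ, EM).prod 𝓘(ℝ, ℝ × F)) ψ,
      ∀ (a b c : AffineFunction 𝓘(ℝ, EM) F A) (f g : M → ℝ), SmoothFun 𝓘(ℝ, EM) f →
        SmoothFun 𝓘(ℝ, EM) g → J.bracket a.fn b.fn = c.fn →
        altBilin Θ (dif _ (a.bar + f ∘ π (ℝ × F) (Hull F A)) ψ)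
          (dif _ (b.bar + g ∘ π (ℝ × F) (Hull F A)) ψ) =
        c.bar ψ + anchorBase J a.fn g ψ.1 - anchorBase J b.fn f ψ.1 := by
  obtain ⟨p, hp⟩ := exists_eq_smul_inclHull ψ hψ
  generalize iotaOne F A ψ = t at hp hψ
  subst hp
  let S : TotalSpace F A → TotalSpace (ℝ × F) (Hull F A) :=
    fun q => ⟨q.1, t • (inclHull F A q).2⟩
  have hS : MDifferentiableAt (𝓘(ℝ, EM).prod 𝓘(ℝ, F)) (𝓘(ℝ, EM).prod 𝓘(ℝ, ℝ × F)) S p :=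
    (contMDiff_smul_inclHull t p).mdifferentiableAt (by simp)
  refine ⟨t⁻¹ • pushBivector (𝓘(ℝ, EM).prod 𝓘(ℝ, F)) (𝓘(ℝ, EM).prod 𝓘(ℝ, ℝ × F)) S p (J.Λ p) +
    t⁻¹ • wedge _ (liouville 𝓘(ℝ, EM) F A (S p)) (mfderiv (𝓘(ℝ, EM).prod 𝓘(ℝ, F))
      (𝓘(ℝ, EM).prod 𝓘(ℝ, ℝ × F)) S p (J.E p)), fun a b c f g hf hg hc => ?_⟩
  have hsm : ∀ (a : AffineFunction 𝓘(ℝ, EM) F A) {f : M → ℝ}, SmoothFun 𝓘(ℝ, EM) f →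
      SmoothFun (𝓘(ℝ, EM).prod 𝓘(ℝ, ℝ × F)) (a.bar + f ∘ π (ℝ × F) (Hull F A)) :=
    fun a f hf => a.smooth_bar.add (smooth_comp_proj hf)
  have hdif : ∀ (a : AffineFunction 𝓘(ℝ, EM) F A) {f : M → ℝ}, SmoothFun 𝓘(ℝ, EM) f →
      (dif (𝓘(ℝ, EM).prod 𝓘(ℝ, ℝ × F)) (a.bar + f ∘ π (ℝ × F) (Hull F A)) (S p)).comp
        (mfderiv (𝓘(ℝ, EM).prod 𝓘(ℝ, F)) (𝓘(ℝ, EM).prod 𝓘(ℝ, ℝ × F)) S p).toLinearMap =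
      t • dif (𝓘(ℝ, EM).prod 𝓘(ℝ, F)) a.fn p +
        dif (𝓘(ℝ, EM).prod 𝓘(ℝ, F)) (f ∘ π F A) p := fun a f hf => by
    rw [← dif_comp ((hsm a hf).mdifferentiableAt _) hS, ← dif_smul t (a.mdifferentiableAt p),
      ← dif_add (SmoothFun.mdifferentiableAt (f := t • a.fn) (SmoothFun.const_smul t a.smooth) p)
        ((smooth_comp_proj hf).mdifferentiableAt p)]
    rfl
  have hlie : ∀ (a : AffineFunction 𝓘(ℝ, EM) F A) {f : M → ℝ}, SmoothFun 𝓘(ℝ, EM) f →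
      dif (𝓘(ℝ, EM).prod 𝓘(ℝ, ℝ × F)) (a.bar + f ∘ π (ℝ × F) (Hull F A)) (S p)
        (liouville 𝓘(ℝ, EM) F A (S p)) = t * a.fn p := fun a f hf => by
    rw [← lieFun_apply, lieFun_add _ a.smooth_bar (smooth_comp_proj hf), lieFun_liouville_bar,
      lieFun_liouville_base hf, add_zero]
    rfl
  have hE : ∀ (a : AffineFunction 𝓘(ℝ, EM) F A) {f : M → ℝ}, SmoothFun 𝓘(ℝ, EM) f →
      dif (𝓘(ℝ, EM).prod 𝓘(ℝ, ℝ × F)) (a.bar + f ∘ π (ℝ × F) (Hull F A)) (S p)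
        (mfderiv (𝓘(ℝ, EM).prod 𝓘(ℝ, F)) (𝓘(ℝ, EM).prod 𝓘(ℝ, ℝ × F)) S p (J.E p)) =
      t * lieFun J.E a.fn p + lieFun J.E (f ∘ π F A) p := fun a f hf =>
    LinearMap.congr_fun (hdif a hf) (J.E p)
  have hcb : c.bar (S p) = t * (pairing J.Λ a.fn b.fn p + a.fn p * lieFun J.E b.fn p -
      b.fn p * lieFun J.E a.fn p) := by
    rw [← JacobiStructure.bracket_apply, hc]
    rfl
  -- This kills the only term of order `t⁻¹`.
  have h0 := congrFun (pairing_base_base hJ hF hf hg) p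
  have hag := anchorFun_eq hJ a hg p
  have hbf := anchorFun_eq hJ b hf p
  have hpush := altBilin_pushBivector (I := 𝓘(ℝ, EM).prod 𝓘(ℝ, F))
    (I' := 𝓘(ℝ, EM).prod 𝓘(ℝ, ℝ × F)) (φ := S) p (J.Λ p)
  change altBilin (t⁻¹ • _ + t⁻¹ • _) (dif _ _ (S p)) (dif _ _ (S p)) = c.bar (S p) +
    anchorBase J a.fn g p.1 - anchorBase J b.fn f p.1
  have hadd : ∀ (Θ Θ' : Bivector (𝓘(ℝ, EM).prod 𝓘(ℝ, ℝ × F)) (S p)) (α β),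
      altBilin (t⁻¹ • Θ + t⁻¹ • Θ') α β = t⁻¹ * (altBilin Θ α β + altBilin Θ' α β) :=
    fun Θ Θ' α β => (mul_add _ _ _).symm
  rw [hadd, hpush, altBilin_wedge, hdif a hf, hdif b hg, hlie a hf, hlie b hg, hE a hf, hE b hg,
    hcb, ← hag, ← hbf]
  simp only [map_add, map_smul, LinearMap.add_apply, LinearMap.smul_apply, smul_eq_mul,
    ← pairing_apply]
  simp only [anchorFun, Pi.add_apply, Pi.mul_apply]
  rw [h0, pairing_swap J.Λ (f ∘ π F A) b.fn, inv_mul_eq_iff_eq_mul₀ hψ]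
  simp only [Pi.neg_apply, Pi.zero_apply]
  ring

/-- The candidate and the bivector of `exists_bivector_hull` agree on the representatives of all
covectors, hence are equal; the formula for arbitrary functions is inherited. -/
theorem pairing_hullBivector_of_ne (hJ : IsAffineJacobi J) (hF : 0 < finrank ℝ F)
    (ψ : TotalSpace (ℝ × F) (Hull F A)) (hψ : iotaOne F A ψ ≠ 0)
    (a b c : AffineFunction 𝓘(ℝ, EM) F A) (f g : M → ℝ) (hf : SmoothFun 𝓘(ℝ, EM) f)
    (hg : SmoothFun 𝓘(ℝ, EM) g) (hc : J.bracket a.fn b.fn = c.fn) :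
    pairing (hullBivector J) (a.bar + f ∘ π (ℝ × F) (Hull F A))
      (b.bar + g ∘ π (ℝ × F) (Hull F A)) ψ =
    c.bar ψ + anchorBase J a.fn g ψ.1 - anchorBase J b.fn f ψ.1 := by
  obtain ⟨Θ, hΘ⟩ := exists_bivector_hull hJ hF ψ hψ
  have h : hullBivector J ψ = Θ := by
    refine altBilin_injective (LinearMap.ext fun γ => LinearMap.ext fun γ' => ?_)
    obtain ⟨d, hd⟩ := hJ (covAffine ψ.1 γ) (covAffine ψ.1 γ')
    rw [hullBivector_apply ψ γ γ' hd, ← hΘ _ _ d _ _ (smooth_covBase ψ.1 γ)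
      (smooth_covBase ψ.1 γ') hd]
    exact congrArg₂ (fun α β => altBilin Θ α β) (dif_hullCoordFun (A := A) γ rfl)
      (dif_hullCoordFun (A := A) γ' rfl)
  rw [pairing_apply, h]
  exact hΘ a b c f g hf hg hc

/-- The bivector field on the hull that corresponds to an affine Jacobi structure, on linear and on
basic functions. -/
theorem pairing_hullBivector (hJ : IsAffineJacobi J) (hF : 0 < finrank ℝ F)
    (a b c : AffineFunction 𝓘(ℝ, EM) F A) (f g : M → ℝ) (hf : SmoothFun 𝓘(ℝ, EM) f)
    (hg : SmoothFun 𝓘(ℝ, EM) g) (hc : J.bracket a.fn b.fn = c.fn) :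
    pairing (hullBivector J) (a.bar + f ∘ π (ℝ × F) (Hull F A))
      (b.bar + g ∘ π (ℝ × F) (Hull F A)) =
    c.bar + anchorBase J a.fn g ∘ π (ℝ × F) (Hull F A) -
      anchorBase J b.fn f ∘ π (ℝ × F) (Hull F A) := by
  ext ψ
  by_cases hψ : iotaOne F A ψ ≠ 0
  · exact pairing_hullBivector_of_ne hJ hF ψ hψ a b c f g hf hg hc
  obtain ⟨x, ψ⟩ := ψ
  push Not at hψ
  obtain ⟨p⟩ : Nonempty (A x) := inferInstance
  -- approach `ψ` along a line in its fibre
  let η : Hull F A x := (inclHull F A ⟨x, p⟩).2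
  let ℓ : ℝ → TotalSpace (ℝ × F) (Hull F A) := fun s => ⟨x, (1 : ℝ) • ψ + s • η⟩
  have hℓ0 : ℓ 0 = ⟨x, ψ⟩ := by simp [ℓ]
  have hℓ : Continuous ℓ :=
    (contMDiff_hull_line (EM := EM) ψ η contDiff_const contDiff_id).continuous
  have hι : ∀ s, iotaOne F A (ℓ s) = s := fun s => by
    have h1 : iotaOne F A (ℓ s) = 1 * iotaOne F A ⟨x, ψ⟩ + s * 1 := rfl
    rw [h1, hψ]
    ring
  -- The line stays over `x`, so the same coordinate functions give a coframe at every `ℓ s`.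
  let e : Fin (finrank ℝ (EM × (ℝ × F))) → Dual ℝ (EM × (ℝ × F)) := (finBasis ℝ _).coord
  choose d hd using fun i j => hJ (covAffine x (e i)) (covAffine x (e j))
  have hexp : ∀ {G : TotalSpace (ℝ × F) (Hull F A) → ℝ},
      SmoothFun (𝓘(ℝ, EM).prod 𝓘(ℝ, ℝ × F)) G →
      ∃ k : Fin (finrank ℝ (EM × (ℝ × F))) → TotalSpace (ℝ × F) (Hull F A) → ℝ,
        (∀ i, ContinuousAt (k i) (ℓ 0)) ∧ ∀ᶠ s in 𝓝 (0 : ℝ),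
          dif (𝓘(ℝ, EM).prod 𝓘(ℝ, ℝ × F)) G (ℓ s) =
            (∑ i, k i (ℓ s) • e i : Dual ℝ (EM × (ℝ × F))) := by
    intro G hG
    obtain ⟨k, -, hk, hGk, -⟩ := exists_expansion_of_coords
      (fun i => smooth_hullCoordFun (A := A) x (e i))
      (fun i => hullCoordFun_eventuallyEq (A := A) (e i) (ψ := ℓ 0) rfl) hG
    refine ⟨k, fun i => (hk i).continuousAt, ?_⟩
    filter_upwards [(hℓ.continuousAt (x := 0)).eventually hGk] with s hs
    rw [hs]
    exact Finset.sum_congr rfl fun i _ =>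
      congrArg (k i (ℓ s) • ·) (dif_hullCoordFun (A := A) (e i) (ψ := ℓ s) rfl)
  have hsm : ∀ (a : AffineFunction 𝓘(ℝ, EM) F A) {f : M → ℝ}, SmoothFun 𝓘(ℝ, EM) f →
      SmoothFun (𝓘(ℝ, EM).prod 𝓘(ℝ, ℝ × F)) (a.bar + f ∘ π (ℝ × F) (Hull F A)) :=
    fun a f hf => a.smooth_bar.add (smooth_comp_proj hf)
  obtain ⟨k, hk, hak⟩ := hexp (hsm a hf)
  obtain ⟨k', hk', hbk⟩ := hexp (hsm b hg)
  -- Smoothness of `hullBivector` is not yet known. Continuity along the line comes from its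
  -- explicit values on the coframe and the continuous coefficients of the two differentials.
  let lhs : ℝ → ℝ := fun s => ∑ i, ∑ j, k i (ℓ s) * (k' j (ℓ s) * ((d i j).bar (ℓ s) +
    anchorBase J (covAffine x (e i)).fn (covBase x (e j)) x -
    anchorBase J (covAffine x (e j)).fn (covBase x (e i)) x))
  let rhs : ℝ → ℝ := fun s => c.bar (ℓ s) + anchorBase J a.fn g x - anchorBase J b.fn f x
  have hl : ∀ᶠ s in 𝓝 (0 : ℝ), pairing (hullBivector J) (a.bar + f ∘ π (ℝ × F) (Hull F A))
      (b.bar + g ∘ π (ℝ × F) (Hull F A)) (ℓ s) = lhs s := by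
    filter_upwards [hak, hbk] with s h1 h2
    have h3 : ∀ (B : Dual ℝ (EM × (ℝ × F)) →ₗ[ℝ] Dual ℝ (EM × (ℝ × F)) →ₗ[ℝ] ℝ),
        B (∑ i, k i (ℓ s) • e i) (∑ i, k' i (ℓ s) • e i) =
          ∑ i, ∑ j, k i (ℓ s) * (k' j (ℓ s) * B (e i) (e j)) := fun B => by
      simp only [map_sum, map_smul, LinearMap.sum_apply, LinearMap.smul_apply, smul_eq_mul,
        Finset.mul_sum]
      rw [Finset.sum_comm]
      exact Finset.sum_congr rfl fun i _ => Finset.sum_congr rfl fun j _ => by ring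
    rw [pairing_apply, h1, h2]
    refine (h3 (altBilin (W := Dual ℝ (EM × (ℝ × F))) (hullBivector J (ℓ s)))).trans ?_
    exact Finset.sum_congr rfl fun i _ => Finset.sum_congr rfl fun j _ => by
      rw [← hullBivector_apply (ℓ s) (e i) (e j) (hd i j)]
      rfl
  have hlc : ContinuousAt lhs 0 := by
    refine tendsto_finsetSum _ fun i _ => tendsto_finsetSum _ fun j _ => ?_
    have h1 : ContinuousAt (fun s => k i (ℓ s)) 0 := (hk i).comp hℓ.continuousAt
    have h2 : ContinuousAt (fun s => k' j (ℓ s)) 0 := (hk' j).comp hℓ.continuousAt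
    have h3 : Continuous fun s => (d i j).bar (ℓ s) := (d i j).smooth_bar.continuous.comp hℓ
    exact h1.mul (h2.mul ((h3.continuousAt.add continuousAt_const).sub continuousAt_const))
  have hrc : ContinuousAt rhs 0 :=
    ((c.smooth_bar.continuous.comp hℓ).continuousAt.add continuousAt_const).sub
      continuousAt_const
  have heq : lhs =ᶠ[𝓝[≠] 0] rhs := by
    filter_upwards [nhdsWithin_le_nhds hl, self_mem_nhdsWithin] with s h1 h2
    rw [← h1]
    exact pairing_hullBivector_of_ne hJ hF (ℓ s) (by rwa [hι]) a b c f g hf hg hc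
  have h0 : lhs 0 = rhs 0 :=
    tendsto_nhds_unique_of_eventuallyEq (hlc.mono_left nhdsWithin_le_nhds)
      (hrc.mono_left nhdsWithin_le_nhds) heq
  rw [← hl.self_of_nhds] at h0
  rw [← hℓ0]
  exact h0

theorem anchorBase_zero (a : TotalSpace F A → ℝ) : anchorBase J a (fun _ => 0) = 0 := by
  ext x
  have h : (fun _ : M => (0 : ℝ)) ∘ π F A = fun _ => 0 := rfl
  rw [anchorBase, anchorFun, h, pairing_const_right, lieFun_const, mul_zero, add_zero]
  rfl

/-- Sums of linear and basic functions contain coordinates, and their brackets are visibly smooth.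
-/
theorem smooth_hullBivector (hJ : IsAffineJacobi J) (hF : 0 < finrank ℝ F) :
    SmoothBivectorField (𝓘(ℝ, EM).prod 𝓘(ℝ, ℝ × F)) (hullBivector J) := by
  refine containsCoordinates_hull.smoothBivectorField ?_
  rintro _ ⟨a, f, hf, rfl⟩ _ ⟨b, g, hg, rfl⟩
  obtain ⟨c, hc⟩ := hJ a b
  rw [pairing_hullBivector hJ hF a b c f g hf hg hc]
  exact (c.smooth_bar.add (smooth_comp_proj (smooth_anchorBase hJ a hg))).sub
    (smooth_comp_proj (smooth_anchorBase hJ b hf))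

theorem pairing_hullBivector_bar (hJ : IsAffineJacobi J) (hF : 0 < finrank ℝ F)
    (a b c : AffineFunction 𝓘(ℝ, EM) F A) (hc : J.bracket a.fn b.fn = c.fn) :
    pairing (hullBivector J) a.bar b.bar = c.bar := by
  have h := pairing_hullBivector hJ hF a b c (fun _ => 0) (fun _ => 0) (smoothFun_const 0)
    (smoothFun_const 0) hc
  rw [anchorBase_zero, anchorBase_zero] at h
  have h0 : ∀ a : AffineFunction 𝓘(ℝ, EM) F A,
      a.bar + (fun _ => 0) ∘ π (ℝ × F) (Hull F A) = a.bar := fun a => funext fun _ => add_zero _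
  have h1 : (0 : M → ℝ) ∘ π (ℝ × F) (Hull F A) = 0 := rfl
  rwa [h0, h0, h1, add_zero, sub_zero] at h

/-- If `Λ` is homogeneous, the bracket of two functions of degree one has degree `1 + 1 - 1`, and
smooth functions of degree one come from affine functions. -/
theorem isHomogeneous_hull_iff
    {Λ : ∀ ψ : TotalSpace (ℝ × F) (Hull F A), Bivector (𝓘(ℝ, EM).prod 𝓘(ℝ, ℝ × F)) ψ}
    (hΛ : SmoothBivectorField (𝓘(ℝ, EM).prod 𝓘(ℝ, ℝ × F)) Λ) :
    IsHomogeneous (liouville 𝓘(ℝ, EM) F A) Λ ↔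
      IsLinearFor (AffineFunction.bar (I := 𝓘(ℝ, EM)) (F := F) (E := A)) Λ := by
  refine ⟨fun h a b => ?_, fun h => isHull_vectorHull.isHomogeneous hΛ h⟩
  refine exists_bar_eq (hΛ _ _ a.smooth_bar b.smooth_bar) ?_
  have h1 := h a.bar b.bar a.smooth_bar b.smooth_bar
  rw [lieBivector, lieFun_liouville_bar, lieFun_liouville_bar] at h1
  linear_combination h1

variable (EM M F A) in
theorem exists_equiv_affineJacobi_homogeneousPoisson (hF : 0 < finrank ℝ F) :
    ∃ Φ : AffineJacobi 𝓘(ℝ, EM) F A ≃ HomogeneousPoisson 𝓘(ℝ, EM) F A,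
      (∀ J P, P = Φ J ↔ ∀ (a b : AffineFunction 𝓘(ℝ, EM) F A) (p : TotalSpace F A),
        J.1.bracket a.fn b.fn p = P.1.bracket a.bar b.bar (inclHull F A p)) ∧
      ∀ J, ∃ K : JacobiStructure (𝓘(ℝ, EM).prod 𝓘(ℝ, ℝ × F)) (TotalSpace (ℝ × F) (Hull F A)),
        K.E = hamOne (Φ J).1.Λ ∧
        (K.Λ = fun ψ => (Φ J).1.Λ ψ - wedge _ (liouville 𝓘(ℝ, EM) F A ψ) (K.E ψ)) ∧
        IsRelated (inclHull F A) J.1 K := by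
  obtain ⟨Φ, h1, h2⟩ := isHull_vectorHull.exists_equiv
    (p := fun J : JacobiStructure (𝓘(ℝ, EM).prod 𝓘(ℝ, F)) (TotalSpace F A) => IsAffineJacobi J)
    (q := fun P => IsHomogeneous (liouville 𝓘(ℝ, EM) F A) P.Λ)
    (fun J => Iff.rfl) (fun P => isHomogeneous_hull_iff P.smoothΛ)
    (fun J hJ => ⟨hullBivector J, smooth_hullBivector hJ hF, fun a b => by
      obtain ⟨c, hc⟩ := hJ a b
      exact ⟨c, pairing_hullBivector_bar hJ hF a b c hc, hc.symm⟩⟩)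
  exact ⟨Φ, h1, fun J => ⟨_, rfl, rfl, h2 J ((isHomogeneous_hull_iff (Φ J).1.smoothΛ).1 (Φ J).2)⟩⟩

end LinearizationFormula

/-! ### Jacobi structures and diffeomorphisms -/

section Diffeomorphisms

variable {EN : Type*} [NormedAddCommGroup EN] [NormedSpace ℝ EN]
  {HN : Type*} [TopologicalSpace HN] {I : ModelWithCorners ℝ EN HN}
  {N : Type*} [TopologicalSpace N] [ChartedSpace HN N]
  {EN' : Type*} [NormedAddCommGroup EN'] [NormedSpace ℝ EN']
  {HN' : Type*} [TopologicalSpace HN'] {I' : ModelWithCorners ℝ EN' HN'}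
  {N' : Type*} [TopologicalSpace N'] [ChartedSpace HN' N']
  {φ : N → N'} {σ : N' → N}

theorem mfderiv_comp_inverse (hφ : ContMDiff I I' ∞ φ) (hσ : ContMDiff I' I ∞ σ)
    (h : ∀ x, σ (φ x) = x) (x : N) :
    (mfderiv I' I σ (φ x) : EN' →L[ℝ] EN) ∘L (mfderiv I I' φ x : EN →L[ℝ] EN') =
      ContinuousLinearMap.id ℝ EN := by
  have h1 : mfderiv I I (σ ∘ φ) x = _ :=
    mfderiv_comp x ((hσ (φ x)).mdifferentiableAt (by simp)) ((hφ x).mdifferentiableAt (by simp))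
  have h2 : σ ∘ φ = id := funext h
  have h3 : (mfderiv I I (σ ∘ φ) x : EN →L[ℝ] EN) = ContinuousLinearMap.id ℝ EN := by
    rw [h2]
    exact mfderiv_id
  exact h1.symm.trans h3

/-- Tensors that are related by a diffeomorphism are related by its inverse. -/
theorem IsRelated.symm_of_inverse {J : JacobiStructure I N} {K : JacobiStructure I' N'}
    (h : IsRelated φ J K) (hφ : ContMDiff I I' ∞ φ) (hσ : ContMDiff I' I ∞ σ)
    (hσφ : ∀ x, σ (φ x) = x) (hφσ : ∀ y, φ (σ y) = y) : IsRelated σ K J := by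
  intro y
  obtain ⟨x, rfl⟩ : ∃ x, y = φ x := ⟨σ y, (hφσ y).symm⟩
  have hd := mfderiv_comp_inverse hφ hσ hσφ x
  obtain ⟨hE, hΛ⟩ := h x
  rw [hE, hΛ]
  -- All tangent spaces are the model space. Seen as functions with a fixed codomain, the tensors
  -- can be transported along `σ (φ x) = x`.
  let E : N → EN := J.E
  let L : N → (Dual ℝ EN [⋀^Fin 2]→ₗ[ℝ] ℝ) := J.Λ
  have hE' : E (σ (φ x)) = E x := congrArg E (hσφ x)
  have hL' : L (σ (φ x)) = L x := congrArg L (hσφ x)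
  refine ⟨hE'.trans (DFunLike.congr_fun hd (E x)).symm, hL'.trans ?_⟩
  ext v
  refine congrArg (L x) (funext fun i => ?_)
  refine LinearMap.ext fun w => ?_
  exact congrArg (v i) (DFunLike.congr_fun hd w).symm

/-- The pushed-forward tensors are related to `J` by the inverse `σ`, and every function on `N'`
factors through `σ`, so `JacobiStructure.ofRelated` applies. -/
theorem existsUnique_isRelated [I'.Boundaryless] [FiniteDimensional ℝ EN'] {S : Set (N' → ℝ)}
    (hS : ContainsCoordinates I' S) (hφ : ContMDiff I I' ∞ φ) (hσ : ContMDiff I' I ∞ σ)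
    (hσφ : ∀ x, σ (φ x) = x) (hφσ : ∀ y, φ (σ y) = y) (J : JacobiStructure I N) :
    ∃! K : JacobiStructure I' N', IsRelated φ J K := by
  refine existsUnique_of_exists_of_unique ?_ fun K K' hK hK' => ?_
  · have hd : ∀ y, (mfderiv I' I σ y : EN' →L[ℝ] EN) ∘L (mfderiv I I' φ (σ y) : EN →L[ℝ] EN') =
        ContinuousLinearMap.id ℝ EN := fun y => by
      let D : N' → (EN' →L[ℝ] EN) := fun y => mfderiv I' I σ y
      have h1 := mfderiv_comp_inverse hφ hσ hσφ (σ y)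
      have h2 : D (φ (σ y)) = D y := congrArg D (hφσ y)
      exact (congrArg (fun T : EN' →L[ℝ] EN => T ∘L (mfderiv I I' φ (σ y) : EN →L[ℝ] EN'))
        h2).symm.trans h1
    let K : JacobiStructure I' N' := JacobiStructure.ofRelated hσ hS
      (fun f hf => ⟨f ∘ φ, (hS.smooth f hf).comp hφ, funext fun y => congrArg f (hφσ y)⟩) J
      (fun y => pushBivector I I' φ (σ y) (J.Λ (σ y)))
      (fun y => (mfderiv I I' φ (σ y) (J.E (σ y)) : EN'))
      (fun y => by
        ext v
        refine congrArg (J.Λ (σ y)) (funext fun i => ?_)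
        refine LinearMap.ext fun w => ?_
        exact congrArg (v i) (DFunLike.congr_fun (hd y) w).symm)
      (fun y => (DFunLike.congr_fun (hd y) (J.E (σ y))).symm)
    have hK : IsRelated σ K J := fun y => ⟨(DFunLike.congr_fun (hd y) (J.E (σ y))).symm, by
        ext v
        refine congrArg (J.Λ (σ y)) (funext fun i => ?_)
        refine LinearMap.ext fun w => ?_
        exact congrArg (v i) (DFunLike.congr_fun (hd y) w).symm⟩
    exact ⟨K, hK.symm_of_inverse hσ hφ hφσ hσφ⟩
  · have hΛ : K.Λ = K'.Λ := funext fun y => by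
      obtain ⟨x, rfl⟩ : ∃ x, y = φ x := ⟨σ y, (hφσ y).symm⟩
      rw [(hK x).2, (hK' x).2]
    have hE : K.E = K'.E := funext fun y => by
      obtain ⟨x, rfl⟩ : ∃ x, y = φ x := ⟨σ y, (hφσ y).symm⟩
      rw [(hK x).1, (hK' x).1]
    exact JacobiStructure.ext hΛ hE

/-- The Jacobi structures on diffeomorphic manifolds correspond to one another. -/
theorem exists_equiv_isRelated [I.Boundaryless] [FiniteDimensional ℝ EN] [I'.Boundaryless]
    [FiniteDimensional ℝ EN'] {S : Set (N → ℝ)} {S' : Set (N' → ℝ)}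
    (hS : ContainsCoordinates I S) (hS' : ContainsCoordinates I' S') (hφ : ContMDiff I I' ∞ φ)
    (hσ : ContMDiff I' I ∞ σ) (hσφ : ∀ x, σ (φ x) = x) (hφσ : ∀ y, φ (σ y) = y) :
    ∃ Ψ : JacobiStructure I N ≃ JacobiStructure I' N', ∀ J K, IsRelated φ J K ↔ K = Ψ J := by
  have h1 := existsUnique_isRelated hS' hφ hσ hσφ hφσ
  have h2 : ∀ K, ∃! J, IsRelated φ J K := fun K => by
    obtain ⟨J, hJ, huniq⟩ := existsUnique_isRelated hS hσ hφ hφσ hσφ K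
    exact ⟨J, hJ.symm_of_inverse hσ hφ hφσ hσφ, fun J' hJ' =>
      huniq J' (hJ'.symm_of_inverse hφ hσ hσφ hφσ)⟩
  choose Ψ hΨ huniq using h1
  choose Ψ' hΨ' huniq' using h2
  exact ⟨⟨Ψ, Ψ', fun J => (huniq' _ J (hΨ J)).symm, fun K => (huniq _ K (hΨ' K)).symm⟩,
    fun J K => ⟨huniq J K, fun h => h ▸ hΨ J⟩⟩

end Diffeomorphisms

/-! ### Linear Poisson tensors on the product with `ℝ ∖ {0}` -/

section ProductNonzero

variable {EM : Type*} [NormedAddCommGroup EM] [NormedSpace ℝ EM]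
  {M : Type*} [TopologicalSpace M] [ChartedSpace EM M]

theorem smooth_tCoord : SmoothFun (𝓘(ℝ, EM).prod 𝓘(ℝ, ℝ)) (tCoord (M := M)) :=
  (contMDiff_subtype_val (U := NonzeroReal)).comp contMDiff_snd

theorem tCoord_ne_zero (q : M × NonzeroReal) : tCoord q ≠ 0 := q.2.2

theorem smooth_comp_fst {f : M → ℝ} (hf : SmoothFun 𝓘(ℝ, EM) f) :
    SmoothFun (𝓘(ℝ, EM).prod 𝓘(ℝ, ℝ)) (fun q : M × NonzeroReal => f q.1) := hf.comp contMDiff_fst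

theorem tMul_eq (f : M → ℝ) : tMul f = tCoord * fun q : M × NonzeroReal => f q.1 := rfl

theorem smooth_tMul {f : M → ℝ} (hf : SmoothFun 𝓘(ℝ, EM) f) :
    SmoothFun (𝓘(ℝ, EM).prod 𝓘(ℝ, ℝ)) (tMul f) := smooth_tCoord.mul (smooth_comp_fst hf)

theorem contMDiff_slice_fst (t : NonzeroReal) :
    ContMDiff 𝓘(ℝ, EM) (𝓘(ℝ, EM).prod 𝓘(ℝ, ℝ)) ∞ (fun x : M => (x, t)) :=
  contMDiff_id.prodMk contMDiff_const

theorem contMDiff_slice_snd (x : M) :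
    ContMDiff 𝓘(ℝ, ℝ) (𝓘(ℝ, EM).prod 𝓘(ℝ, ℝ)) ∞ (fun t : NonzeroReal => (x, t)) :=
  contMDiff_const.prodMk contMDiff_id

theorem lieFun_liftVectorField (X : ∀ x : M, TangentSpace 𝓘(ℝ, EM) x) {G : M × NonzeroReal → ℝ}
    (hG : SmoothFun (𝓘(ℝ, EM).prod 𝓘(ℝ, ℝ)) G) (q : M × NonzeroReal) :
    lieFun (liftVectorField 𝓘(ℝ, EM) X) G q = lieFun X (fun x => G (x, q.2)) q.1 :=
  (dif_comp_apply (φ := fun x : M => (x, q.2)) (x := q.1) (hG.mdifferentiableAt q)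
    ((contMDiff_slice_fst q.2 q.1).mdifferentiableAt (by simp)) (X q.1)).symm

theorem pairing_liftBivectorField (Λ : ∀ x : M, Bivector 𝓘(ℝ, EM) x) {G G' : M × NonzeroReal → ℝ}
    (hG : SmoothFun (𝓘(ℝ, EM).prod 𝓘(ℝ, ℝ)) G) (hG' : SmoothFun (𝓘(ℝ, EM).prod 𝓘(ℝ, ℝ)) G')
    (q : M × NonzeroReal) :
    pairing (liftBivectorField 𝓘(ℝ, EM) Λ) G G' q =
      pairing Λ (fun x => G (x, q.2)) (fun x => G' (x, q.2)) q.1 := by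
  have hs := (contMDiff_slice_fst (EM := EM) q.2 q.1).mdifferentiableAt (by simp)
  have h1 := dif_comp (f := G) (x := q.1) (hG.mdifferentiableAt q) hs
  have h2 := dif_comp (f := G') (x := q.1) (hG'.mdifferentiableAt q) hs
  refine (altBilin_pushBivector (φ := fun x : M => (x, q.2)) q.1 (Λ q.1) _ _).trans ?_
  exact (congrArg₂ (fun α β => altBilin (Λ q.1) α β) h1 h2).symm

theorem lieFun_partialT_comp_fst {f : M → ℝ} (hf : SmoothFun 𝓘(ℝ, EM) f) :
    lieFun (partialT 𝓘(ℝ, EM)) (fun q : M × NonzeroReal => f q.1) = 0 := by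
  ext q
  have h := dif_comp_apply (f := fun q : M × NonzeroReal => f q.1) (x := q.2)
    (φ := fun t : NonzeroReal => (q.1, t)) ((smooth_comp_fst hf).mdifferentiableAt q)
    ((contMDiff_slice_snd (EM := EM) q.1 q.2).mdifferentiableAt (by simp)) (1 : ℝ)
  refine h.symm.trans ?_
  have h1 : (fun q : M × NonzeroReal => f q.1) ∘ (fun t : NonzeroReal => (q.1, t)) =
    fun _ => f q.1 := rfl
  rw [h1, dif_const]
  rfl

variable [FiniteDimensional ℝ EM]

theorem lieFun_partialT_tCoord :
    lieFun (partialT 𝓘(ℝ, EM)) (tCoord (M := M)) = 1 := by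
  ext q
  have h := dif_comp_apply (f := tCoord (M := M)) (x := q.2)
    (φ := fun t : NonzeroReal => (q.1, t)) (smooth_tCoord.mdifferentiableAt q)
    ((contMDiff_slice_snd (EM := EM) q.1 q.2).mdifferentiableAt (by simp)) (1 : ℝ)
  refine h.symm.trans ?_
  have h1 : dif 𝓘(ℝ, ℝ) (tCoord (M := M) ∘ fun t : NonzeroReal => (q.1, t)) q.2 = LinearMap.id :=
    dif_coord (c := (LinearMap.id : Dual ℝ ℝ)) (contMDiff_subtype_val (U := NonzeroReal))
      (Filter.Eventually.of_forall fun _ => rfl)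
  rw [h1]
  rfl

/-- The vector field `t ∂/∂t`. -/
def eulerT (EM : Type*) [NormedAddCommGroup EM] [NormedSpace ℝ EM] {M : Type*} [TopologicalSpace M]
    [ChartedSpace EM M] (q : M × NonzeroReal) : TangentSpace (𝓘(ℝ, EM).prod 𝓘(ℝ, ℝ)) q :=
  tCoord q • partialT 𝓘(ℝ, EM) q

theorem lieFun_eulerT (G : M × NonzeroReal → ℝ) :
    lieFun (eulerT EM) G = tCoord * lieFun (partialT 𝓘(ℝ, EM)) G :=
  funext fun _ => map_smul _ _ _

/-- The bivector field `t⁻¹ Λ + ∂/∂t ∧ E`. -/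
def poissonizationBivector (K : JacobiStructure 𝓘(ℝ, EM) M) (q : M × NonzeroReal) :
    Bivector (𝓘(ℝ, EM).prod 𝓘(ℝ, ℝ)) q :=
  (tCoord q)⁻¹ • liftBivectorField 𝓘(ℝ, EM) K.Λ q +
    wedge _ (partialT 𝓘(ℝ, EM) q) (liftVectorField 𝓘(ℝ, EM) K.E q)

theorem pairing_poissonizationBivector (K : JacobiStructure 𝓘(ℝ, EM) M)
    {G G' : M × NonzeroReal → ℝ} (hG : SmoothFun (𝓘(ℝ, EM).prod 𝓘(ℝ, ℝ)) G)
    (hG' : SmoothFun (𝓘(ℝ, EM).prod 𝓘(ℝ, ℝ)) G') (q : M × NonzeroReal) :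
    pairing (poissonizationBivector K) G G' q =
      (tCoord q)⁻¹ * pairing K.Λ (fun x => G (x, q.2)) (fun x => G' (x, q.2)) q.1 +
      (lieFun (partialT 𝓘(ℝ, EM)) G q * lieFun K.E (fun x => G' (x, q.2)) q.1 -
        lieFun K.E (fun x => G (x, q.2)) q.1 * lieFun (partialT 𝓘(ℝ, EM)) G' q) := by
  rw [← pairing_liftBivectorField K.Λ hG hG' q, ← lieFun_liftVectorField K.E hG q,
    ← lieFun_liftVectorField K.E hG' q]
  simp only [lieFun_apply]
  have h := altBilin_wedge (partialT 𝓘(ℝ, EM) q) (liftVectorField 𝓘(ℝ, EM) K.E q)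
    (dif _ G q) (dif _ G' q)
  exact congrArg ((tCoord q)⁻¹ * pairing (liftBivectorField 𝓘(ℝ, EM) K.Λ) G G' q + ·) h

variable [IsManifold 𝓘(ℝ, EM) ∞ M] [T2Space M]

theorem containsCoordinates_product : ContainsCoordinates (𝓘(ℝ, EM).prod 𝓘(ℝ, ℝ))
    {G : M × NonzeroReal → ℝ | ∃ (f : M → ℝ) (r : ℝ), SmoothFun 𝓘(ℝ, EM) f ∧
      G = (fun q => f q.1) + r • tCoord} := by
  refine ⟨?_, fun p c => ?_⟩
  · rintro _ ⟨f, r, hf, rfl⟩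
    exact (smooth_comp_fst hf).add (smooth_tCoord.const_smul r)
  · refine ⟨_, ⟨baseCoord p.1 (c ∘ₗ LinearMap.inl ℝ EM ℝ), c (0, 1), smooth_baseCoord _ _, rfl⟩, ?_⟩
    filter_upwards [(continuous_fst.continuousAt (x := p)).eventually
      (baseCoord_eventuallyEq p.1 (c ∘ₗ LinearMap.inl ℝ EM ℝ))] with q h1
    rw [Pi.add_apply, h1, Pi.smul_apply, smul_eq_mul]
    have h2 : extChartAt (𝓘(ℝ, EM).prod 𝓘(ℝ, ℝ)) p q = (extChartAt 𝓘(ℝ, EM) p.1 q.1, tCoord q) := by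
      rw [extChartAt_prod]
      rfl
    rw [h2]
    have h3 : ((extChartAt 𝓘(ℝ, EM) p.1 q.1, tCoord q) : EM × ℝ) =
        (extChartAt 𝓘(ℝ, EM) p.1 q.1, 0) + tCoord q • (0, 1) := by simp
    rw [h3, map_add, map_smul, smul_eq_mul, mul_comm (tCoord q)]
    rfl

variable (EM M) in
-- The counterpart of `isHull_vectorHull`: the slice `t = 1` plays the role of the affine bundle and
-- `t` that of `iotaOne`, here nowhere zero.
theorem isHull_product : IsHull 𝓘(ℝ, EM) (𝓘(ℝ, EM).prod 𝓘(ℝ, ℝ))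
    (fun x : M => (x, (⟨1, one_ne_zero⟩ : NonzeroReal))) (eulerT EM)
    (⟨1, smoothFun_one⟩ : {f : M → ℝ // SmoothFun 𝓘(ℝ, EM) f}) (fun f => f.1)
    (fun f => tMul f.1) where
  smooth_incl := contMDiff_slice_fst _
  smooth_bar f := smooth_tMul f.2
  smooth_liouville := containsCoordinates_product.smoothVectorField <| by
    rintro _ ⟨f, r, hf, rfl⟩
    rw [lieFun_eulerT, lieFun_add _ (smooth_comp_fst hf) (smooth_tCoord.const_smul r),
      lieFun_partialT_comp_fst hf, zero_add]
    have h : lieFun (partialT 𝓘(ℝ, EM)) (r • tCoord (M := M)) = fun _ => r := by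
      ext q
      rw [lieFun_apply, dif_smul r (smooth_tCoord.mdifferentiableAt q), LinearMap.smul_apply,
        ← lieFun_apply, lieFun_partialT_tCoord]
      exact mul_one r
    rw [h]
    exact smooth_tCoord.mul (smoothFun_const r)
  lie_bar f := by
    rw [lieFun_eulerT, tMul_eq, lieFun_mul _ smooth_tCoord (smooth_comp_fst f.2),
      lieFun_partialT_comp_fst f.2, lieFun_partialT_tCoord]
    ring
  bar_comp f := funext fun _ => one_mul _
  fn_one := rfl
  ext_bar f g h := congrArg tMul h
  exists_add f g := ⟨⟨f.1 + g.1, f.2.add g.2⟩, rfl, funext fun _ => mul_add _ _ _⟩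
  coords := by
    rw [Subtype.range_coe_subtype]
    exact containsCoordinates_smooth
  coords' := containsCoordinates_product.mono containsCoordinates_product.smooth fun _ h => h
  dense := by
    convert dense_univ
    exact eq_univ_of_forall fun q => by simpa [tMul] using tCoord_ne_zero q
  span q _ c := by
    obtain ⟨_, ⟨f, r, hf, rfl⟩, hc⟩ := containsCoordinates_product.exists_dif_eq q c
    have ht := tCoord_ne_zero q
    -- A function with value `r` at `q.1` and differential `df` divided by the value of `t` at `q`,
    -- so that its product with `t` has differential `df + r dt` at `q`.
    have hg : SmoothFun 𝓘(ℝ, EM) ((tCoord q)⁻¹ • f + fun _ => r - (tCoord q)⁻¹ * f q.1) :=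
      (hf.const_smul _).add (smoothFun_const _)
    refine ⟨⟨_, hg⟩, ?_⟩
    have h1 : (fun q' : M × NonzeroReal =>
        ((tCoord q)⁻¹ • f + fun _ => r - (tCoord q)⁻¹ * f q.1 : M → ℝ) q'.1) =
      (tCoord q)⁻¹ • (fun q' : M × NonzeroReal => f q'.1) +
        fun _ => r - (tCoord q)⁻¹ * f q.1 := rfl
    rw [← hc, tMul_eq, dif_mul (smooth_tCoord.mdifferentiableAt q)
      ((smooth_comp_fst hg).mdifferentiableAt q), h1,
      dif_add (((smooth_comp_fst hf).const_smul _).mdifferentiableAt q)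
        ((smoothFun_const _).mdifferentiableAt q), dif_const, add_zero,
      dif_smul _ ((smooth_comp_fst hf).mdifferentiableAt q), smul_smul, mul_inv_cancel₀ ht,
      one_smul, dif_add ((smooth_comp_fst hf).mdifferentiableAt q)
        ((smooth_tCoord.const_smul r).mdifferentiableAt q),
      dif_smul r (smooth_tCoord.mdifferentiableAt q)]
    congr 2
    simp
  finrank_eq := by rw [finrank_prod, finrank_self]

/-- On `f + r t` and `g + s t` it gives `t⁻¹ Λ(df, dg) + r E(g) - s E(f)`. In contrast to positive
rank, `Λ(df, dg)` need not vanish, and smoothness depends on excluding `t = 0`. -/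
theorem smooth_poissonizationBivector (K : JacobiStructure 𝓘(ℝ, EM) M) :
    SmoothBivectorField (𝓘(ℝ, EM).prod 𝓘(ℝ, ℝ)) (poissonizationBivector K) := by
  refine containsCoordinates_product.smoothBivectorField ?_
  have hs : ∀ {f : M → ℝ} {r : ℝ}, SmoothFun 𝓘(ℝ, EM) f → SmoothFun (𝓘(ℝ, EM).prod 𝓘(ℝ, ℝ))
      ((fun q : M × NonzeroReal => f q.1) + r • tCoord) :=
    fun hf => (smooth_comp_fst hf).add (smooth_tCoord.const_smul _)
  have hT : ∀ {f : M → ℝ} {r : ℝ}, SmoothFun 𝓘(ℝ, EM) f →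
      lieFun (partialT 𝓘(ℝ, EM)) ((fun q : M × NonzeroReal => f q.1) + r • tCoord) =
        fun _ => r := fun {f r} hf => by
    ext q
    rw [lieFun_add _ (smooth_comp_fst hf) (smooth_tCoord.const_smul r),
      lieFun_partialT_comp_fst hf, zero_add, lieFun_apply,
      dif_smul r (smooth_tCoord.mdifferentiableAt q), LinearMap.smul_apply,
        ← lieFun_apply, lieFun_partialT_tCoord]
    exact mul_one r
  have hd : ∀ {f : M → ℝ} {r : ℝ}, SmoothFun 𝓘(ℝ, EM) f → ∀ (q : M × NonzeroReal),
      dif 𝓘(ℝ, EM) (fun x => ((fun q : M × NonzeroReal => f q.1) + r • tCoord :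
        M × NonzeroReal → ℝ) (x, q.2)) q.1 =
        dif 𝓘(ℝ, EM) f q.1 := fun {f r} hf q => by
    have h : (fun x => ((fun q : M × NonzeroReal => f q.1) + r • tCoord :
        M × NonzeroReal → ℝ) (x, q.2)) =
      f + fun _ => r * (q.2 : ℝ) := rfl
    rw [h, dif_add (hf.mdifferentiableAt _) ((smoothFun_const _).mdifferentiableAt _), dif_const,
      add_zero]
  rintro _ ⟨f, r, hf, rfl⟩ _ ⟨g, s, hg, rfl⟩
  have h : pairing (poissonizationBivector K) ((fun q : M × NonzeroReal => f q.1) + r • tCoord)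
      ((fun q : M × NonzeroReal => g q.1) + s • tCoord) =
      (fun q => (tCoord q)⁻¹) * (fun q => pairing K.Λ f g q.1) +
        (r • (fun q => lieFun K.E g q.1) - s • (fun q => lieFun K.E f q.1)) := by
    ext q
    rw [pairing_poissonizationBivector K (hs hf) (hs hg), hT hf, hT hg, pairing_apply, lieFun_apply,
      lieFun_apply, hd hf, hd hg, ← pairing_apply, ← lieFun_apply, ← lieFun_apply]
    simp only [Pi.add_apply, Pi.mul_apply, Pi.sub_apply, Pi.smul_apply, smul_eq_mul]
    ring
  rw [h]
  exact ((smooth_tCoord.inv₀ tCoord_ne_zero).mul (smooth_comp_fst (K.smoothΛ f g hf hg))).add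
    (((smooth_comp_fst (K.smoothE g hg)).const_smul r).sub
      ((smooth_comp_fst (K.smoothE f hf)).const_smul s))

omit [IsManifold 𝓘(ℝ, EM) ∞ M] [T2Space M] in
-- On the slice at height `t` both differentials are scaled by `t`, so `t⁻¹ Λ` contributes `t Λ(df,
-- dg)`; the wedge contributes `t (f E(g) - g E(f))`.
theorem pairing_poissonizationBivector_tMul (K : JacobiStructure 𝓘(ℝ, EM) M) {f g : M → ℝ}
    (hf : SmoothFun 𝓘(ℝ, EM) f) (hg : SmoothFun 𝓘(ℝ, EM) g) :
    pairing (poissonizationBivector K) (tMul f) (tMul g) = tMul (K.bracket f g) := by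
  have hT : ∀ {f : M → ℝ}, SmoothFun 𝓘(ℝ, EM) f → ∀ q : M × NonzeroReal,
      lieFun (partialT 𝓘(ℝ, EM)) (tMul f) q = f q.1 := fun {f} hf q => by
    rw [tMul_eq, lieFun_mul _ smooth_tCoord (smooth_comp_fst hf), lieFun_partialT_comp_fst hf,
      lieFun_partialT_tCoord]
    simp
  have hd : ∀ {f : M → ℝ}, SmoothFun 𝓘(ℝ, EM) f → ∀ q : M × NonzeroReal,
      dif 𝓘(ℝ, EM) (fun x => tMul f (x, q.2)) q.1 = tCoord q • dif 𝓘(ℝ, EM) f q.1 :=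
    fun hf q => dif_smul (tCoord q) (hf.mdifferentiableAt q.1)
  ext q
  have ht := tCoord_ne_zero q
  rw [pairing_poissonizationBivector K (smooth_tMul hf) (smooth_tMul hg), hT hf, hT hg,
    pairing_apply, lieFun_apply, lieFun_apply, hd hf, hd hg, tMul, JacobiStructure.bracket_apply,
    pairing_apply, lieFun_apply, lieFun_apply]
  simp only [map_smul, LinearMap.smul_apply, smul_eq_mul]
  field_simp
  ring

variable (EM M) in
/-- The Poissonization is a one-to-one correspondence between Jacobi structures and linear Poisson
tensors. -/
theorem exists_equiv_jacobi_linearPoisson :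
    ∃ Φ : JacobiStructure 𝓘(ℝ, EM) M ≃ LinearPoisson 𝓘(ℝ, EM) M, ∀ K,
      (∀ P, P = Φ K ↔ ∀ f g : M → ℝ, SmoothFun 𝓘(ℝ, EM) f → SmoothFun 𝓘(ℝ, EM) g →
        P.1.bracket (tMul f) (tMul g) = tMul (K.bracket f g)) ∧
      (Φ K).1.Λ = poissonizationBivector K := by
  obtain ⟨Φ, hΦ, -⟩ := (isHull_product EM M).exists_equiv (p := fun _ => True)
    (q := fun P => IsLinearBivector P.Λ)
    (fun K => ⟨fun _ f g => ⟨⟨_, K.smooth_bracket f.2 g.2⟩, rfl⟩, fun _ => trivial⟩)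
    (fun P => ⟨fun h f g => (h f.1 g.1 f.2 g.2).elim fun k hk => ⟨⟨k, hk.1⟩, hk.2⟩,
      fun h f g hf hg => (h ⟨f, hf⟩ ⟨g, hg⟩).elim fun k hk => ⟨k.1, k.2, hk⟩⟩)
    (fun K _ => ⟨poissonizationBivector K, smooth_poissonizationBivector K, fun f g =>
      ⟨⟨_, K.smooth_bracket f.2 g.2⟩, pairing_poissonizationBivector_tMul K f.2 g.2, rfl⟩⟩)
  have hchar : ∀ K P, P = Φ ⟨K, trivial⟩ ↔ ∀ f g : M → ℝ, SmoothFun 𝓘(ℝ, EM) f →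
      SmoothFun 𝓘(ℝ, EM) g → P.1.bracket (tMul f) (tMul g) = tMul (K.bracket f g) := by
    intro K P
    rw [hΦ]
    refine ⟨fun h f g hf hg => ?_, fun h f g x => ?_⟩
    -- The abstract correspondence compares brackets only at `t = 1`; linearity of `P` extends the
    -- equality to all `t`.
    · obtain ⟨k, -, hk⟩ := P.2 f g hf hg
      have hk' : K.bracket f g = k := funext fun x => by
        rw [h ⟨f, hf⟩ ⟨g, hg⟩ x, PoissonStructure.bracket, hk]
        exact one_mul _
      rw [hk']
      exact hk
    · rw [h f.1 g.1 f.2 g.2]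
      exact (one_mul _).symm
  refine ⟨(Equiv.subtypeUnivEquiv fun _ => trivial).symm.trans Φ, fun K => ⟨hchar K, ?_⟩⟩
  refine (isHull_product EM M).bivector_ext (Φ ⟨K, trivial⟩).1.smoothΛ
    (smooth_poissonizationBivector K) fun f g => ?_
  rw [pairing_poissonizationBivector_tMul K f.2 g.2]
  exact (hchar K _).1 rfl f.1 g.1 f.2 g.2

end ProductNonzero

/-! ### Affine bundles of rank zero -/

section RankZeroBundles

variable (EM : Type*) [NormedAddCommGroup EM] [NormedSpace ℝ EM] [FiniteDimensional ℝ EM]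
  (M : Type*) [TopologicalSpace M] [ChartedSpace EM M] [IsManifold 𝓘(ℝ, EM) ∞ M] [T2Space M]
  (F : Type*) [NormedAddCommGroup F] [NormedSpace ℝ F] [FiniteDimensional ℝ F]
  {V : M → Type*} [∀ x, AddCommGroup (V x)] [∀ x, Module ℝ (V x)]
  (A : M → Type*) [∀ x, AddTorsor (V x) (A x)]
  [TopologicalSpace (TotalSpace F A)] [∀ x, TopologicalSpace (A x)]
  [FiberBundle F A] [IsSmoothAffineBundle F A 𝓘(ℝ, EM)]

omit [FiniteDimensional ℝ EM] [IsManifold 𝓘(ℝ, EM) ∞ M] [T2Space M] in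
-- Each fibre is a single point, so the trivialization used to define the point is irrelevant, and
-- near `x` one trivialization can be used throughout.
theorem smooth_fibrePoint_zero (hF : finrank ℝ F = 0) :
    ContMDiff 𝓘(ℝ, EM) (𝓘(ℝ, EM).prod 𝓘(ℝ, F)) ∞ (fun x => fibrePoint F A x 0) ∧
      ∀ p : TotalSpace F A, fibrePoint F A p.1 0 = p := by
  have hsub : Subsingleton F := finrank_zero_iff.1 hF
  have h1 : ∀ p : TotalSpace F A, fibrePoint F A p.1 0 = p := fun p => by
    obtain ⟨v, hv⟩ := exists_fibrePoint_eq p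
    rw [Subsingleton.elim 0 v]
    exact hv.symm
  refine ⟨fun x => ?_, h1⟩
  have h2 : (fun x => fibrePoint F A x 0) = fun y =>
      ⟨y, (fibreAff F A (trivializationAt F A x) y).symm 0⟩ := funext fun y => (h1 ⟨y, _⟩)
  rw [h2]
  exact contMDiffAt_fibreAff_symm contMDiffAt_id contMDiffAt_const
    (mem_baseSet_trivializationAt F A x)

theorem exists_equiv_affineJacobi_linearPoisson (hF : finrank ℝ F = 0) :
    (∀ J : AffineJacobi 𝓘(ℝ, EM) F A, ∃! K : JacobiStructure 𝓘(ℝ, EM) M,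
      IsRelated (π F A) J.1 K) ∧
    ∃ Φ : AffineJacobi 𝓘(ℝ, EM) F A ≃ LinearPoisson 𝓘(ℝ, EM) M,
      ∀ (J : AffineJacobi 𝓘(ℝ, EM) F A) (K : JacobiStructure 𝓘(ℝ, EM) M),
        IsRelated (π F A) J.1 K →
        (∀ P, P = Φ J ↔ ∀ f g : M → ℝ, SmoothFun 𝓘(ℝ, EM) f → SmoothFun 𝓘(ℝ, EM) g →
          P.1.bracket (tMul f) (tMul g) = tMul (K.bracket f g)) ∧
        (Φ J).1.Λ = poissonizationBivector K := by
  obtain ⟨hσ, hσπ⟩ := smooth_fibrePoint_zero EM M F A hF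
  have hπσ : ∀ x, π F A (fibrePoint F A x 0) = x := fun _ => rfl
  have hπ : ContMDiff (𝓘(ℝ, EM).prod 𝓘(ℝ, F)) 𝓘(ℝ, EM) ∞ (π F A) := contMDiff_proj A
  refine ⟨fun J => existsUnique_isRelated containsCoordinates_smooth hπ hσ hσπ hπσ J.1, ?_⟩
  -- A function on a single point is affine, so the affinity condition is empty and Jacobi
  -- structures transfer along the diffeomorphism `π`.
  have haff : ∀ J : JacobiStructure (𝓘(ℝ, EM).prod 𝓘(ℝ, F)) (TotalSpace F A),
      IsAffineJacobi J := fun J a b =>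
    ⟨⟨fun x => AffineMap.const ℝ (A x) (J.bracket a.fn b.fn (fibrePoint F A x 0)), by
      simp only [AffineMap.const_apply]
      have h := J.smooth_bracket a.smooth b.smooth
      exact (h.comp hσ).comp hπ⟩, funext fun p => congrArg (J.bracket a.fn b.fn) (hσπ p).symm⟩
  obtain ⟨Ψ, hΨ⟩ := exists_equiv_isRelated (containsCoordinates_affine (A := A) (EM := EM))
    containsCoordinates_smooth hπ hσ hσπ hπσ
  obtain ⟨Φ, hΦ⟩ := exists_equiv_jacobi_linearPoisson EM M
  refine ⟨(Equiv.subtypeUnivEquiv haff).trans (Ψ.trans Φ), fun J K hJK => ?_⟩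
  rw [hΨ] at hJK
  subst hJK
  exact hΦ (Ψ J.1)

end RankZeroBundles

end

theorem corollary3p9
    {EM : Type*} [NormedAddCommGroup EM] [NormedSpace ℝ EM] [FiniteDimensional ℝ EM]
    {M : Type*} [TopologicalSpace M] [ChartedSpace EM M] [IsManifold 𝓘(ℝ, EM) ∞ M]
    [T2Space M] [SecondCountableTopology M]
    {F : Type*} [NormedAddCommGroup F] [NormedSpace ℝ F] [FiniteDimensional ℝ F]
    {V : M → Type*} [∀ x, AddCommGroup (V x)] [∀ x, Module ℝ (V x)]
    {A : M → Type*} [∀ x, AddTorsor (V x) (A x)]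
    [TopologicalSpace (TotalSpace F A)] [∀ x, TopologicalSpace (A x)]
    [FiberBundle F A] [IsSmoothAffineBundle F A 𝓘(ℝ, EM)] :
    (0 < Module.finrank ℝ F →
      ∃ Φ : AffineJacobi 𝓘(ℝ, EM) F A ≃ HomogeneousPoisson 𝓘(ℝ, EM) F A,
        (∀ J P, P = Φ J ↔ ∀ (a b : AffineFunction 𝓘(ℝ, EM) F A) (p : TotalSpace F A),
          J.1.bracket a.fn b.fn p = P.1.bracket a.bar b.bar (inclHull F A p)) ∧
        ∀ J, ∃ K : JacobiStructure (𝓘(ℝ, EM).prod 𝓘(ℝ, ℝ × F)) (TotalSpace (ℝ × F) (Hull F A)),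
          K.E = hamOne (Φ J).1.Λ ∧
          (K.Λ = fun ψ => (Φ J).1.Λ ψ - wedge _ (liouville 𝓘(ℝ, EM) F A ψ) (K.E ψ)) ∧
          IsRelated (inclHull F A) J.1 K) ∧
    (Module.finrank ℝ F = 0 →
      (∀ J : AffineJacobi 𝓘(ℝ, EM) F A, ∃! K : JacobiStructure 𝓘(ℝ, EM) M,
        IsRelated (π F A) J.1 K) ∧
      ∃ Φ : AffineJacobi 𝓘(ℝ, EM) F A ≃ LinearPoisson 𝓘(ℝ, EM) M,
        ∀ (J : AffineJacobi 𝓘(ℝ, EM) F A) (K : JacobiStructure 𝓘(ℝ, EM) M),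
          IsRelated (π F A) J.1 K →
          (∀ P, P = Φ J ↔ ∀ f g : M → ℝ, SmoothFun 𝓘(ℝ, EM) f → SmoothFun 𝓘(ℝ, EM) g →
            P.1.bracket (tMul f) (tMul g) = tMul (K.bracket f g)) ∧
          (Φ J).1.Λ = fun q => (tCoord q)⁻¹ • liftBivectorField 𝓘(ℝ, EM) K.Λ q +
            wedge _ (partialT 𝓘(ℝ, EM) q) (liftVectorField 𝓘(ℝ, EM) K.E q)) :=
  ⟨exists_equiv_affineJacobi_homogeneousPoisson EM M F A,
    exists_equiv_affineJacobi_linearPoisson EM M F A⟩
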